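/- **Timed Petri nets.** A *timed Petri net* (TPN) $N=(P,T,\mathit{In},\mathit{Out})$ has finite sets $P$ of places and $T$ of transitions, and partial functions $\mathit{In},\mathit{Out}$ from $T\times P$ to intervals of nonnegative reals with lower end point in $\mathbb N$ and upper end point in $\mathbb N\cup\{\infty\}$, open or closed at each end. Let $\mathit{max}$ be the largest finite constant on its arcs ($0$ if there are no arcs). A marking is a finite multiset over $P\times\mathbb R_{\ge 0}$. A timed transition with delay $d\ge 0$ adds $d$ to the age of every token. A discrete transition $t\in T$ removes one token $(p,x)$ with $x\in\mathit{In}(t,p)$ for each $p$ where $\mathit{In}(t,p)$ is defined and adds one token $(p,y)$ with $y\in\mathit{Out}(t,p)$ for each $p$ where $\mathit{Out}(t,p)$ is defined. $\mathit{Pre}^*(S)$ is the set of markings from which some marking in $S$ is reachable by finitely many timed and discrete transitions. An *infinite computation* is an infinite sequence of transitions containing infinitely many discrete ones; $\Delta(\pi)$ is the sum of its delays. $\mathit{ZENO}$ is the set of markings $M$ from which some infinite computation $\pi$ with $\Delta(\pi)\le m$ for some finite $m$ starts. **Regions.** A *region* is a triple $(b_0,\,b_1\bullet\dots\bullet b_n,\,b_{\mathit{max}})$,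 where $b_0$ is a finite multiset over $P\times\{0,\dots,\mathit{max}\}$, the $b_i$ ($1\le i\le n$) are nonempty finite multisets over $P\times\{0,\dots,\mathit{max}-1\}$, and $b_{\mathit{max}}$ is a finite multiset over $P$. It describes the markings consisting of a token $(p,k)$ for each $(p,k)$ in $b_0$, a token $(p,k+f_i)$ for each $(p,k)$ in $b_i$, where $0<f_1<\dots<f_n<1$ are some reals, and a token of some age $>\mathit{max}$ on $p$ for each $p$ in $b_{\mathit{max}}$. A *multi-region upward closure* (MRUC) is a finite set of regions; its denotation $[\![\cdot]\!]$ is the set of all markings that contain a sub-marking described by one of its regions. Unions, intersections and $\mathit{Pre}^*$ of MRUCs are MRUCs whose denotations are the union, the intersection and $\mathit{Pre}^*$ of the denotations. **The untimed net $N'$.** Symbols are $k$ and $k+$ for $0\le k\le\mathit{max}$ and $k-$ for $1\le k\le\mathit{max}$, ordered by $k<k+<(k+1)-<k+1$; $\mathit{enc}(I)$ is the set of symbols that lie between the end points of the interval $I$ (strictly at an open end). The places of $N'$ are $p(s)$ for $p\in P$ and symbols $s$, and $p_{disc},p_{time1},p_{time2},p_{count},p_{dump}$; its markings $M'$ map places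 to $\mathbb N$. An ordinary transition with input set $A$ and output set $B$ is enabled if all places of $A$ are nonempty; it removes one token from each place in $A\setminus B$ and adds one to each place in $B\setminus A$. The ordinary transitions are: - for $t\in T$ and any choice of $s_p\in\mathit{enc}(\mathit{In}(t,p))$ and $s'_p\in\mathit{enc}(\mathit{Out}(t,p))$ for the input and output places $p$ of $t$, one with input set $\{p(s_p)\}_p\cup\{p_{disc}\}$ and output set $\{p(s'_p)\}_p\cup\{p_{disc},p_{count}\}$; - one from $\{p_{disc},p_{count}\}$ to $\{p_{time1}\}$ and one from $\{p_{time2}\}$ to $\{p_{disc}\}$; - for $p\in P$ and $1\le k\le\mathit{max}$, one from $\{p_{time2},p(k-)\}$ to $\{p_{time2},p(k)\}$ and one from $\{p_{time2},p(k-)\}$ to $\{p_{time2},p(k+)\}$. In addition there is one transfer transition, which moves one token from $p_{time1}$ to $p_{time2}$ and simultaneously all tokens from $p(k)$ to $p(k+)$, for all $p\in P$ and $0\le k\le\mathit{max}$, and from $p_{count}$ to $p_{dump}$. Let $\mathit{INF}$ be the set of markings of $N'$ from which an infinite computation of $N'$ starts, and let $\mathit{INF}'_{min}$ be the set of those minimal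 elements of $\mathit{INF}$ (componentwise order) that are standard, i.e. satisfy $M'(p_{disc})=1$ and $M'(p_{time1})=M'(p_{time2})=M'(p_{count})=0$. **The MRUC $Z$.** For a marking $M'$ of $N'$ let $\mathit{perm}(M'^-)$ (resp. $\mathit{perm}(M'^+)$) be the set of words $b_1\bullet\dots\bullet b_n$ of nonempty finite multisets over $P\times\{0,\dots,\mathit{max}-1\}$ with $\sum_i b_i((p,k))=M'(p((k+1)-))$ (resp. $=M'(p(k+))$) for all $p\in P$ and $k<\mathit{max}$. Let $\mathit{Reg}(M',w_+,w_-)$ be the region $(b_0,w_+\bullet w_-,b_{\mathit{max}})$ with $b_0((p,k))=M'(p(k))$ and $b_{\mathit{max}}(p)=M'(p(\mathit{max}+))$. Put $$Z:=\bigcup_{M'\in\mathit{INF}'_{min}}\ \bigcup_{w_+\in\mathit{perm}(M'^+)}\ \bigcap_{w_-\in\mathit{perm}(M'^-)}\mathit{Pre}^*(\{\mathit{Reg}(M',w_+,w_-)\}).$$ **Statement.** For every TPN $N$, this defines an MRUC $Z$ (each $\mathit{Pre}^*(\{\mathit{Reg}(M',w_+,w_-)\})$ is denoted by an MRUC, and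 so is the whole expression), and $[\![Z]\!]=\mathit{ZENO}$. -/

import Mathlib

open scoped NNReal ENNReal

namespace TimedPetri

/-! ## Timed Petri nets -/

/-- Intervals of nonnegative reals with a natural lower end point and an upper end point that is
a natural number or infinity; each end may be closed or open. -/
structure Intrv where
  lower : ℕ
  lowerClosed : Bool
  upper : ℕ∞
  upperClosed : Bool

/-- Membership of a nonnegative real in an interval. -/
def Intrv.Mem (I : Intrv) (x : ℝ≥0) : Prop :=
  (if I.lowerClosed then (I.lower : ℝ≥0) ≤ x else (I.lower : ℝ≥0) < x) ∧
    ∀ b : ℕ, I.upper = b → if I.upperClosed then x ≤ (b : ℝ≥0) else x < (b : ℝ≥0)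

/-- The largest finite constant written in an interval. -/
def Intrv.maxConst (I : Intrv) : ℕ := max I.lower (WithTop.untopD 0 I.upper)

/-- A timed Petri net with places `P` and transitions `T`. Arcs are partial functions. -/
structure TPN (P T : Type*) where
  arcIn : T → P → Option Intrv
  arcOut : T → P → Option Intrv

/-- A marking is a finite multiset of tokens, a token being a place with an age. -/
abbrev Marking (P : Type*) := Multiset (P × ℝ≥0)

/-- Labels of transitions: the passing of `d` time units, or the firing of `t`. -/
inductive Label (T : Type*) where
  | time (d : ℝ≥0)
  | disc (t : T)

/-- The time taken by a transition. -/
def Label.delay {T : Type*} : Label T → ℝ≥0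
  | .time d => d
  | .disc _ => 0

section Semantics

variable {P T : Type*} [Fintype P]

/-- One token `(p, x p)` for every arc in `arcs`. -/
def arcTokens (arcs : P → Option Intrv) (x : P → ℝ≥0) : Marking P :=
  (Finset.univ.filter fun p => (arcs p).isSome = true).val.map fun p => (p, x p)

/-- The transition relation `M₁ → M₂` with a label. A timed transition adds `d` to the age of
every token. A discrete transition removes one token per input arc and adds one token per output
arc, with ages in the respective intervals. -/
def Step (N : TPN P T) : Label T → Marking P → Marking P → Prop
  | .time d, M₁, M₂ => M₂ = M₁.map fun τ => (τ.1, τ.2 + d)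
  | .disc t, M₁, M₂ => ∃ (x y : P → ℝ≥0) (C : Marking P),
      (∀ p I, N.arcIn t p = some I → I.Mem (x p)) ∧
      (∀ p I, N.arcOut t p = some I → I.Mem (y p)) ∧
      M₁ = C + arcTokens (N.arcIn t) x ∧ M₂ = C + arcTokens (N.arcOut t) y

/-- `Pre*(S)`: the markings from which a marking in `S` is reachable by timed and discrete
transitions. -/
def preStar (N : TPN P T) (S : Set (Marking P)) : Set (Marking P) :=
  {M | ∃ M' ∈ S, Relation.ReflTransGen (fun M₁ M₂ => ∃ l, Step N l M₁ M₂) M M'}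

/-- An infinite computation: an infinite sequence of transitions, infinitely many of which are
discrete (the mere passing of time, cut into infinitely many pieces, is not one). -/
structure InfComputation (N : TPN P T) where
  state : ℕ → Marking P
  label : ℕ → Label T
  step : ∀ i, Step N (label i) (state i) (state (i + 1))
  disc_often : ∀ n, ∃ i, n ≤ i ∧ ∃ t, label i = .disc t

/-- The total delay of an infinite computation. -/
noncomputable def InfComputation.totalDelay {N : TPN P T} (π : InfComputation N) : ℝ≥0∞ :=
  ∑' i, ((π.label i).delay : ℝ≥0∞)

/-- The markings with an infinite computation of total delay at most `m`. -/
def zenoWithin (N : TPN P T) (m : ℝ≥0) : Set (Marking P) :=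
  {M | ∃ π : InfComputation N, π.state 0 = M ∧ π.totalDelay ≤ m}

/-- The set ZENO of all zeno-markings. -/
def ZENO (N : TPN P T) : Set (Marking P) := ⋃ m : ℝ≥0, zenoWithin N m

/-- The maximal finite constant on the arcs of a net. -/
def TPN.maxConst [Fintype T] (N : TPN P T) : ℕ :=
  Finset.univ.sup fun a : T × P =>
    max ((N.arcIn a.1 a.2).elim 0 Intrv.maxConst) ((N.arcOut a.1 a.2).elim 0 Intrv.maxConst)

end Semantics

/-! ## Regions and multi-region upward closures -/

/-- Finite words of nonempty multisets over `P × {0, …, m-1}`. -/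
def Word (P : Type*) (m : ℕ) := {w : List (Multiset (P × Fin m)) // ∀ b ∈ w, b ≠ 0}

/-- Concatenation of words. -/
def Word.append {P : Type*} {m : ℕ} (u v : Word P m) : Word P m :=
  ⟨u.1 ++ v.1, fun b hb => (List.mem_append.1 hb).elim (u.2 b) (v.2 b)⟩

/-- A region `(b₀, w, b_max)`: `b₀` lists the tokens whose age is an integer at most `m`, `w`
lists the integer parts of the ages of the other tokens of age below `m`, in the order of
increasing fractional parts, and `bmax` lists the tokens of age above `m`. -/
structure Region (P : Type*) (m : ℕ) where
  b0 : Multiset (P × Fin (m + 1))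
  w : Word P m
  bmax : Multiset P

/-- The set of markings described by a region. -/
def Region.den {P : Type*} {m : ℕ} (R : Region P m) : Set (Marking P) :=
  {M | ∃ (f : Fin R.w.1.length → ℝ≥0) (B : Marking P),
    StrictMono f ∧ (∀ i, 0 < f i ∧ f i < 1) ∧
    B.map Prod.fst = R.bmax ∧ (∀ τ ∈ B, (m : ℝ≥0) < τ.2) ∧
    M = R.b0.map (fun q => (q.1, ((q.2 : ℕ) : ℝ≥0))) +
      ∑ i, (R.w.1.get i).map (fun q => (q.1, ((q.2 : ℕ) : ℝ≥0) + f i)) + B}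

/-- A multi-region upward closure is a finite set of regions. -/
abbrev MRUC (P : Type*) (m : ℕ) := Finset (Region P m)

/-- The set denoted by a multi-region upward closure: the markings that contain a marking of one
of the regions. -/
def MRUC.den {P : Type*} {m : ℕ} (Z : MRUC P m) : Set (Marking P) :=
  {M | ∃ R ∈ Z, ∃ M₀ ∈ R.den, M₀ ≤ M}

/-! ## Simultaneous-disjoint-transfer nets -/

/-- A simultaneous-disjoint-transfer net with places `Q` and ordinary transitions `U`; the
transfer transition is `(transIn, transOut, st)`. -/
structure SDTN (Q U : Type*) where
  input : U → Set Q
  output : U → Set Q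
  transIn : Set Q
  transOut : Set Q
  st : Set (Q × Q)
  source_ne_target : ∀ a ∈ st, ∀ b ∈ st, a.1 ≠ b.2
  pairwise_ne : ∀ a ∈ st, ∀ b ∈ st, a ≠ b → a.1 ≠ b.1 ∧ a.2 ≠ b.2
  notMem_trans : ∀ a ∈ st, a.1 ∉ transIn ∪ transOut ∧ a.2 ∉ transIn ∪ transOut

namespace SDTN

variable {Q U : Type*}

/-- Firing the ordinary transition `t`. -/
def Fires (N : SDTN Q U) (t : U) (M M' : Q → ℕ) : Prop :=
  (∀ p ∈ N.input t, 1 ≤ M p) ∧ ∀ p,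
    (p ∈ N.input t → p ∈ N.output t → M' p = M p) ∧
    (p ∈ N.input t → p ∉ N.output t → M' p = M p - 1) ∧
    (p ∉ N.input t → p ∈ N.output t → M' p = M p + 1) ∧
    (p ∉ N.input t → p ∉ N.output t → M' p = M p)

/-- Firing the transfer transition. -/
def FiresTrans (N : SDTN Q U) (M M' : Q → ℕ) : Prop :=
  (∀ p ∈ N.transIn, 1 ≤ M p) ∧ ∀ p,
    (p ∈ N.transIn → p ∈ N.transOut → M' p = M p) ∧
    (p ∈ N.transIn → p ∉ N.transOut → M' p = M p - 1) ∧
    (p ∉ N.transIn → p ∈ N.transOut → M' p = M p + 1) ∧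
    (∀ q, (p, q) ∈ N.st → M' p = 0) ∧
    (∀ q, (q, p) ∈ N.st → M' p = M p + M q) ∧
    (p ∉ N.transIn → p ∉ N.transOut → (∀ q, (p, q) ∉ N.st) → (∀ q, (q, p) ∉ N.st) →
      M' p = M p)

/-- One transition of the net. -/
def Step (N : SDTN Q U) (M M' : Q → ℕ) : Prop :=
  (∃ t, N.Fires t M M') ∨ N.FiresTrans M M'

/-- The markings from which an infinite computation starts. -/
def INF (N : SDTN Q U) : Set (Q → ℕ) :=
  {M | ∃ σ : ℕ → Q → ℕ, σ 0 = M ∧ ∀ i, N.Step (σ i) (σ (i + 1))}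

/-- The minimal elements of `INF` for the componentwise order. -/
def INFmin (N : SDTN Q U) : Set (Q → ℕ) := {M | Minimal (· ∈ N.INF) M}

end SDTN

/-! ## The net associated with a timed Petri net -/

/-- Symbolic ages: `exact k` is `k`, `plus k` is `k+` (both for `0 ≤ k ≤ m`), and `minus k` is
`(k+1)-` (for `0 ≤ k < m`). -/
inductive Sym (m : ℕ) where
  | exact (k : Fin (m + 1))
  | plus (k : Fin (m + 1))
  | minus (k : Fin m)

/-- The position of a symbol in the total order `k < k+ < (k+1)- < k+1`; the symbol `k` has
position `3 * k`. -/
def Sym.rank {m : ℕ} : Sym m → ℕ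
  | .exact k => 3 * k
  | .plus k => 3 * k + 1
  | .minus k => 3 * k + 2

/-- The encoding of an interval: the symbols between its end points. -/
def enc (m : ℕ) (I : Intrv) : Set (Sym m) :=
  {s | (if I.lowerClosed then 3 * I.lower ≤ s.rank else 3 * I.lower < s.rank) ∧
    ∀ b : ℕ, I.upper = b → if I.upperClosed then s.rank ≤ 3 * b else s.rank < 3 * b}

/-- The places of the associated net. -/
inductive Place (P : Type*) (m : ℕ) where
  | tok (p : P) (s : Sym m)
  | disc
  | time1
  | time2
  | count
  | dump

section Translation

variable {P T : Type*}

/-- The sets of places obtained by choosing one symbol from the encoding of every arc. -/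
def arcPlaces (m : ℕ) (arcs : P → Option Intrv) : Set (Set (Place P m)) :=
  {A | ∃ s : P → Sym m, (∀ p I, arcs p = some I → s p ∈ enc m I) ∧
    A = {q | ∃ p, (arcs p).isSome = true ∧ q = .tok p (s p)}}

/-- The ordinary transitions of the associated net. -/
inductive Trans (N : TPN P T) (m : ℕ) where
  | fire (t : T) (A B : Set (Place P m))
      (hA : A ∈ arcPlaces m (N.arcIn t)) (hB : B ∈ arcPlaces m (N.arcOut t))
  | switchTime
  | switchDisc
  | reach (p : P) (k : Fin m)
  | exceed (p : P) (k : Fin m)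

/-- Input places of the ordinary transitions. -/
def Trans.input {N : TPN P T} {m : ℕ} : Trans N m → Set (Place P m)
  | .fire _ A _ _ _ => A ∪ {.disc}
  | .switchTime => {.disc, .count}
  | .switchDisc => {.time2}
  | .reach p k => {.time2, .tok p (.minus k)}
  | .exceed p k => {.time2, .tok p (.minus k)}

/-- Output places of the ordinary transitions: `reach` turns a token of age `(k+1)-` into one of
age `k+1`, and `exceed` turns it into one of age `(k+1)+`. -/
def Trans.output {N : TPN P T} {m : ℕ} : Trans N m → Set (Place P m)
  | .fire _ _ B _ _ => B ∪ {.disc, .count}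
  | .switchTime => {.time1}
  | .switchDisc => {.disc}
  | .reach p k => {.time2, .tok p (.exact k.succ)}
  | .exceed p k => {.time2, .tok p (.plus k.succ)}

/-- The transfer arcs `p(k) → p(k+)` and `p_count → p_dump`. -/
def transferArcs (P : Type*) (m : ℕ) : Set (Place P m × Place P m) :=
  {a | (∃ p k, a = (.tok p (.exact k), .tok p (.plus k))) ∨ a = (.count, .dump)}

/-- The simultaneous-disjoint-transfer net associated with a timed Petri net. -/
def TPN.toSDTN [Fintype P] [Fintype T] (N : TPN P T) :
    SDTN (Place P N.maxConst) (Trans N N.maxConst) where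
  input := Trans.input
  output := Trans.output
  transIn := {.time1}
  transOut := {.time2}
  st := transferArcs P N.maxConst
  source_ne_target := by
    rintro _ (⟨p, k, rfl⟩ | rfl) _ (⟨q, l, rfl⟩ | rfl) <;> simp
  pairwise_ne := by
    rintro _ (⟨p, k, rfl⟩ | rfl) _ (⟨q, l, rfl⟩ | rfl) <;> simp
  notMem_trans := by
    rintro _ (⟨p, k, rfl⟩ | rfl) <;> simp

/-- Standard markings of the associated net. -/
def IsStandard {m : ℕ} (M : Place P m → ℕ) : Prop :=
  M .disc = 1 ∧ M .time1 = 0 ∧ M .time2 = 0 ∧ M .count = 0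

/-- The standard markings among the minimal elements of `INF`. -/
def INFminStd [Fintype P] [Fintype T] (N : TPN P T) : Set (Place P N.maxConst → ℕ) :=
  {M | M ∈ N.toSDTN.INFmin ∧ IsStandard M}

variable [DecidableEq P]

/-- All arrangements in a word of the tokens of `M` on the places `p((k+1)-)`. -/
def permMinus {m : ℕ} (M : Place P m → ℕ) : Set (Word P m) :=
  {w | ∀ p k, M (.tok p (.minus k)) = (w.1.map fun b => b.count (p, k)).sum}

/-- All arrangements in a word of the tokens of `M` on the places `p(k+)` with `k < m`. -/
def permPlus {m : ℕ} (M : Place P m → ℕ) : Set (Word P m) :=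
  {w | ∀ p (k : Fin m), M (.tok p (.plus k.castSucc)) = (w.1.map fun b => b.count (p, k)).sum}

variable [Fintype P]

/-- The region `Reg(M, w₊, w₋) = (b₀, w₊ • w₋, b_max)`, where `b₀((p, k)) = M(p(k))` and
`b_max(p) = M(p(max+))`. -/
def Reg {m : ℕ} (M : Place P m → ℕ) (wp wm : Word P m) : Region P m where
  b0 := ∑ q : P × Fin (m + 1), M (.tok q.1 (.exact q.2)) • ({q} : Multiset (P × Fin (m + 1)))
  w := wp.append wm
  bmax := ∑ p : P, M (.tok p (.plus (Fin.last m))) • ({p} : Multiset P)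

/-- `IsZ N Z` says that the multi-region upward closure `Z` is
`⋃_{M ∈ INF'_min} ⋃_{w₊ ∈ perm(M⁺)} ⋂_{w₋ ∈ perm(M⁻)} Pre*({Reg(M, w₊, w₋)})`.
A multi-region upward closure stands for the set it denotes, so `Pre*`, the unions and the
intersections are operations on multi-region upward closures that are specified by their effect
on these sets; `Q M w₊ w₋` is `Pre*({Reg(M, w₊, w₋)})`. -/
def IsZ [Fintype T] (N : TPN P T) (Z : MRUC P N.maxConst) : Prop :=
  ∃ Q : (Place P N.maxConst → ℕ) → Word P N.maxConst → Word P N.maxConst → MRUC P N.maxConst,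
    (∀ M wp wm, (Q M wp wm).den =
      preStar N (MRUC.den ({Reg M wp wm} : MRUC P N.maxConst))) ∧
    Z.den = ⋃ M ∈ INFminStd N, ⋃ wp ∈ permPlus M, ⋂ wm ∈ permMinus M,
      (Q M wp wm).den

end Translation

end TimedPetri

namespace TimedPetri

/-! ## Multisets, sequences and orders -/

section General

variable {α β γ κ : Type*}

/-! Existence of `Z`. Any set of markings closed under adding tokens and under region equivalence is
denoted by an MRUC (`IsRegionClosed.exists_mruc`): embedding of regions is a well-quasi-order, by
Dickson's lemma for b₀ and b_max and Higman's lemma for the word, so finitely many regions generate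
the set. This closure passes to arbitrary unions and intersections. It passes to Pre* because region
equivalence is a bisimulation (`Step.of_regionEquiv`): ages are related by a strictly increasing Φ
that fixes 0 and commutes with x ↦ x + 1, and a delay d is answered by the delay -Φ(-d).

Z ⊆ ZENO. An infinite run of N' from a standard marking simulates infinitely many discrete
transitions, since every other transition decreases a potential. The tokens on each p((k+1)-) are
treated as a queue, and each gets a fate in ℕ∞: 2n if it reaches k+1 exactly in time phase n, 2n-1
if it exceeds k+1 in phase n, and ⊤ if it does neither. A schedule is a strictly increasing g on ℕ∞
with g 0 = 0 and g ⊤ < 1; phase n ends at time g(2n). A token with fate v that is present at the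
start gets the age k+1-g(v), so that it is k+1 old at time g(v), and later tokens are created with
the ages that their fates demand. The timed net can then copy the run in total time at most 1
(`Run.mem_ZENO`). Larger fractional parts mean earlier fates, so the fates prescribe an arrangement
w₋, which depends on the run only. Any marking of Reg(M', w₊, w₋) for this w₋ fixes g at finitely
many fates, and g extends (`exists_isSchedule`). As w₊ precedes w₋, there is room to keep g ⊤ so
small that no plus token reaches its next integer. Of the intersection over w₋ only this one member
is used (`Run.exists_permMinus`).

ZENO ⊆ Z. Let Δ i be the time that remains after step i of a zeno computation. At a late step j,
encode a token by a minus symbol if it will still exceed its next integer, and by a plus symbol if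
its age is not an integer and it will not. Since less than one time unit remains, each token crosses
at most one integer, and the encoding lies in INF (`InfComputation.IsTail.mem_INF`); take a minimal
standard E below it. The plus tokens determine w₊. If j is late enough compared with a step i₀,
every token of step i₀ that is going to exceed an integer has reached it by step j, so the minus
tokens at j were all created after i₀. Each was created with an age in some open interval (k, k+1),
which no arc can tell apart, so it could have been created with another age there
(`exists_exchange`). Hence the state at i₀ also reaches markings whose minus tokens have any
prescribed order of fractional parts, which serves every w₋ at once. -/

theorem exists_pairing_of_map_eq {S : Multiset α} {B : Multiset β} {f : α → γ} {g : β → γ}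
    (h : S.map f = B.map g) :
    ∃ W : Multiset (α × β), W.map Prod.fst = S ∧ W.map Prod.snd = B ∧ ∀ w ∈ W, f w.1 = g w.2 := by
  have h' : Multiset.Rel (fun a b => f a = g b) S B := by
    rwa [← Multiset.rel_eq, Multiset.rel_map] at h
  clear h
  induction h' with
  | zero => exact ⟨0, by simp⟩
  | @cons a b as bs hab _ ih =>
    obtain ⟨W, h1, h2, h3⟩ := ih
    refine ⟨(a, b) ::ₘ W, by simp [h1], by simp [h2], ?_⟩
    intro w hw
    rcases Multiset.mem_cons.1 hw with rfl | hw
    · exact hab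
    · exact h3 w hw

theorem exists_add_of_map_eq_add {S : Multiset α} {f : α → β} {A B : Multiset β}
    (h : S.map f = A + B) :
    ∃ S₁ S₂, S = S₁ + S₂ ∧ S₁.map f = A ∧ S₂.map f = B := by
  rw [← Multiset.rel_eq, Multiset.rel_map_left, Multiset.rel_add_right] at h
  obtain ⟨S₁, S₂, h1, h2, h3⟩ := h
  rw [← Multiset.rel_map_left, Multiset.rel_eq] at h1 h2
  exact ⟨S₁, S₂, h3, h1, h2⟩

theorem exists_le_of_le_map {S : Multiset α} {f : α → β} {A : Multiset β} (h : A ≤ S.map f) :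
    ∃ S₁ ≤ S, S₁.map f = A := by
  obtain ⟨B, hB⟩ := Multiset.le_iff_exists_add.1 h
  obtain ⟨S₁, S₂, rfl, h1, _⟩ := exists_add_of_map_eq_add hB
  exact ⟨S₁, Multiset.le_add_right _ _, h1⟩

/-- A transition uses at most one token per place, so a multiset of pairs over its arcs is the graph
of a function. -/
theorem exists_fun_of_map_fst_eq [Inhabited β] {V : Multiset (α × β)} {S : Finset α}
    (h : V.map Prod.fst = S.val) : ∃ g : α → β, V = S.val.map fun p => (p, g p) := by
  classical
  have h1 : ∀ p, ∃ b, p ∈ S → (p, b) ∈ V := by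
    intro p
    by_cases hp : p ∈ S
    · have : p ∈ V.map Prod.fst := by rw [h]; exact hp
      obtain ⟨⟨q, b⟩, hv, rfl⟩ := Multiset.mem_map.1 this
      exact ⟨b, fun _ => hv⟩
    · exact ⟨default, fun h => absurd h hp⟩
  choose g hg using h1
  have hnd : (V.map Prod.fst).Nodup := by rw [h]; exact S.nodup
  refine ⟨g, (Multiset.Nodup.ext hnd.of_map ?_).2 ?_⟩
  · exact S.nodup.map (fun a b hab => (Prod.ext_iff.1 hab).1)
  · rintro ⟨p, b⟩
    constructor
    · intro hv
      have hp : p ∈ S := by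
        have : p ∈ V.map Prod.fst := Multiset.mem_map_of_mem Prod.fst hv
        rwa [h] at this
      have := Multiset.inj_on_of_nodup_map hnd _ hv _ (hg p hp) rfl
      exact Multiset.mem_map.2 ⟨p, hp, this.symm⟩
    · intro hv
      obtain ⟨q, hq, he⟩ := Multiset.mem_map.1 hv
      obtain ⟨rfl, rfl⟩ := Prod.ext_iff.1 he
      exact hg _ hq

/-- A multiset of elements with keys splits into a list of groups with increasing keys. -/
theorem exists_sorted_groups [LinearOrder κ] (A : Multiset (β × κ)) :
    ∃ L : List (κ × Multiset β), L.Pairwise (fun a b => a.1 < b.1) ∧ (∀ e ∈ L, e.2 ≠ 0) ∧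
      (L.map fun e => e.2.map fun b => (b, e.1)).sum = A := by
  classical
  let V : Finset κ := (A.map Prod.snd).toFinset
  let F : κ → κ × Multiset β := fun v => (v, (A.filter fun a => a.2 = v).map Prod.fst)
  refine ⟨(V.sort (· ≤ ·)).map F, ?_, ?_, ?_⟩
  · rw [List.pairwise_map]
    exact (Finset.sortedLT_sort V).pairwise
  · intro e he
    obtain ⟨v, hv, rfl⟩ := List.mem_map.1 he
    have : v ∈ A.map Prod.snd := by simpa [V] using hv
    obtain ⟨a, ha, rfl⟩ := Multiset.mem_map.1 this
    intro h0
    rw [Multiset.map_eq_zero, Multiset.filter_eq_nil] at h0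
    exact h0 a ha rfl
  · have h1 : ∀ v, ((F v).2.map fun b => (b, (F v).1)) = A.filter fun a => a.2 = v := by
      intro v
      simp only [F, Multiset.map_map, Function.comp_def]
      conv_rhs => rw [← Multiset.map_id (A.filter fun a => a.2 = v)]
      refine Multiset.map_congr rfl fun a ha => ?_
      rw [← (Multiset.mem_filter.1 ha).2]; rfl
    rw [List.map_map]
    have h2 : ((fun e : κ × Multiset β => e.2.map fun b => (b, e.1)) ∘ F) =
        fun v => A.filter fun a => a.2 = v := funext h1
    rw [h2, ← List.sum_toFinset _ (Finset.sort_nodup V _), Finset.sort_toFinset]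
    ext ⟨b, v⟩
    rw [Multiset.count_sum']
    simp only [Multiset.count_filter]
    rw [Finset.sum_ite_eq]
    split_ifs with hv
    · rfl
    · rw [eq_comm, Multiset.count_eq_zero]
      intro hm
      exact hv (by simpa [V] using ⟨b, hm⟩)

/-- A strictly monotone function on a finite set containing `⊥` extends to a strictly monotone
function as soon as there is any bounded one. -/
theorem exists_strictMono_extension [LinearOrder α] [OrderBot α] (φ : α → ℝ) (hφ : StrictMono φ)
    (hb : ∀ a b, φ a - φ b ≤ 1) (V : Finset α) (hV : ⊥ ∈ V) (h : α → ℝ)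
    (hh : StrictMonoOn h V) : ∃ g : α → ℝ, StrictMono g ∧ ∀ v ∈ V, g v = h v := by
  classical
  -- ε bounds the gaps between the values of `h` on `V` from below. The extension follows `h` at the
  -- greatest point of `V` below v and adds ε times the increment of φ since then.
  obtain ⟨ε, hε, hgap⟩ : ∃ ε : ℝ, 0 < ε ∧ ∀ a ∈ V, ∀ b ∈ V, a < b → h a + ε ≤ h b := by
    let E : Finset ℝ := ((V ×ˢ V).filter fun x => x.1 < x.2).image fun x => h x.2 - h x.1
    by_cases hE : E.Nonempty
    · refine ⟨E.min' hE, ?_, ?_⟩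
      · rw [Finset.lt_min'_iff]
        intro y hy
        obtain ⟨x, hx, rfl⟩ := Finset.mem_image.1 hy
        simp only [Finset.mem_filter, Finset.mem_product] at hx
        exact sub_pos.2 (hh hx.1.1 hx.1.2 hx.2)
      · intro a ha b hb hab
        have : E.min' hE ≤ h b - h a := Finset.min'_le _ _ (Finset.mem_image.2
          ⟨(a, b), by simp [ha, hb, hab], rfl⟩)
        linarith
    · refine ⟨1, one_pos, fun a ha b hb hab => absurd ?_ hE⟩
      exact ⟨_, Finset.mem_image.2 ⟨(a, b), by simp [ha, hb, hab], rfl⟩⟩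
  have hne : ∀ v : α, (V.filter (· ≤ v)).Nonempty := fun v => ⟨⊥, by simp [hV]⟩
  let pr : α → α := fun v => (V.filter (· ≤ v)).max' (hne v)
  have hpr : ∀ v, pr v ∈ V ∧ pr v ≤ v := fun v =>
    Finset.mem_filter.1 (Finset.max'_mem _ (hne v))
  have hpr' : ∀ v, v ∈ V → pr v = v := fun v hv =>
    le_antisymm (hpr v).2 (Finset.le_max' _ _ (by simp [hv]))
  have hmono : ∀ v w, v ≤ w → pr v ≤ pr w := fun v w hvw =>
    Finset.le_max' _ _ (by simpa using ⟨(hpr v).1, (hpr v).2.trans hvw⟩)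
  refine ⟨fun v => h (pr v) + ε * (φ v - φ (pr v)), ?_, ?_⟩
  · intro v w hvw
    have h1 : φ v < φ w := hφ hvw
    rcases (hmono v w hvw.le).eq_or_lt with he | hl
    · simp only [he]
      have := mul_lt_mul_of_pos_left h1 hε
      linarith
    · have h2 := hgap _ (hpr v).1 _ (hpr w).1 hl
      have h3 : φ v < φ (pr w) := by
        apply hφ
        by_contra hc
        have : pr w ≤ pr v := Finset.le_max' _ _ (by simpa using ⟨(hpr w).1, not_lt.1 hc⟩)
        exact absurd hl (not_lt.2 this)
      -- Strict, because φ v lies below φ (pr w); so the correction at v stays below the gap ε.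
      have h4 : φ v - φ (pr v) < 1 := lt_of_lt_of_le (by linarith) (hb (pr w) (pr v))
      have h5 : 0 ≤ φ w - φ (pr w) := sub_nonneg.2 (hφ.monotone (hpr w).2)
      have h6 := mul_lt_mul_of_pos_left h4 hε
      have h7 := mul_nonneg hε.le h5
      show h (pr v) + ε * (φ v - φ (pr v)) < h (pr w) + ε * (φ w - φ (pr w))
      linarith
  · intro v hv
    simp [hpr' v hv]

/-- A set that can be revisited after finitely many steps admits infinite paths. -/
theorem exists_infinite_path {r : α → α → Prop} {S : Set α}
    (hS : ∀ x ∈ S, ∃ y ∈ S, Relation.TransGen r x y) {x : α} (hx : x ∈ S) :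
    ∃ σ : ℕ → α, σ 0 = x ∧ ∀ i, r (σ i) (σ (i + 1)) := by
  -- The points from which `S` can be reached in at least one step: this contains `S` and the
  -- intermediate points of the chosen paths, so single steps never leave it.
  let S' : Set α := {x | ∃ y ∈ S, Relation.TransGen r x y}
  have h1 : ∀ x : S', ∃ y : S', r x y := by
    rintro ⟨x, y, hy, hxy⟩
    obtain ⟨z, hz, hzy⟩ := Relation.TransGen.head'_iff.1 hxy
    rcases Relation.reflTransGen_iff_eq_or_transGen.1 hzy with rfl | hzy
    · exact ⟨⟨_, hS _ hy⟩, hz⟩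
    · exact ⟨⟨z, y, hy, hzy⟩, hz⟩
  choose f hf using h1
  refine ⟨fun n => (f^[n] ⟨x, hS x hx⟩ : S'), rfl, fun i => ?_⟩
  simp only [Function.iterate_succ_apply']
  exact hf _

/-- Without a finite basis, elements could be chosen one by one, each not above any earlier one;
this would be a bad sequence. -/
theorem exists_finset_basis {r : α → α → Prop} (hr : WellQuasiOrdered r) (S : Set α) :
    ∃ F : Finset α, ↑F ⊆ S ∧ ∀ s ∈ S, ∃ f ∈ F, r f s := by
  by_contra hc
  push Not at hc
  obtain ⟨f, hf, hf'⟩ := exists_seq_of_forall_finset_exists (· ∈ S) (fun a b => ¬ r a b)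
    (fun s hs => hc s hs)
  obtain ⟨m, n, hmn, hr'⟩ := hr f
  exact hf' m n hmn hr'

theorem wellQuasiOrdered_multiset_le [Finite α] :
    WellQuasiOrdered ((· ≤ ·) : Multiset α → Multiset α → Prop) := by
  classical
  intro f
  have h := wellQuasiOrdered_le (α := α → ℕ) (fun n a => (f n).count a)
  obtain ⟨m, n, hmn, hle⟩ := h
  exact ⟨m, n, hmn, Multiset.le_iff_count.2 hle⟩

/-- Higman's lemma for words over a well-quasi-ordered alphabet. -/
theorem wellQuasiOrdered_sublistForall {r : α → α → Prop} [IsPreorder α r]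
    (hr : WellQuasiOrdered r) : WellQuasiOrdered (List.SublistForall₂ r) := by
  have h := Set.PartiallyWellOrderedOn.partiallyWellOrderedOn_sublistForall₂ r (s := Set.univ)
    (Set.partiallyWellOrderedOn_univ_iff.2 hr)
  have h2 : {l : List α | ∀ x, x ∈ l → x ∈ (Set.univ : Set α)} = Set.univ := by simp
  rw [h2] at h
  exact Set.partiallyWellOrderedOn_univ_iff.1 h

end General

/-! ## Regions through lists of groups of tokens -/

section Regions

variable {P : Type*} {m : ℕ}

/-- The tokens of a list of groups, each with its fractional part. -/
def groupTokens (L : List (ℝ≥0 × Multiset (P × Fin m))) : Marking P :=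
  (L.map fun e => e.2.map fun q => (q.1, ((q.2 : ℕ) : ℝ≥0) + e.1)).sum

/-- The tokens with integer ages. -/
def exactTokens (b : Multiset (P × Fin (m + 1))) : Marking P :=
  b.map fun q => (q.1, ((q.2 : ℕ) : ℝ≥0))

@[simp] theorem groupTokens_nil : groupTokens ([] : List (ℝ≥0 × Multiset (P × Fin m))) = 0 := rfl

@[simp] theorem groupTokens_cons (e : ℝ≥0 × Multiset (P × Fin m)) (L) :
    groupTokens (e :: L) = (e.2.map fun q => (q.1, ((q.2 : ℕ) : ℝ≥0) + e.1)) + groupTokens L := by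
  simp [groupTokens]

theorem groupTokens_append (L₁ L₂ : List (ℝ≥0 × Multiset (P × Fin m))) :
    groupTokens (L₁ ++ L₂) = groupTokens L₁ + groupTokens L₂ := by
  simp [groupTokens]

/-- The tokens depend only on the multiset of pairs (q, fractional part) and not on the grouping;
this is the bridge between words and multisets. -/
theorem groupTokens_eq_map (L : List (ℝ≥0 × Multiset (P × Fin m))) :
    groupTokens L = (L.map fun e : ℝ≥0 × Multiset (P × Fin m) => e.2.map fun b => (b, e.1)).sum.map
      fun a : (P × Fin m) × ℝ≥0 => (a.1.1, ((a.1.2 : ℕ) : ℝ≥0) + a.2) := by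
  induction L with
  | nil => simp
  | cons e L ih => simp [ih, Multiset.map_map]

/-- Keeping each letter together with its fractional part in one list allows words to be split,
thinned out and mapped without index arithmetic. -/
theorem Region.mem_den_iff {R : Region P m} {M : Marking P} :
    M ∈ R.den ↔ ∃ (L : List (ℝ≥0 × Multiset (P × Fin m))) (B : Marking P),
      L.map Prod.snd = R.w.1 ∧ L.Pairwise (fun a b => a.1 < b.1) ∧
      (∀ e ∈ L, 0 < e.1 ∧ e.1 < 1) ∧ B.map Prod.fst = R.bmax ∧ (∀ τ ∈ B, (m : ℝ≥0) < τ.2) ∧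
      M = exactTokens R.b0 + groupTokens L + B := by
  obtain ⟨b0, ⟨w, hw⟩, bmax⟩ := R
  constructor
  · rintro ⟨f, B, hf, hf', hB, hB', rfl⟩
    refine ⟨List.ofFn fun i => (f i, w.get i), B, ?_, ?_, ?_, hB, hB', ?_⟩
    · rw [List.map_ofFn]
      exact List.ofFn_get w
    · rw [List.pairwise_ofFn]
      exact fun i j hij => hf hij
    · intro e he
      obtain ⟨i, rfl⟩ := (List.mem_ofFn' _ _).1 he
      exact hf' i
    · simp [exactTokens, groupTokens, List.map_ofFn, List.sum_ofFn]
  · rintro ⟨L, B, hL, hs, hL', hB, hB', rfl⟩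
    dsimp only at hL hB
    subst hL
    have hlen : (L.map Prod.snd).length = L.length := List.length_map _
    refine ⟨fun i => (L.get (i.cast hlen)).1, B, ?_, ?_, hB, hB', ?_⟩
    · intro i j hij
      exact List.pairwise_iff_get.1 hs _ _ hij
    · intro i
      exact hL' _ (List.get_mem _ _)
    · have h1 : groupTokens L = ∑ i : Fin L.length,
          (L.get i).2.map fun q => (q.1, ((q.2 : ℕ) : ℝ≥0) + (L.get i).1) := by
        rw [groupTokens, ← List.sum_ofFn]
        congr 1
        conv_lhs => rw [← List.ofFn_get L]
        rw [List.map_ofFn]; rfl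
      congr 2
      rw [h1]
      refine (Fintype.sum_equiv (finCongr hlen) _ _ ?_).symm
      intro i
      simp

end Regions

/-! ### Maps with prescribed values on lists and multisets -/

section General

variable {α β : Type*}

theorem exists_map_eq_of_forall {S : Multiset α} {f : β → α} {Q : β → Prop}
    (h : ∀ a ∈ S, ∃ b, Q b ∧ f b = a) : ∃ B : Multiset β, (∀ b ∈ B, Q b) ∧ B.map f = S := by
  induction S using Multiset.induction_on with
  | empty => exact ⟨0, by simp⟩
  | cons a S ih =>
    obtain ⟨B, hB, hB'⟩ := ih fun x hx => h x (Multiset.mem_cons_of_mem hx)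
    obtain ⟨b, hb, rfl⟩ := h a (Multiset.mem_cons_self _ _)
    exact ⟨b ::ₘ B, by simpa [hb] using hB, by simp [hB']⟩

theorem exists_strictMonoOn_map_eq [LinearOrder α] [Preorder β] [Inhabited β] :
    ∀ (l₁ : List α) (l₂ : List β), l₁.length = l₂.length → l₁.Pairwise (· < ·) →
      l₂.Pairwise (· < ·) → ∃ h : α → β, l₁.map h = l₂ ∧ StrictMonoOn h {x | x ∈ l₁}
  | [], [], _, _, _ => ⟨fun _ => default, rfl, by simp [StrictMonoOn]⟩
  | [], _ :: _, h, _, _ => by simp at h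
  | _ :: _, [], h, _, _ => by simp at h
  | a :: l₁, b :: l₂, h, h₁, h₂ => by
    classical
    rw [List.pairwise_cons] at h₁ h₂
    obtain ⟨g, hg, hg'⟩ := exists_strictMonoOn_map_eq l₁ l₂ (by simpa using h) h₁.2 h₂.2
    have hne : ∀ x ∈ l₁, x ≠ a := fun x hx => (h₁.1 x hx).ne'
    refine ⟨Function.update g a b, ?_, ?_⟩
    · rw [List.map_cons, Function.update_self, ← hg]
      congr 1
      exact List.map_congr_left fun x hx => Function.update_of_ne (hne x hx) _ _
    · intro x hx y hy hxy
      rcases List.mem_cons.1 hx with rfl | hx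
      · rcases List.mem_cons.1 hy with rfl | hy
        · exact absurd hxy (lt_irrefl _)
        · rw [Function.update_self, Function.update_of_ne (hne y hy)]
          exact h₂.1 _ (hg ▸ List.mem_map_of_mem hy)
      · rcases List.mem_cons.1 hy with hy | hy
        · exact absurd hxy (hy ▸ (h₁.1 x hx).not_gt)
        · rw [Function.update_of_ne (hne y hy), Function.update_of_ne (hne x hx)]
          exact hg' hx hy hxy

end General

/-! ## Order automorphisms commuting with the unit translation -/

/-- A strictly monotone function on the reals that commutes with `x ↦ x + 1` and fixes `0`. -/
structure IsUnitEquivariant (Φ : ℝ → ℝ) : Prop where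
  strictMono : StrictMono Φ
  add_one : ∀ x, Φ (x + 1) = Φ x + 1
  zero : Φ 0 = 0

namespace IsUnitEquivariant

variable {Φ : ℝ → ℝ}

theorem add_nat (h : IsUnitEquivariant Φ) (x : ℝ) (n : ℕ) : Φ (x + n) = Φ x + n := by
  induction n with
  | zero => simp
  | succ n ih => push_cast; rw [← add_assoc, h.add_one, ih, add_assoc]

theorem nat (h : IsUnitEquivariant Φ) (n : ℕ) : Φ n = n := by
  simpa [h.zero] using h.add_nat 0 n

theorem nonneg (h : IsUnitEquivariant Φ) (x : ℝ≥0) : 0 ≤ Φ x := by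
  rw [← h.zero]; exact h.strictMono.monotone x.2

/-- If ages x and Φ(x) correspond, then after the delays d and -Φ(-d) the corresponding ages are
related by this map. -/
theorem translate (h : IsUnitEquivariant Φ) (d : ℝ) :
    IsUnitEquivariant fun y => Φ (y - d) - Φ (-d) where
  strictMono := fun x y hxy => by
    have := h.strictMono (show x - d < y - d by linarith)
    show Φ (x - d) - Φ (-d) < Φ (y - d) - Φ (-d)
    linarith
  add_one := fun x => by
    show Φ (x + 1 - d) - Φ (-d) = Φ (x - d) - Φ (-d) + 1
    rw [show x + 1 - d = x - d + 1 by ring, h.add_one]; ring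
  zero := by simp

end IsUnitEquivariant

/-- A finite strictly monotone map between fractional parts extends to the reals. -/
theorem exists_isUnitEquivariant {l₁ l₂ : List ℝ≥0} (hlen : l₁.length = l₂.length)
    (h₁ : l₁.Pairwise (· < ·)) (h₂ : l₂.Pairwise (· < ·)) (h₁' : ∀ x ∈ l₁, 0 < x ∧ x < 1)
    (h₂' : ∀ x ∈ l₂, 0 < x ∧ x < 1) :
    ∃ Φ, IsUnitEquivariant Φ ∧ l₁.map (fun x : ℝ≥0 => (Φ x).toNNReal) = l₂ := by
  classical
  -- The end points 0 and 1 are added as fixed points, so that the map can be repeated on every unit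
  -- interval.
  obtain ⟨h, hh, hmono⟩ := exists_strictMonoOn_map_eq (0 :: (l₁ ++ [1])) (0 :: (l₂ ++ [1]))
    (by simp [hlen])
    (by
      simp only [List.pairwise_cons, List.pairwise_append, List.mem_append, List.mem_singleton]
      refine ⟨?_, h₁, by simp, fun a ha b hb => hb ▸ (h₁' a ha).2⟩
      rintro a (ha | rfl)
      exacts [(h₁' a ha).1, one_pos])
    (by
      simp only [List.pairwise_cons, List.pairwise_append, List.mem_append, List.mem_singleton]
      refine ⟨?_, h₂, by simp, fun a ha b hb => hb ▸ (h₂' a ha).2⟩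
      rintro a (ha | rfl)
      exacts [(h₂' a ha).1, one_pos])
  simp only [List.map_cons, List.map_append, List.map_nil, List.cons.injEq] at hh
  obtain ⟨h0, hh⟩ := hh
  obtain ⟨hl, h1⟩ := List.append_inj' hh rfl
  have h1 : h 1 = 1 := by simpa using h1
  -- A strictly increasing function of oscillation at most 1, as the extension lemma requires.
  have hφ : StrictMono fun x : ℝ≥0 => -(1 / (1 + x : ℝ)) := by
    intro x y hxy
    have hx := x.2
    have : (x : ℝ) < y := hxy
    apply neg_lt_neg
    apply one_div_lt_one_div_of_lt <;> linarith
  obtain ⟨g, hg, hgV⟩ := exists_strictMono_extension _ hφ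
    (fun a b => by
      have ha : 0 ≤ 1 / (1 + a : ℝ) := by have := a.2; positivity
      have hb : 1 / (1 + b : ℝ) ≤ 1 := by
        have := b.2
        rw [div_le_one (by linarith)]; linarith
      linarith)
    (0 :: (l₁ ++ [1])).toFinset (by simp) (fun x => (h x : ℝ))
    (fun x hx y hy hxy => NNReal.coe_lt_coe.2 (hmono (List.mem_toFinset.1 hx)
      (List.mem_toFinset.1 hy) hxy))
  have hg0 : g 0 = 0 := by rw [hgV 0 (by simp), h0]; simp
  have hg1 : g 1 = 1 := by rw [hgV 1 (by simp), h1]; simp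
  have hfr : ∀ x : ℝ, (Int.fract x).toNNReal < 1 := fun x => by
    rw [Real.toNNReal_lt_one]; exact Int.fract_lt_one x
  have hlo : ∀ x : ℝ, 0 ≤ g (Int.fract x).toNNReal := fun x => by
    rw [← hg0]; exact hg.monotone zero_le
  have hhi : ∀ x : ℝ, g (Int.fract x).toNNReal < 1 := fun x => by
    rw [← hg1]; exact hg (hfr x)
  -- The periodic continuation: integer parts are kept and `g` acts on the fractional part.
  refine ⟨fun x => ⌊x⌋ + g (Int.fract x).toNNReal, ⟨?_, ?_, ?_⟩, ?_⟩
  · intro x y hxy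
    rcases (Int.floor_mono hxy.le).eq_or_lt with he | hl
    · have : Int.fract x < Int.fract y := by
        rw [← Int.self_sub_floor, ← Int.self_sub_floor, he]; linarith
      have := hg ((Real.toNNReal_lt_toNNReal_iff_of_nonneg (Int.fract_nonneg x)).2 this)
      simp only [he]; linarith
    · have h3 : (⌊x⌋ : ℝ) + 1 ≤ ⌊y⌋ := by exact_mod_cast hl
      have := hlo y
      have := hhi x
      show (⌊x⌋ : ℝ) + g (Int.fract x).toNNReal < ⌊y⌋ + g (Int.fract y).toNNReal
      linarith
  · intro x
    simp only [Int.floor_add_one, Int.fract_add_one]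
    push_cast; ring
  · simp [hg0]
  · rw [← hl]
    refine List.map_congr_left fun x hx => ?_
    have hx' := h₁' x hx
    have hf : ⌊(x : ℝ)⌋ = 0 := by
      rw [Int.floor_eq_zero_iff]; exact ⟨x.2, by exact_mod_cast hx'.2⟩
    have hfr : Int.fract (x : ℝ) = x := by rw [← Int.self_sub_floor, hf]; simp
    show ((⌊(x : ℝ)⌋ : ℝ) + g (Int.fract (x : ℝ)).toNNReal).toNNReal = h x
    rw [hf, hfr, Real.toNNReal_coe, hgV x (by simp [hx])]
    simp

/-! ## Region equivalence -/

section Equivalence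

variable {P T : Type*} {m : ℕ}

/-- Two markings have the same region when their tokens can be paired so that the ages up to `m`
correspond by a unit-equivariant map. -/
def RegionEquiv (m : ℕ) (M₁ M₂ : Marking P) : Prop :=
  ∃ Φ, IsUnitEquivariant Φ ∧ ∃ V : Multiset (P × ℝ≥0 × ℝ≥0),
    V.map (fun v => (v.1, v.2.1)) = M₁ ∧ V.map (fun v => (v.1, v.2.2)) = M₂ ∧
    ∀ v ∈ V, (v.2.2 : ℝ) = Φ v.2.1 ∨ ((m : ℝ≥0) < v.2.1 ∧ (m : ℝ≥0) < v.2.2)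

/-- Sets of markings that are closed under adding tokens and under region equivalence. -/
def IsRegionClosed (m : ℕ) (S : Set (Marking P)) : Prop :=
  (∀ M₁ ∈ S, ∀ M₂, M₁ ≤ M₂ → M₂ ∈ S) ∧ ∀ M₁ ∈ S, ∀ M₂, RegionEquiv m M₁ M₂ → M₂ ∈ S

/-- The index family is arbitrary: a finite basis comes from the well-quasi-order afterwards, so
neither the finiteness of INF'_min nor that of the sets of arrangements is needed. -/
theorem IsRegionClosed.iUnion {ι : Sort*} {S : ι → Set (Marking P)}
    (h : ∀ i, IsRegionClosed m (S i)) : IsRegionClosed m (⋃ i, S i) := by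
  constructor <;> intro M₁ hM₁ M₂ hM <;> obtain ⟨i, hi⟩ := Set.mem_iUnion.1 hM₁
  · exact Set.mem_iUnion.2 ⟨i, (h i).1 _ hi _ hM⟩
  · exact Set.mem_iUnion.2 ⟨i, (h i).2 _ hi _ hM⟩

theorem IsRegionClosed.iInter {ι : Sort*} {S : ι → Set (Marking P)}
    (h : ∀ i, IsRegionClosed m (S i)) : IsRegionClosed m (⋂ i, S i) :=
  ⟨fun _ h₁ _ hM => Set.mem_iInter.2 fun i => (h i).1 _ (Set.mem_iInter.1 h₁ i) _ hM,
    fun _ h₁ _ hM => Set.mem_iInter.2 fun i => (h i).2 _ (Set.mem_iInter.1 h₁ i) _ hM⟩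

theorem Intrv.lower_le_maxConst (I : Intrv) : I.lower ≤ I.maxConst := le_max_left _ _

theorem Intrv.upper_le_maxConst {I : Intrv} {b : ℕ} (h : I.upper = b) : b ≤ I.maxConst := by
  unfold Intrv.maxConst
  rw [h]; exact le_max_right _ _

theorem TPN.maxConst_arcIn_le [Fintype P] [Fintype T] (N : TPN P T) {t : T} {p : P} {I : Intrv}
    (h : N.arcIn t p = some I) : I.maxConst ≤ N.maxConst := by
  have := Finset.le_sup (f := fun a : T × P => max ((N.arcIn a.1 a.2).elim 0 Intrv.maxConst)
    ((N.arcOut a.1 a.2).elim 0 Intrv.maxConst)) (Finset.mem_univ (t, p))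
  refine le_trans ?_ this
  simp [h]

theorem TPN.maxConst_arcOut_le [Fintype P] [Fintype T] (N : TPN P T) {t : T} {p : P} {I : Intrv}
    (h : N.arcOut t p = some I) : I.maxConst ≤ N.maxConst := by
  have := Finset.le_sup (f := fun a : T × P => max ((N.arcIn a.1 a.2).elim 0 Intrv.maxConst)
    ((N.arcOut a.1 a.2).elim 0 Intrv.maxConst)) (Finset.mem_univ (t, p))
  refine le_trans ?_ this
  simp [h]

/-- All finite end points are integers at most `m`, so membership depends only on comparisons with
those integers. -/
theorem Intrv.mem_congr {I : Intrv} (hI : I.maxConst ≤ m) {x y : ℝ≥0}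
    (h : ∀ n : ℕ, n ≤ m → (x < n ↔ y < n) ∧ ((n : ℝ≥0) < x ↔ (n : ℝ≥0) < y)) :
    I.Mem x ↔ I.Mem y := by
  have hl := h _ (I.lower_le_maxConst.trans hI)
  unfold Intrv.Mem
  refine and_congr ?_ (forall_congr' fun b => imp_congr_right fun hb => ?_)
  · split_ifs
    · rw [← not_lt, hl.1, not_lt]
    · exact hl.2
  · have hu := h _ ((Intrv.upper_le_maxConst hb).trans hI)
    split_ifs
    · rw [← not_lt, hu.2, not_lt]
    · exact hu.1

theorem lt_iff_of_match {Φ : ℝ → ℝ} (hΦ : IsUnitEquivariant Φ) {x y : ℝ≥0}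
    (h : (y : ℝ) = Φ x ∨ ((m : ℝ≥0) < x ∧ (m : ℝ≥0) < y)) {n : ℕ} (hn : n ≤ m) :
    (x < n ↔ y < n) ∧ ((n : ℝ≥0) < x ↔ (n : ℝ≥0) < y) := by
  rcases h with h | ⟨h₁, h₂⟩
  · rw [← NNReal.coe_lt_coe, ← NNReal.coe_lt_coe, ← NNReal.coe_lt_coe, ← NNReal.coe_lt_coe, h,
      NNReal.coe_natCast]
    constructor
    · conv_rhs => rw [← hΦ.nat n]
      exact hΦ.strictMono.lt_iff_lt.symm
    · conv_rhs => rw [← hΦ.nat n]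
      exact hΦ.strictMono.lt_iff_lt.symm
  · have hn' : (n : ℝ≥0) ≤ m := by exact_mod_cast hn
    have h₁ := hn'.trans_lt h₁
    have h₂ := hn'.trans_lt h₂
    simp [h₁, h₂, h₁.not_gt, h₂.not_gt]

/-- Pairs whose first components are the tokens of some arcs. -/
theorem exists_arcTokens_snd [Fintype P] {β : Type*} [Inhabited β] {arcs : P → Option Intrv}
    {x : P → ℝ≥0} {V : Multiset (P × ℝ≥0 × β)}
    (h : V.map (fun v => (v.1, v.2.1)) = arcTokens arcs x) :
    ∃ x' : P → β, V.map (fun v => (v.1, v.2.2)) =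
        (Finset.univ.filter fun p => (arcs p).isSome = true).val.map (fun p => (p, x' p)) ∧
      ∀ p, (arcs p).isSome = true → (p, x p, x' p) ∈ V := by
  have h1 : V.map Prod.fst = (Finset.univ.filter fun p => (arcs p).isSome = true).val := by
    have := congrArg (Multiset.map Prod.fst) h
    simpa [arcTokens, Multiset.map_map] using this
  obtain ⟨g, rfl⟩ := exists_fun_of_map_fst_eq h1
  refine ⟨fun p => (g p).2, by simp [Multiset.map_map], ?_⟩
  intro p hp
  have hp' : p ∈ (Finset.univ.filter fun p => (arcs p).isSome = true).val := by simpa using hp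
  have h2 : (p, x p) ∈ arcTokens arcs x := Multiset.mem_map_of_mem (fun p => (p, x p)) hp'
  rw [← h, Multiset.map_map] at h2
  obtain ⟨q, hq, he⟩ := Multiset.mem_map.1 h2
  simp only [Function.comp_def, Prod.mk.injEq] at he
  obtain ⟨rfl, he⟩ := he
  rw [← he]
  exact Multiset.mem_map_of_mem (fun p => (p, g p)) hp'

/-- Region equivalence is a bisimulation; only the amount of a delay changes between the two sides.
-/
theorem Step.of_regionEquiv [Fintype P] [Fintype T] {N : TPN P T} {l : Label T}
    {M₁ M₁' M₂ : Marking P} (hs : Step N l M₁ M₁') (h : RegionEquiv N.maxConst M₁ M₂) :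
    ∃ l' M₂', Step N l' M₂ M₂' ∧ RegionEquiv N.maxConst M₁' M₂' := by
  obtain ⟨Φ, hΦ, V, rfl, rfl, hV⟩ := h
  cases l with
  | time d =>
    have hd : 0 ≤ -Φ (-d) := by
      have := hΦ.strictMono.monotone (show -(d : ℝ) ≤ 0 by simp)
      rw [hΦ.zero] at this; linarith
    -- With this delay the new ages x + d and Φ(x) - Φ(-d) correspond under the translate of Φ by d,
    -- which fixes 0 again.
    refine ⟨.time (-Φ (-d)).toNNReal, _, rfl, _, hΦ.translate d,
      V.map fun v => (v.1, v.2.1 + d, v.2.2 + (-Φ (-d)).toNNReal), ?_, ?_, ?_⟩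
    · rw [show M₁' = _ from hs]
      simp [Multiset.map_map]
    · simp [Multiset.map_map]
    · intro v hv
      obtain ⟨u, hu, rfl⟩ := Multiset.mem_map.1 hv
      rcases hV _ hu with h | ⟨h₁, h₂⟩
      · left
        simp only [NNReal.coe_add, Real.coe_toNNReal _ hd, add_sub_cancel_right, h]
        ring
      · right
        exact ⟨h₁.trans_le (by simp), h₂.trans_le (by simp)⟩
  | disc t =>
    obtain ⟨x, y, C, hx, hy, hM, rfl⟩ := hs
    obtain ⟨VC, VI, rfl, rfl, hI⟩ := exists_add_of_map_eq_add hM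
    obtain ⟨x', hx', hmem⟩ := exists_arcTokens_snd hI
    -- The created ages are transported by Φ, which fixes the integers and hence preserves the
    -- intervals of the output arcs.
    refine ⟨.disc t, VC.map (fun v => (v.1, v.2.2)) +
      arcTokens (N.arcOut t) fun p => (Φ (y p)).toNNReal,
      ⟨x', fun p => (Φ (y p)).toNNReal, _, ?_, ?_, by rw [Multiset.map_add, hx']; rfl, rfl⟩,
      Φ, hΦ, VC + (Finset.univ.filter fun p => (N.arcOut t p).isSome = true).val.map
        fun p => (p, y p, (Φ (y p)).toNNReal), ?_, ?_, ?_⟩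
    · intro p I hpI
      refine (Intrv.mem_congr (N.maxConst_arcIn_le hpI) fun n hn => ?_).1 (hx p I hpI)
      exact lt_iff_of_match hΦ (hV _ (Multiset.mem_add.2 (.inr (hmem p (by simp [hpI]))))) hn
    · intro p I hpI
      refine (Intrv.mem_congr (N.maxConst_arcOut_le hpI) fun n hn => ?_).1 (hy p I hpI)
      exact lt_iff_of_match hΦ (.inl (Real.coe_toNNReal _ (hΦ.nonneg _))) hn
    · simp [Multiset.map_map, arcTokens]
    · simp [Multiset.map_map, arcTokens]
    · intro v hv
      rcases Multiset.mem_add.1 hv with hv | hv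
      · exact hV v (Multiset.mem_add.2 (.inl hv))
      · obtain ⟨p, _, rfl⟩ := Multiset.mem_map.1 hv
        exact .inl (Real.coe_toNNReal _ (hΦ.nonneg _))

theorem Step.exists_add [Fintype P] {N : TPN P T} {l : Label T} {M M' : Marking P}
    (hs : Step N l M M') (C : Marking P) : ∃ C', Step N l (M + C) (M' + C') := by
  cases l with
  | time d =>
    refine ⟨C.map fun τ => (τ.1, τ.2 + d), ?_⟩
    rw [show M' = _ from hs]
    simp [Step]
  | disc t =>
    obtain ⟨x, y, D, hx, hy, rfl, rfl⟩ := hs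
    exact ⟨C, x, y, D + C, hx, hy, add_right_comm _ _ _, add_right_comm _ _ _⟩

/-- A path is copied step by step: additional tokens merely age along, and equivalent markings
answer each step by bisimulation. -/
theorem isRegionClosed_preStar [Fintype P] [Fintype T] {N : TPN P T} {S : Set (Marking P)}
    (hS : IsRegionClosed N.maxConst S) : IsRegionClosed N.maxConst (preStar N S) := by
  constructor
  · rintro M₁ ⟨M', hM', hr⟩ M₂ hle
    induction hr using Relation.ReflTransGen.head_induction_on generalizing M₂ with
    | refl => exact ⟨M₂, hS.1 _ hM' _ hle, .refl⟩
    | head h _ ih =>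
      obtain ⟨l, hl⟩ := h
      obtain ⟨C, rfl⟩ := Multiset.le_iff_exists_add.1 hle
      obtain ⟨C', hC'⟩ := hl.exists_add C
      obtain ⟨M'', h1, h2⟩ := ih _ (Multiset.le_add_right _ C')
      exact ⟨M'', h1, .head ⟨l, hC'⟩ h2⟩
  · rintro M₁ ⟨M', hM', hr⟩ M₂ he
    induction hr using Relation.ReflTransGen.head_induction_on generalizing M₂ with
    | refl => exact ⟨M₂, hS.2 _ hM' _ he, .refl⟩
    | head h _ ih =>
      obtain ⟨l, hl⟩ := h
      obtain ⟨l', M₂', hC', he'⟩ := hl.of_regionEquiv he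
      obtain ⟨M'', h1, h2⟩ := ih _ he'
      exact ⟨M'', h1, .head ⟨l', hC'⟩ h2⟩

/-! ## Regions and region equivalence -/

theorem toNNReal_add_nat {Φ : ℝ → ℝ} (hΦ : IsUnitEquivariant Φ) (k : ℕ) (f : ℝ≥0) :
    (Φ ((k : ℝ≥0) + f : ℝ≥0)).toNNReal = k + (Φ f).toNNReal := by
  rw [NNReal.coe_add, NNReal.coe_natCast, add_comm, hΦ.add_nat, add_comm,
    Real.toNNReal_add (by simp) (hΦ.nonneg _)]
  simp

theorem map_groupTokens {Φ : ℝ → ℝ} (hΦ : IsUnitEquivariant Φ)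
    (L : List (ℝ≥0 × Multiset (P × Fin m))) :
    (groupTokens L).map (fun τ => (τ.1, (Φ τ.2).toNNReal)) =
      groupTokens (L.map fun e => ((Φ e.1).toNNReal, e.2)) := by
  induction L with
  | nil => simp
  | cons e L ih => simp only [groupTokens_cons, Multiset.map_add, ih, List.map_cons,
      Multiset.map_map, Function.comp_def, toNNReal_add_nat hΦ]

theorem age_le_of_mem_groupTokens {L : List (ℝ≥0 × Multiset (P × Fin m))}
    (hL : ∀ e ∈ L, e.1 < 1) {τ : P × ℝ≥0} (hτ : τ ∈ groupTokens L) : τ.2 ≤ m := by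
  induction L with
  | nil => simp at hτ
  | cons e L ih =>
    rw [groupTokens_cons, Multiset.mem_add] at hτ
    rcases hτ with hτ | hτ
    · obtain ⟨q, _, rfl⟩ := Multiset.mem_map.1 hτ
      have h1 : ((q.2 : ℕ) : ℝ≥0) + 1 ≤ m := by exact_mod_cast q.2.2
      exact le_trans (by simpa using (hL e (by simp)).le) h1
    · exact ih (fun e he => hL e (by simp [he])) hτ

theorem Region.den_of_regionEquiv {R : Region P m} {M₁ M₂ : Marking P} (h₁ : M₁ ∈ R.den)
    (h : RegionEquiv m M₁ M₂) : M₂ ∈ R.den := by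
  rw [Region.mem_den_iff] at h₁ ⊢
  obtain ⟨L, B, hL, hs, hL', hB, hB', hM⟩ := h₁
  obtain ⟨Φ, hΦ, V, rfl, rfl, hV⟩ := h
  obtain ⟨V', VB, rfl, hV', hVB⟩ := exists_add_of_map_eq_add hM
  obtain ⟨VE, VG, rfl, hVE, hVG⟩ := exists_add_of_map_eq_add hV'
  -- Tokens of age at most `m` cannot be matched by the clause for ages above `m`, so on them the
  -- pairing is given by Φ.
  have key : ∀ U : Multiset (P × ℝ≥0 × ℝ≥0), (∀ v ∈ U, v ∈ VE + VG + VB) →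
      (∀ τ ∈ U.map (fun v => (v.1, v.2.1)), τ.2 ≤ (m : ℝ≥0)) →
      U.map (fun v => (v.1, v.2.2)) =
        (U.map fun v => (v.1, v.2.1)).map fun τ => (τ.1, (Φ τ.2).toNNReal) := by
    intro U hU hU'
    rw [Multiset.map_map]
    refine Multiset.map_congr rfl fun v hv => ?_
    rcases hV v (hU v hv) with h | h
    · simp [← h]
    · exact absurd (hU' _ (Multiset.mem_map_of_mem _ hv)) (not_le.2 h.1)
  refine ⟨L.map fun e => ((Φ e.1).toNNReal, e.2), VB.map fun v => (v.1, v.2.2), ?_, ?_, ?_, ?_,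
    ?_, ?_⟩
  · rw [← hL]; simp [Function.comp_def]
  · rw [List.pairwise_map]
    refine hs.imp fun {a b} hab => ?_
    exact (Real.toNNReal_lt_toNNReal_iff_of_nonneg (hΦ.nonneg _)).2 (hΦ.strictMono hab)
  · intro e he
    obtain ⟨e', he', rfl⟩ := List.mem_map.1 he
    obtain ⟨h0, h1⟩ := hL' e' he'
    refine ⟨Real.toNNReal_pos.2 ?_, Real.toNNReal_lt_one.2 ?_⟩
    · rw [← hΦ.zero]; exact hΦ.strictMono h0
    · have := hΦ.nat 1
      rw [Nat.cast_one] at this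
      rw [← this]; exact hΦ.strictMono h1
  · rw [← hB, ← hVB]; simp [Multiset.map_map]
  · intro τ hτ
    obtain ⟨v, hv, rfl⟩ := Multiset.mem_map.1 hτ
    have h1 := hB' (v.1, v.2.1) (hVB ▸ Multiset.mem_map_of_mem _ hv)
    exact (lt_iff_of_match hΦ (hV v (by simp [hv])) le_rfl).2.1 h1
  · rw [Multiset.map_add, Multiset.map_add, key VE (by simp +contextual) ?_,
      key VG (by simp +contextual) ?_, hVE, hVG, map_groupTokens hΦ]
    · congr 2
      simp only [exactTokens, Multiset.map_map, Function.comp_def]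
      refine Multiset.map_congr rfl fun q _ => ?_
      simp [hΦ.nat]
    · rw [hVG]
      exact fun τ => age_le_of_mem_groupTokens fun e he => (hL' e he).2
    · rw [hVE]
      intro τ hτ
      obtain ⟨q, _, rfl⟩ := Multiset.mem_map.1 hτ
      show ((q.2 : ℕ) : ℝ≥0) ≤ m
      exact_mod_cast Nat.lt_succ_iff.1 q.2.2

/-- The two increasing lists of fractional parts have equal length; a unit-equivariant map carrying
one to the other relates the markings, and the tokens above `m` are paired by their places alone. -/
theorem Region.regionEquiv_of_mem_den {R : Region P m} {M₁ M₂ : Marking P} (h₁ : M₁ ∈ R.den)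
    (h₂ : M₂ ∈ R.den) : RegionEquiv m M₁ M₂ := by
  rw [Region.mem_den_iff] at h₁ h₂
  obtain ⟨L₁, B₁, hL₁, hs₁, hL₁', hB₁, hB₁', rfl⟩ := h₁
  obtain ⟨L₂, B₂, hL₂, hs₂, hL₂', hB₂, hB₂', rfl⟩ := h₂
  have hmap : L₁.map Prod.snd = L₂.map Prod.snd := hL₁.trans hL₂.symm
  obtain ⟨Φ, hΦ, hΦL⟩ := exists_isUnitEquivariant (l₁ := L₁.map Prod.fst) (l₂ := L₂.map Prod.fst)
    (by simpa using congrArg List.length hmap) (List.pairwise_map.2 hs₁) (List.pairwise_map.2 hs₂)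
    (by
      intro x hx
      obtain ⟨e, he, rfl⟩ := List.mem_map.1 hx
      exact hL₁' e he)
    (by
      intro x hx
      obtain ⟨e, he, rfl⟩ := List.mem_map.1 hx
      exact hL₂' e he)
  have hLL : L₂ = L₁.map fun e => ((Φ e.1).toNNReal, e.2) := by
    rw [← List.zip_unzip L₂, List.unzip_eq_map, ← hmap, ← hΦL, List.map_map, List.zip_map']
    rfl
  obtain ⟨W, hW₁, hW₂, hW⟩ := exists_pairing_of_map_eq (hB₁.trans hB₂.symm)
  refine ⟨Φ, hΦ, (exactTokens R.b0).map (fun τ => (τ.1, τ.2, τ.2)) +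
    (groupTokens L₁).map (fun τ => (τ.1, τ.2, (Φ τ.2).toNNReal)) +
    W.map (fun w => (w.1.1, w.1.2, w.2.2)), ?_, ?_, ?_⟩
  · simp [Multiset.map_map, ← hW₁]
  · simp only [Multiset.map_add, Multiset.map_map, Function.comp_def, hLL, ← map_groupTokens hΦ,
      ← hW₂, Prod.mk.eta, Multiset.map_id']
    congr 1
    refine Multiset.map_congr rfl fun w hw => ?_
    rw [hW w hw]
  · intro v hv
    rcases Multiset.mem_add.1 hv with hv | hv
    · rcases Multiset.mem_add.1 hv with hv | hv
      · obtain ⟨τ, hτ, rfl⟩ := Multiset.mem_map.1 hv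
        obtain ⟨q, _, rfl⟩ := Multiset.mem_map.1 hτ
        left; simp [hΦ.nat]
      · obtain ⟨τ, hτ, rfl⟩ := Multiset.mem_map.1 hv
        exact .inl (Real.coe_toNNReal _ (hΦ.nonneg _))
    · obtain ⟨w, hw, rfl⟩ := Multiset.mem_map.1 hv
      refine .inr ⟨hB₁' _ ?_, hB₂' _ ?_⟩
      · rw [← hW₁]; exact Multiset.mem_map_of_mem _ hw
      · rw [← hW₂]; exact Multiset.mem_map_of_mem _ hw

theorem isRegionClosed_den (Z : MRUC P m) : IsRegionClosed m Z.den := by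
  constructor
  · rintro M₁ ⟨R, hR, M₀, hM₀, hle⟩ M₂ h
    exact ⟨R, hR, M₀, hM₀, hle.trans h⟩
  · rintro M₁ ⟨R, hR, M₀, hM₀, hle⟩ M₂ ⟨Φ, hΦ, V, rfl, rfl, hV⟩
    obtain ⟨V₀, hV₀, rfl⟩ := exists_le_of_le_map hle
    exact ⟨R, hR, V₀.map fun v => (v.1, v.2.2), Region.den_of_regionEquiv hM₀
      ⟨Φ, hΦ, V₀, rfl, rfl, fun v hv => hV v (Multiset.mem_of_le hV₀ hv)⟩,
      Multiset.map_le_map hV₀⟩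

/-! ### Finite bases of regions -/

theorem exists_region_mem (m : ℕ) (M : Marking P) : ∃ R : Region P m, M ∈ R.den := by
  classical
  let B := M.filter fun τ => (m : ℝ≥0) < τ.2
  let C := M.filter fun τ => ¬ (m : ℝ≥0) < τ.2
  let E := C.filter fun τ => ((⌊τ.2⌋₊ : ℕ) : ℝ≥0) = τ.2
  let G := C.filter fun τ => ¬ ((⌊τ.2⌋₊ : ℕ) : ℝ≥0) = τ.2
  obtain ⟨b0, -, hb0⟩ := exists_map_eq_of_forall (S := E) (Q := fun _ => True)
    (f := fun q : P × Fin (m + 1) => (q.1, ((q.2 : ℕ) : ℝ≥0))) (by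
      intro τ hτ
      simp only [E, C, Multiset.mem_filter, not_lt] at hτ
      refine ⟨(τ.1, ⟨⌊τ.2⌋₊, ?_⟩), trivial, Prod.ext rfl hτ.2⟩
      have : ((⌊τ.2⌋₊ : ℕ) : ℝ≥0) ≤ m := hτ.2.le.trans hτ.1.2
      exact Nat.lt_succ_iff.2 (by exact_mod_cast this))
  obtain ⟨A, hA, hAG⟩ := exists_map_eq_of_forall (S := G)
    (Q := fun a : (P × Fin m) × ℝ≥0 => 0 < a.2 ∧ a.2 < 1)
    (f := fun a : (P × Fin m) × ℝ≥0 => (a.1.1, ((a.1.2 : ℕ) : ℝ≥0) + a.2)) (by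
      intro τ hτ
      simp only [G, C, Multiset.mem_filter, not_lt] at hτ
      have hle : ((⌊τ.2⌋₊ : ℕ) : ℝ≥0) ≤ τ.2 := Nat.floor_le zero_le
      have hlt := lt_of_le_of_ne hle hτ.2
      refine ⟨((τ.1, ⟨⌊τ.2⌋₊, ?_⟩), τ.2 - (⌊τ.2⌋₊ : ℕ)), ⟨tsub_pos_of_lt hlt, ?_⟩, ?_⟩
      · exact_mod_cast hlt.trans_le hτ.1.2
      · rw [tsub_lt_iff_left hle]; exact Nat.lt_floor_add_one _
      · exact Prod.ext rfl (add_tsub_cancel_of_le hle))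
  obtain ⟨L, hs, hne, hsum⟩ := exists_sorted_groups A
  refine ⟨⟨b0, ⟨L.map Prod.snd, ?_⟩, B.map Prod.fst⟩, Region.mem_den_iff.2
    ⟨L, B, rfl, hs, ?_, rfl, ?_, ?_⟩⟩
  · intro b hb
    obtain ⟨e, he, rfl⟩ := List.mem_map.1 hb
    exact hne e he
  · intro e he
    obtain ⟨q, hq⟩ := Multiset.exists_mem_of_ne_zero (hne e he)
    refine hA (q, e.1) ?_
    rw [← hsum]
    exact Multiset.mem_of_le (List.single_le_sum (by simp) _ (List.mem_map_of_mem he))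
      (Multiset.mem_map_of_mem _ hq)
  · intro τ hτ
    exact (Multiset.mem_filter.1 hτ).2
  · rw [groupTokens_eq_map, hsum, hAG]
    show M = b0.map _ + G + B
    rw [hb0, Multiset.filter_add_not, add_comm, Multiset.filter_add_not]

/-- The embedding order of regions. -/
def Region.Embeds (R R' : Region P m) : Prop :=
  R.b0 ≤ R'.b0 ∧ R.bmax ≤ R'.bmax ∧ List.SublistForall₂ (· ≤ ·) R.w.1 R'.w.1

theorem Region.wellQuasiOrdered_embeds [Finite P] :
    WellQuasiOrdered (Region.Embeds : Region P m → Region P m → Prop) := by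
  have h := (wellQuasiOrdered_multiset_le (α := P × Fin (m + 1))).prod
    ((wellQuasiOrdered_multiset_le (α := P)).prod
      (wellQuasiOrdered_sublistForall (wellQuasiOrdered_multiset_le (α := P × Fin m))))
  intro f
  obtain ⟨i, j, hij, h'⟩ := h fun n => ((f n).b0, (f n).bmax, (f n).w.1)
  exact ⟨i, j, hij, h'⟩

/-- Each letter of the smaller word inherits the fractional part of the letter it embeds into. -/
theorem exists_sublist_groups {w w' : List (Multiset (P × Fin m))}
    (h : List.SublistForall₂ (· ≤ ·) w w') :
    ∀ L' : List (ℝ≥0 × Multiset (P × Fin m)), L'.map Prod.snd = w' →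
      ∃ L : List (ℝ≥0 × Multiset (P × Fin m)), L.map Prod.snd = w ∧
        (L.map Prod.fst).Sublist (L'.map Prod.fst) ∧ groupTokens L ≤ groupTokens L' := by
  induction h with
  | nil => exact fun L' _ => ⟨[], rfl, by simp, by simp⟩
  | @cons a₁ a₂ l₁ l₂ ha _ ih =>
    intro L' hL'
    obtain ⟨e, L₀, rfl, rfl, hL₀⟩ := List.map_eq_cons_iff.1 hL'
    obtain ⟨L, h1, h2, h3⟩ := ih L₀ hL₀
    refine ⟨(e.1, a₁) :: L, by simp [h1], by simpa using h2, ?_⟩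
    rw [groupTokens_cons, groupTokens_cons]
    exact add_le_add (Multiset.map_le_map ha) h3
  | cons_right _ ih =>
    intro L' hL'
    obtain ⟨e, L₀, rfl, rfl, hL₀⟩ := List.map_eq_cons_iff.1 hL'
    obtain ⟨L, h1, h2, h3⟩ := ih L₀ hL₀
    refine ⟨L, h1, by simpa using h2.cons _, ?_⟩
    rw [groupTokens_cons]
    exact h3.trans (Multiset.le_add_left _ _)

theorem Region.Embeds.exists_le_mem_den {R R' : Region P m} (h : R.Embeds R') {M : Marking P}
    (hM : M ∈ R'.den) : ∃ M₀ ∈ R.den, M₀ ≤ M := by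
  obtain ⟨L', B', hL', hs, hL'', hB, hB', rfl⟩ := Region.mem_den_iff.1 hM
  obtain ⟨L, h1, h2, h3⟩ := exists_sublist_groups h.2.2 L' hL'
  have hbm := h.2.1
  rw [← hB] at hbm
  obtain ⟨B, hBB, hB1⟩ := exists_le_of_le_map hbm
  refine ⟨_, Region.mem_den_iff.2 ⟨L, B, h1, ?_, ?_, hB1, fun τ hτ => hB' τ
    (Multiset.mem_of_le hBB hτ), rfl⟩, add_le_add (add_le_add (Multiset.map_le_map h.1) h3) hBB⟩
  · exact List.pairwise_map.1 ((List.pairwise_map.2 hs).sublist h2)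
  · intro e he
    obtain ⟨e', he', hee⟩ := List.mem_map.1 (h2.subset (List.mem_map_of_mem he))
    rw [← hee]; exact hL'' e' he'

/-- Sets closed under adding tokens and region equivalence are denoted by multi-region upward
closures. -/
theorem IsRegionClosed.exists_mruc [Finite P] {S : Set (Marking P)} (hS : IsRegionClosed m S) :
    ∃ Z : MRUC P m, Z.den = S := by
  obtain ⟨F, hF, hF'⟩ := exists_finset_basis (Region.wellQuasiOrdered_embeds (P := P) (m := m))
    {R | ∃ M ∈ R.den, M ∈ S}
  refine ⟨F, Set.Subset.antisymm ?_ ?_⟩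
  · rintro M ⟨R, hR, M₀, hM₀, hle⟩
    obtain ⟨M₁, hM₁, hM₁S⟩ := hF hR
    -- All markings of a region are equivalent, so one member of `S` in the region of the basis
    -- brings in the whole region.
    exact hS.1 _ (hS.2 _ hM₁S _ (Region.regionEquiv_of_mem_den hM₁ hM₀)) _ hle
  · intro M hM
    obtain ⟨R, hR⟩ := exists_region_mem m M
    obtain ⟨R', hR', hle⟩ := hF' R ⟨M, hR, hM⟩
    exact ⟨R', hR', hle.exists_le_mem_den hR⟩

theorem exists_isZ [Fintype P] [DecidableEq P] [Fintype T] (N : TPN P T) :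
    ∃ Z : MRUC P N.maxConst, IsZ N Z := by
  have h1 : ∀ M wp wm, ∃ Q : MRUC P N.maxConst,
      Q.den = preStar N (MRUC.den ({Reg M wp wm} : MRUC P N.maxConst)) := fun M wp wm =>
    (isRegionClosed_preStar (isRegionClosed_den _)).exists_mruc
  choose Q hQ using h1
  obtain ⟨Z, hZ⟩ := IsRegionClosed.exists_mruc (m := N.maxConst)
    (S := ⋃ M ∈ INFminStd N, ⋃ wp ∈ permPlus M, ⋂ wm ∈ permMinus M, (Q M wp wm).den)
    (.iUnion fun _ => .iUnion fun _ => .iUnion fun _ => .iUnion fun _ => .iInter fun _ =>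
      .iInter fun _ => isRegionClosed_den _)
  exact ⟨Z, Q, hQ, hZ⟩

end Equivalence

/-! ## Symbols and ages -/

section Symbols

variable {m : ℕ}

/-- The symbols are three families of indices. -/
def Sym.equivSum (m : ℕ) : Sym m ≃ (Fin (m + 1) ⊕ Fin (m + 1)) ⊕ Fin m where
  toFun
    | .exact k => .inl (.inl k)
    | .plus k => .inl (.inr k)
    | .minus k => .inr k
  invFun
    | .inl (.inl k) => .exact k
    | .inl (.inr k) => .plus k
    | .inr k => .minus k
  left_inv s := by cases s <;> rfl
  right_inv s := by rcases s with (s | s) | s <;> rfl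

noncomputable instance : DecidableEq (Sym m) := Classical.decEq _

instance : Fintype (Sym m) := Fintype.ofEquiv _ (Sym.equivSum m).symm

theorem Sym.sum_eq {A : Type*} [AddCommMonoid A] (f : Sym m → A) :
    ∑ s, f s = (∑ k, f (.exact k) + ∑ k, f (.plus k)) + ∑ k, f (.minus k) := by
  rw [← Fintype.sum_equiv (Sym.equivSum m).symm (fun s => f ((Sym.equivSum m).symm s)) f
    fun _ => rfl, Fintype.sum_sum_type, Fintype.sum_sum_type]
  rfl

/-- The ages represented by a symbol. -/
def Sym.Realizes : Sym m → ℝ≥0 → Prop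
  | .exact k, x => x = (k : ℕ)
  | .plus k, x => ((k : ℕ) : ℝ≥0) < x ∧ ((k : ℕ) < m → x < (k : ℕ) + 1)
  | .minus k, x => ((k : ℕ) : ℝ≥0) < x ∧ x < (k : ℕ) + 1

theorem Sym.Realizes.lt_iff {s : Sym m} {x : ℝ≥0} (h : s.Realizes x) {n : ℕ} (hn : n ≤ m) :
    (x < n ↔ s.rank < 3 * n) ∧ ((n : ℝ≥0) < x ↔ 3 * n < s.rank) := by
  -- Common to plus and minus symbols: an age inside (k, k+1), or anywhere above k when k = m, lies
  -- strictly on one side of each integer up to m.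
  have mid : ∀ k : ℕ, (k : ℝ≥0) < x → (k < m → x < k + 1) →
      (x < n ↔ k < n) ∧ ((n : ℝ≥0) < x ↔ n ≤ k) := by
    intro k h1 h2
    rcases lt_or_ge k n with hk | hk
    · have h3 : ((k : ℝ≥0) + 1) ≤ n := by exact_mod_cast hk
      have h4 := (h2 (hk.trans_le hn)).trans_le h3
      simp [h4, hk, h4.not_gt]
    · have h3 : (n : ℝ≥0) ≤ k := by exact_mod_cast hk
      have h4 := h3.trans_lt h1
      simp [h4, hk, h4.not_gt]
  cases s with
  | exact k =>
    have h : x = (k : ℕ) := h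
    subst h
    simp only [Sym.rank, Nat.cast_lt]
    omega
  | plus k =>
    obtain ⟨h1, h2⟩ := mid k h.1 h.2
    rw [h1, h2, Sym.rank]
    omega
  | minus k =>
    obtain ⟨h1, h2⟩ := mid k h.1 fun _ => h.2
    rw [h1, h2, Sym.rank]
    omega

theorem Sym.Realizes.mem_enc_iff {s : Sym m} {x : ℝ≥0} (h : s.Realizes x) {I : Intrv}
    (hI : I.maxConst ≤ m) : s ∈ enc m I ↔ I.Mem x := by
  have hl := h.lt_iff (I.lower_le_maxConst.trans hI)
  simp only [enc, Set.mem_ofPred_eq, Intrv.Mem]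
  refine and_congr ?_ (forall_congr' fun b => imp_congr_right fun hb => ?_)
  · split_ifs
    · rw [← not_lt, ← hl.1, not_lt]
    · exact hl.2.symm
  · have hu := h.lt_iff ((Intrv.upper_le_maxConst hb).trans hI)
    split_ifs
    · rw [← not_lt, ← hu.2, not_lt]
    · exact hu.1.symm

end Symbols

/-! ## Zeno markings -/

section Zeno

variable {P T : Type*} [Fintype P] {N : TPN P T}

theorem mem_ZENO_of_step {l : Label T} {M M' : Marking P} (hs : Step N l M M')
    (h : M' ∈ ZENO N) : M ∈ ZENO N := by
  obtain ⟨m, ⟨π, hπ, hm⟩⟩ := Set.mem_iUnion.1 h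
  refine Set.mem_iUnion.2 ⟨l.delay + m, ⟨fun n => n.casesOn M π.state, fun n => n.casesOn l π.label,
    ?_, ?_⟩, rfl, ?_⟩
  · rintro (_ | i)
    · show Step N l M (π.state 0)
      rwa [hπ]
    · exact π.step i
  · intro n
    obtain ⟨i, hi, t, ht⟩ := π.disc_often n
    exact ⟨i + 1, by omega, t, ht⟩
  · rw [InfComputation.totalDelay, tsum_eq_zero_add' ENNReal.summable, ENNReal.coe_add]
    exact add_le_add le_rfl hm

theorem preStar_ZENO_subset : preStar N (ZENO N) ⊆ ZENO N := by
  rintro M ⟨M', hM', hr⟩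
  induction hr using Relation.ReflTransGen.head_induction_on with
  | refl => exact hM'
  | head h _ ih => exact mem_ZENO_of_step h.choose_spec ih

end Zeno

/-! ## Runs of the associated net -/

section FiresLemmas

variable {Q U : Type*} {N : SDTN Q U}

open Classical in
-- The additive form avoids truncated subtraction and makes the token counts accessible to linear
-- arithmetic.
theorem SDTN.Fires.count {t : U} {M M' : Q → ℕ} (h : N.Fires t M M') (p : Q) :
    M' p + (if p ∈ N.input t ∧ p ∉ N.output t then 1 else 0) =
      M p + (if p ∈ N.output t ∧ p ∉ N.input t then 1 else 0) := by
  obtain ⟨h0, h⟩ := h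
  obtain ⟨h1, h2, h3, h4⟩ := h p
  by_cases hi : p ∈ N.input t <;> by_cases ho : p ∈ N.output t
  · simp [hi, ho, h1 hi ho]
  · have := h0 p hi
    have := h2 hi ho
    simp only [hi, ho, not_false_eq_true, and_self, if_true, false_and, if_false]
    omega
  · simp [hi, ho, h3 hi ho]
  · simp [hi, ho, h4 hi ho]

end FiresLemmas

section Net

variable {P T : Type*} [Fintype P] [Fintype T] {N : TPN P T}

theorem isTok_of_mem_arcPlaces {P : Type*} {m : ℕ} {arcs : P → Option Intrv} {A : Set (Place P m)}
    (hA : A ∈ arcPlaces m arcs) :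
    Place.disc ∉ A ∧ Place.time1 ∉ A ∧ Place.time2 ∉ A ∧ Place.count ∉ A := by
  obtain ⟨s, -, rfl⟩ := hA
  simp

/-- The effect of the transfer transition. -/
theorem firesTrans_iff {M M' : Place P N.maxConst → ℕ} (h : N.toSDTN.FiresTrans M M') :
    M .time1 = M' .time1 + 1 ∧ M' .time2 = M .time2 + 1 ∧ M' .disc = M .disc ∧ M' .count = 0 ∧
    (∀ p k, M' (.tok p (.exact k)) = 0) ∧
    (∀ p k, M' (.tok p (.plus k)) = M (.tok p (.plus k)) + M (.tok p (.exact k))) ∧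
    ∀ p k, M' (.tok p (.minus k)) = M (.tok p (.minus k)) := by
  obtain ⟨h0, h⟩ := h
  refine ⟨?_, ?_, ?_, ?_, fun p k => ?_, fun p k => ?_, fun p k => ?_⟩
  · have h1 := h0 .time1 rfl
    have h2 := (h .time1).2.1 rfl (by simp [TPN.toSDTN])
    omega
  · exact (h .time2).2.2.1 (by simp [TPN.toSDTN]) rfl
  · exact (h .disc).2.2.2.2.2 (by simp [TPN.toSDTN]) (by simp [TPN.toSDTN])
      (by simp [TPN.toSDTN, transferArcs]) (by simp [TPN.toSDTN, transferArcs])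
  · exact (h .count).2.2.2.1 .dump (.inr rfl)
  · exact (h (.tok p (.exact k))).2.2.2.1 (.tok p (.plus k)) (.inl ⟨p, k, rfl⟩)
  · exact (h (.tok p (.plus k))).2.2.2.2.1 (.tok p (.exact k)) (.inl ⟨p, k, rfl⟩)
  · exact (h (.tok p (.minus k))).2.2.2.2.2 (by simp [TPN.toSDTN]) (by simp [TPN.toSDTN])
      (by simp [TPN.toSDTN, transferArcs]) (by simp [TPN.toSDTN, transferArcs])

/-- The tokens that are waiting for their next integer age and the control tokens, weighted so
that every transition other than the simulation of a discrete one decreases the sum. -/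
def potential {m : ℕ} (M : Place P m → ℕ) : ℕ :=
  (∑ q : P × Fin m, M (.tok q.1 (.minus q.2))) + 3 * M .count + 2 * M .time1 + M .time2

/-- Transitions that simulate a discrete transition. -/
def Trans.IsFire {m : ℕ} (v : Trans N m) : Prop := ∃ t A B hA hB, v = .fire t A B hA hB

open Classical in
-- The weights 3, 2, 1, 0 of count, time1, time2 and disc drop along the control cycle, and `reach`
-- and `exceed` use up a waiting token.
theorem potential_lt_of_fires {v : Trans N N.maxConst} (hv : ¬ v.IsFire)
    {M M' : Place P N.maxConst → ℕ} (h : N.toSDTN.Fires v M M') : potential M' < potential M := by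
  have hd := h.count .disc
  have h1 := h.count .time1
  have h2 := h.count .time2
  have hc := h.count .count
  have ht : ∀ p k, _ := fun p k => h.count (.tok p (.minus k))
  cases v with
  | fire t A B hA hB => exact absurd ⟨t, A, B, hA, hB, rfl⟩ hv
  | switchTime =>
    simp only [TPN.toSDTN, Trans.input, Trans.output] at hd h1 h2 hc ht
    simp at hd h1 h2 hc ht
    simp only [potential, ht]
    omega
  | switchDisc =>
    simp only [TPN.toSDTN, Trans.input, Trans.output] at hd h1 h2 hc ht
    simp at hd h1 h2 hc ht
    simp only [potential, ht]
    omega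
  | reach p k =>
    simp only [TPN.toSDTN, Trans.input, Trans.output] at hd h1 h2 hc ht
    simp at hd h1 h2 hc ht
    have h3 : ∑ q : P × Fin N.maxConst, M (.tok q.1 (.minus q.2)) =
        ∑ q : P × Fin N.maxConst, M' (.tok q.1 (.minus q.2)) + 1 := by
      simp only [← ht, Finset.sum_add_distrib]
      congr 1
      rw [Finset.sum_eq_single (p, k)] <;> simp +contextual [Prod.ext_iff]
    simp only [potential, h3]
    omega
  | exceed p k =>
    simp only [TPN.toSDTN, Trans.input, Trans.output] at hd h1 h2 hc ht
    simp at hd h1 h2 hc ht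
    have h3 : ∑ q : P × Fin N.maxConst, M (.tok q.1 (.minus q.2)) =
        ∑ q : P × Fin N.maxConst, M' (.tok q.1 (.minus q.2)) + 1 := by
      simp only [← ht, Finset.sum_add_distrib]
      congr 1
      rw [Finset.sum_eq_single (p, k)] <;> simp +contextual [Prod.ext_iff]
    simp only [potential, h3]
    omega

theorem potential_lt_of_firesTrans {M M' : Place P N.maxConst → ℕ}
    (h : N.toSDTN.FiresTrans M M') : potential M' < potential M := by
  obtain ⟨h1, h2, -, h4, -, -, h5⟩ := firesTrans_iff h
  simp only [potential, h5]
  omega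

/-- An infinite computation of the associated net from a standard marking. The transition `none`
is the transfer transition. -/
structure Run (N : TPN P T) where
  σ : ℕ → Place P N.maxConst → ℕ
  u : ℕ → Option (Trans N N.maxConst)
  fires : ∀ i v, u i = some v → N.toSDTN.Fires v (σ i) (σ (i + 1))
  trans : ∀ i, u i = none → N.toSDTN.FiresTrans (σ i) (σ (i + 1))
  standard : IsStandard (σ 0)

theorem exists_run {M : Place P N.maxConst → ℕ} (hM : M ∈ N.toSDTN.INF) (hs : IsStandard M) :
    ∃ r : Run N, r.σ 0 = M := by
  obtain ⟨σ, rfl, hσ⟩ := hM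
  have h : ∀ i, ∃ u : Option (Trans N N.maxConst),
      (∀ v, u = some v → N.toSDTN.Fires v (σ i) (σ (i + 1))) ∧
      (u = none → N.toSDTN.FiresTrans (σ i) (σ (i + 1))) := by
    intro i
    rcases hσ i with ⟨t, ht⟩ | ht
    · exact ⟨some t, by rintro _ ⟨⟩; exact ht, by simp⟩
    · exact ⟨none, by simp, fun _ => ht⟩
  choose u h1 h2 using h
  exact ⟨⟨σ, u, h1, h2, hs⟩, rfl⟩

/-! ### Phases, queues and fates along a run -/

namespace Run

variable (r : Run N)

/-- The potential cannot decrease forever. The place count serves this purpose: each time phase has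
to be paid for by a discrete transition. -/
theorem fire_often (n : ℕ) : ∃ i, n ≤ i ∧ ∃ v, r.u i = some v ∧ v.IsFire := by
  by_contra hc
  push Not at hc
  have hlt : ∀ i, n ≤ i → potential (r.σ (i + 1)) < potential (r.σ i) := by
    intro i hi
    cases hu : r.u i with
    | none => exact potential_lt_of_firesTrans (r.trans i hu)
    | some v => exact potential_lt_of_fires (hc i hi v hu) (r.fires i v hu)
  have h2 : ∀ j, potential (r.σ (n + j)) + j ≤ potential (r.σ n) := by
    intro j
    induction j with
    | zero => simp
    | succ j ih => have := hlt (n + j) (by omega); rw [add_assoc] at this; omega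
  have := h2 (potential (r.σ n) + 1)
  omega

open Classical in
-- There is always exactly one control token, so discrete and time phases cannot overlap.
theorem mode (i : ℕ) : r.σ i .disc + r.σ i .time1 + r.σ i .time2 = 1 := by
  induction i with
  | zero => have h := r.standard; simp [h.1, h.2.1, h.2.2.1]
  | succ i ih =>
    cases hu : r.u i with
    | none =>
      obtain ⟨h1, h2, h3, -⟩ := firesTrans_iff (r.trans i hu)
      omega
    | some v =>
      have h := r.fires i v hu
      have hd := h.count .disc
      have h1 := h.count .time1
      have h2 := h.count .time2
      cases v with
      | fire t A B hA hB =>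
        obtain ⟨a1, a2, a3, a4⟩ := isTok_of_mem_arcPlaces hA
        obtain ⟨b1, b2, b3, b4⟩ := isTok_of_mem_arcPlaces hB
        simp only [TPN.toSDTN, Trans.input, Trans.output] at hd h1 h2
        simp [*] at hd h1 h2
        omega
      | switchTime =>
        simp only [TPN.toSDTN, Trans.input, Trans.output] at hd h1 h2
        simp at hd h1 h2
        omega
      | switchDisc =>
        simp only [TPN.toSDTN, Trans.input, Trans.output] at hd h1 h2
        simp at hd h1 h2
        omega
      | reach p k =>
        simp only [TPN.toSDTN, Trans.input, Trans.output] at hd h1 h2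
        simp at hd h1 h2
        omega
      | exceed p k =>
        simp only [TPN.toSDTN, Trans.input, Trans.output] at hd h1 h2
        simp at hd h1 h2
        omega

/-- The number of transfers before step `i`. -/
noncomputable def phase (i : ℕ) : ℕ := by
  classical exact Nat.count (fun j => r.u j = none) i

theorem phase_zero : r.phase 0 = 0 := by simp [phase]

theorem phase_succ_none {i : ℕ} (h : r.u i = none) : r.phase (i + 1) = r.phase i + 1 := by
  simp [phase, Nat.count_succ, h]

theorem phase_succ_some {i : ℕ} {v : Trans N N.maxConst} (h : r.u i = some v) :
    r.phase (i + 1) = r.phase i := by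
  simp [phase, Nat.count_succ, h]

open Classical in
/-- Between a discrete phase and a later time phase there is a transfer. -/
theorem phase_lt_of_le {i j : ℕ} (hi : r.σ i .disc = 1) (hij : i ≤ j)
    (hj : 1 ≤ r.σ j .time2) : r.phase i < r.phase j := by
  have key : ∀ j, i ≤ j → r.phase i ≤ r.phase j ∧ (r.phase i < r.phase j ∨ r.σ j .time2 = 0) := by
    intro j hij
    induction j, hij using Nat.le_induction with
    | base => have := r.mode i; exact ⟨le_rfl, .inr (by omega)⟩
    | succ j _ ih =>
      cases hu : r.u j with
      | none => rw [r.phase_succ_none hu]; omega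
      | some v =>
        rw [r.phase_succ_some hu]
        have h2 := (r.fires j v hu).count .time2
        cases v with
        | fire t A B hA hB =>
          obtain ⟨a1, a2, a3, a4⟩ := isTok_of_mem_arcPlaces hA
          obtain ⟨b1, b2, b3, b4⟩ := isTok_of_mem_arcPlaces hB
          simp only [TPN.toSDTN, Trans.input, Trans.output] at h2
          simp [*] at h2
          omega
        | switchTime =>
          simp only [TPN.toSDTN, Trans.input, Trans.output] at h2
          simp at h2
          omega
        | switchDisc =>
          simp only [TPN.toSDTN, Trans.input, Trans.output] at h2
          simp at h2
          omega
        | reach p k =>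
          simp only [TPN.toSDTN, Trans.input, Trans.output] at h2
          simp at h2
          omega
        | exceed p k =>
          simp only [TPN.toSDTN, Trans.input, Trans.output] at h2
          simp at h2
          omega
  have := (key j hij).2
  omega

/-- Step `i` takes a token away from the place `p((k+1)-)`. -/
def Removes (p : P) (k : Fin N.maxConst) (i : ℕ) : Prop :=
  ∃ v, r.u i = some v ∧ .tok p (.minus k) ∈ v.input ∧ .tok p (.minus k) ∉ v.output

/-- Step `i` puts a token on the place `p((k+1)-)`. -/
def Adds (p : P) (k : Fin N.maxConst) (i : ℕ) : Prop :=
  ∃ v, r.u i = some v ∧ .tok p (.minus k) ∈ v.output ∧ .tok p (.minus k) ∉ v.input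

/-- The tokens on `p((k+1)-)` are numbered in the order of their arrival and removed in the same
order; `lo` is the number of the oldest token present before step `i`. -/
noncomputable def lo (p : P) (k : Fin N.maxConst) (i : ℕ) : ℕ := by
  classical exact Nat.count (r.Removes p k) i

/-- The number of the next token to arrive on `p((k+1)-)`. -/
noncomputable def hi (p : P) (k : Fin N.maxConst) (i : ℕ) : ℕ := by
  classical exact r.σ 0 (.tok p (.minus k)) + Nat.count (r.Adds p k) i

variable {r} in
theorem lo_succ_of_removes {p : P} {k : Fin N.maxConst} {i : ℕ} (h : r.Removes p k i) :
    r.lo p k (i + 1) = r.lo p k i + 1 := by simp [lo, Nat.count_succ, h]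

variable {r} in
theorem lo_succ_of_not_removes {p : P} {k : Fin N.maxConst} {i : ℕ} (h : ¬ r.Removes p k i) :
    r.lo p k (i + 1) = r.lo p k i := by simp [lo, Nat.count_succ, h]

variable {r} in
theorem hi_succ_of_adds {p : P} {k : Fin N.maxConst} {i : ℕ} (h : r.Adds p k i) :
    r.hi p k (i + 1) = r.hi p k i + 1 := by simp [hi, Nat.count_succ, h, add_assoc]

variable {r} in
theorem hi_succ_of_not_adds {p : P} {k : Fin N.maxConst} {i : ℕ} (h : ¬ r.Adds p k i) :
    r.hi p k (i + 1) = r.hi p k i := by simp [hi, Nat.count_succ, h]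

theorem lo_zero (p : P) (k : Fin N.maxConst) : r.lo p k 0 = 0 := by simp [lo]

theorem hi_zero (p : P) (k : Fin N.maxConst) : r.hi p k 0 = r.σ 0 (.tok p (.minus k)) := by
  simp [hi]

/-- The waiting tokens before step `i` are exactly those numbered from `lo` up to `hi` (excluded).
-/
theorem lo_add (p : P) (k : Fin N.maxConst) (i : ℕ) :
    r.lo p k i + r.σ i (.tok p (.minus k)) = r.hi p k i := by
  classical
  induction i with
  | zero => simp [lo_zero, hi_zero]
  | succ i ih =>
    cases hu : r.u i with
    | none =>
      have h := (firesTrans_iff (r.trans i hu)).2.2.2.2.2.2 p k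
      have h1 : ¬ r.Removes p k i := by simp [Removes, hu]
      have h2 : ¬ r.Adds p k i := by simp [Adds, hu]
      rw [lo_succ_of_not_removes h1, hi_succ_of_not_adds h2]
      omega
    | some v =>
      have h := (r.fires i v hu).count (.tok p (.minus k))
      have h1 : r.Removes p k i ↔ .tok p (.minus k) ∈ v.input ∧ .tok p (.minus k) ∉ v.output := by
        simp [Removes, hu]
      have h2 : r.Adds p k i ↔ .tok p (.minus k) ∈ v.output ∧ .tok p (.minus k) ∉ v.input := by
        simp [Adds, hu]
      simp only [TPN.toSDTN, ← h1, ← h2] at h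
      by_cases hr : r.Removes p k i <;> by_cases ha : r.Adds p k i <;>
        simp only [hr, ha, if_true, if_false] at h
      · exact absurd (h1.1 hr).1 (h2.1 ha).2
      · rw [lo_succ_of_removes hr, hi_succ_of_not_adds ha]; omega
      · rw [lo_succ_of_not_removes hr, hi_succ_of_adds ha]; omega
      · rw [lo_succ_of_not_removes hr, hi_succ_of_not_adds ha]; omega

/-- What a transition that removes a token from `p((k+1)-)` in phase `n` makes of it: an age that
is reached in phase `n`, exceeded in phase `n`, or never attained. -/
noncomputable def fateOf (n : ℕ) : Option (Trans N N.maxConst) → ℕ∞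
  | some (.reach _ _) => (2 * n : ℕ)
  | some (.exceed _ _) => (2 * n - 1 : ℕ)
  | _ => ⊤

open Classical in
/-- The fate of the token with number `a` on `p((k+1)-)`. -/
noncomputable def fate (p : P) (k : Fin N.maxConst) (a : ℕ) : ℕ∞ :=
  if h : ∃ j, r.Removes p k j ∧ r.lo p k j = a then fateOf (r.phase h.choose) (r.u h.choose)
  else ⊤

variable {r} in
-- `lo` grows at every removal, so the step that removes a given number is unique and the choice in
-- `fate` is harmless.
theorem fate_lo {p : P} {k : Fin N.maxConst} {j : ℕ} (h : r.Removes p k j) :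
    r.fate p k (r.lo p k j) = fateOf (r.phase j) (r.u j) := by
  classical
  have hex : ∃ j', r.Removes p k j' ∧ r.lo p k j' = r.lo p k j := ⟨j, h, rfl⟩
  have h1 := hex.choose_spec
  have h2 : hex.choose = j := Nat.count_injective h1.1 h h1.2
  rw [fate, dif_pos hex, h2]

theorem lo_mono (p : P) (k : Fin N.maxConst) {i j : ℕ} (h : i ≤ j) : r.lo p k i ≤ r.lo p k j := by
  classical exact Nat.count_monotone _ h

/-- Tokens that are present or absent in a discrete phase do not get their fate before the next
phase. -/
theorem lt_fate {p : P} {k : Fin N.maxConst} {i a : ℕ} (hi : r.σ i .disc = 1)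
    (ha : r.lo p k i ≤ a) : ((2 * r.phase i : ℕ) : ℕ∞) < r.fate p k a := by
  by_cases hex : ∃ j, r.Removes p k j ∧ r.lo p k j = a
  · obtain ⟨j, hj, rfl⟩ := hex
    rw [fate_lo hj]
    -- A removal before step `i` would have pushed `lo` beyond its number by then.
    have hij : i ≤ j := by
      by_contra hc
      have h1 := r.lo_mono p k (show j + 1 ≤ i by omega)
      rw [lo_succ_of_removes hj] at h1
      omega
    cases hu : r.u j with
    | none => exact ENat.natCast_lt_top _
    | some v =>
      have hf := (r.fires j v hu).1
      cases v with
      | reach p' k' =>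
        have := r.phase_lt_of_le hi hij (hf .time2 (by simp [TPN.toSDTN, Trans.input]))
        show ((2 * r.phase i : ℕ) : ℕ∞) < (2 * r.phase j : ℕ)
        exact_mod_cast (by omega : 2 * r.phase i < 2 * r.phase j)
      | exceed p' k' =>
        have := r.phase_lt_of_le hi hij (hf .time2 (by simp [TPN.toSDTN, Trans.input]))
        -- The transition happens in a later phase, and 2n - 1 still exceeds 2(n - 1): this is why
        -- phases are doubled, leaving a time between the ends of two phases for tokens that
        -- overshoot.
        show ((2 * r.phase i : ℕ) : ℕ∞) < (2 * r.phase j - 1 : ℕ)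
        exact_mod_cast (by omega : 2 * r.phase i < 2 * r.phase j - 1)
      | _ => exact ENat.natCast_lt_top _
  · rw [fate, dif_neg hex]
    exact ENat.natCast_lt_top _

theorem fate_pos (p : P) (k : Fin N.maxConst) (a : ℕ) : 0 < r.fate p k a := by
  simpa [phase_zero] using r.lt_fate (p := p) (k := k) (i := 0) (a := a) r.standard.1
    (by simp [lo_zero])

end Run

end Net

/-! ## Timed computations from runs of the associated net -/

/-- The marking with the tokens `(p, x)` for `x` in `W p s`, where `s` is any symbol. -/
def flatten {P : Type*} [Fintype P] {m : ℕ} (W : P → Sym m → Multiset ℝ≥0) : Marking P :=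
  ∑ p, ∑ s, (W p s).map fun x => (p, x)

theorem flatten_add {P : Type*} [Fintype P] {m : ℕ} (W W' : P → Sym m → Multiset ℝ≥0) :
    flatten (fun p s => W p s + W' p s) = flatten W + flatten W' := by
  simp [flatten, Finset.sum_add_distrib]

theorem map_flatten {P : Type*} [Fintype P] {m : ℕ} (W : P → Sym m → Multiset ℝ≥0)
    (f : ℝ≥0 → ℝ≥0) :
    (flatten W).map (fun τ => (τ.1, f τ.2)) = flatten fun p s => (W p s).map f := by
  simp only [flatten, ← Multiset.coe_mapAddMonoidHom, map_sum]
  simp only [Multiset.coe_mapAddMonoidHom, Multiset.map_map]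
  rfl

open Classical in
theorem flatten_arcs {P : Type*} [Fintype P] {m : ℕ} (arcs : P → Option Intrv) (s : P → Sym m)
    (X : P → Sym m → ℝ≥0) :
    flatten (fun p s' => if (arcs p).isSome = true ∧ s' = s p then {X p s'} else 0) =
      arcTokens arcs fun p => X p (s p) := by
  have h1 : ∀ p, (∑ s', (if (arcs p).isSome = true ∧ s' = s p then {X p s'} else 0 :
      Multiset ℝ≥0).map fun x => (p, x)) = if (arcs p).isSome = true then {(p, X p (s p))} else 0 := by
    intro p
    rw [Finset.sum_eq_single (s p)]
    · split_ifs <;> simp_all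
    · intro b _ hb
      simp [hb]
    · simp
  simp only [flatten, h1]
  rw [← Finset.sum_filter, arcTokens]
  ext τ
  rw [← Multiset.sum_map_singleton (Multiset.map _ _), Multiset.map_map]
  rfl

theorem step_zero {P T : Type*} [Fintype P] {N : TPN P T} (M : Marking P) :
    Step N (.time 0) M M := by
  simp [Step]

section Net

variable {P T : Type*} [Fintype P] [Fintype T] {N : TPN P T}

namespace Run

variable (r : Run N)

/-- The age before step `i` of the token with number `a` on `p((k+1)-)`, when the fate `v` comes
at time `g v`. -/
noncomputable def age (g : ℕ∞ → ℝ) (p : P) (k : Fin N.maxConst) (i a : ℕ) : ℝ≥0 :=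
  ((k : ℕ) + 1 + g (2 * r.phase i : ℕ) - g (r.fate p k a)).toNNReal

/-- The ages of the tokens on `p` that represent the symbol `s` before step `i`. -/
def PlaceInv (g : ℕ∞ → ℝ) (i : ℕ) (p : P) (s : Sym N.maxConst) (w : Multiset ℝ≥0) : Prop :=
  w.card = r.σ i (.tok p s) ∧ match s with
    | .exact k => ∀ x ∈ w, x = (k : ℕ)
    | .plus k => ∀ x ∈ w, ((k : ℕ) : ℝ≥0) < x ∧
        ((k : ℕ) < N.maxConst → (x : ℝ) + g ⊤ < (k : ℕ) + 1 + g (2 * r.phase i : ℕ))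
    | .minus k => w = (Finset.Ico (r.lo p k i) (r.hi p k i)).val.map (r.age g p k i)

/-- The times of the fates: `g ⊤` bounds the duration of the computation. -/
structure IsSchedule (g : ℕ∞ → ℝ) : Prop where
  strictMono : StrictMono g
  zero : g 0 = 0
  top : g ⊤ < 1

variable {r} {g : ℕ∞ → ℝ}

theorem IsSchedule.nonneg (hg : IsSchedule g) (v : ℕ∞) : 0 ≤ g v := by
  rw [← hg.zero]; exact hg.strictMono.monotone bot_le

theorem IsSchedule.lt_one (hg : IsSchedule g) (v : ℕ∞) : g v < 1 :=
  (hg.strictMono.monotone le_top).trans_lt hg.top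

/-- The truncation in `age` is never effective, since the values of `g` lie in [0, 1). -/
theorem coe_age (hg : IsSchedule g) (p : P) (k : Fin N.maxConst) (i a : ℕ) :
    (r.age g p k i a : ℝ) = (k : ℕ) + 1 + g (2 * r.phase i : ℕ) - g (r.fate p k a) := by
  have h1 := hg.nonneg (2 * r.phase i : ℕ)
  have h2 := hg.lt_one (r.fate p k a)
  have h3 : (0 : ℝ) ≤ (k : ℕ) := Nat.cast_nonneg _
  exact Real.coe_toNNReal _ (by linarith)

/-- In a discrete phase the fate of a waiting token is still to come and lies less than one time
unit ahead. After a transfer this may fail until the token is relabelled. -/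
theorem realizes_age (hg : IsSchedule g) {p : P} {k : Fin N.maxConst} {i a : ℕ}
    (hi : r.σ i .disc = 1) (ha : r.lo p k i ≤ a) : (Sym.minus k).Realizes (r.age g p k i a) := by
  have h1 := hg.strictMono (r.lt_fate hi ha)
  have h2 := hg.nonneg (2 * r.phase i : ℕ)
  have h3 := hg.lt_one (r.fate p k a)
  constructor
  · rw [← NNReal.coe_lt_coe, coe_age hg, NNReal.coe_natCast]; linarith
  · rw [← NNReal.coe_lt_coe, coe_age hg, NNReal.coe_add, NNReal.coe_natCast, NNReal.coe_one]
    linarith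

theorem age_congr {p : P} {k : Fin N.maxConst} {i : ℕ} (h : r.phase (i + 1) = r.phase i) :
    r.age g p k (i + 1) = r.age g p k i := by
  funext a; simp [age, h]

theorem PlaceInv.minus_iff {i : ℕ} {p : P} {k : Fin N.maxConst} {w : Multiset ℝ≥0} :
    r.PlaceInv g i p (.minus k) w ↔
      w = (Finset.Ico (r.lo p k i) (r.hi p k i)).val.map (r.age g p k i) := by
  refine ⟨fun h => h.2, fun h => ⟨?_, h⟩⟩
  have := r.lo_add p k i
  rw [h, Multiset.card_map]
  show (Finset.Ico _ _).card = _
  rw [Nat.card_Ico]; omega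

open Classical in
/-- Choice of a token to be removed and of a token to be added among those that satisfy `Q`. -/
theorem exists_replace {Q : ℝ≥0 → Prop} {w : Multiset ℝ≥0} (hw : ∀ x ∈ w, Q x) {y₀ : ℝ≥0}
    (hy₀ : Q y₀) {a b : Prop} (ha : a → 1 ≤ w.card) {c : ℕ}
    (hc : c + (if a ∧ ¬ b then 1 else 0) = w.card + (if b ∧ ¬ a then 1 else 0)) :
    ∃ x y s, w = (if a then {x} else 0) + s ∧ ((if b then {y} else 0) + s).card = c ∧
      (∀ z ∈ (if b then {y} else 0) + s, Q z) ∧ (a → Q x) ∧ (b → Q y) := by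
  by_cases h : a
  · obtain ⟨x, hx⟩ := Multiset.card_pos_iff_exists_mem.1 (ha h)
    obtain ⟨s, rfl⟩ := Multiset.exists_cons_of_mem hx
    have hQx := hw x (by simp)
    refine ⟨x, y₀, s, by simp [h], ?_, ?_, fun _ => hQx, fun _ => hy₀⟩
    · by_cases hb : b <;> simp [h, hb] at hc ⊢ <;> omega
    · intro z hz
      by_cases hb : b
      · simp only [hb, if_true, Multiset.mem_add, Multiset.mem_singleton] at hz
        rcases hz with rfl | hz
        exacts [hy₀, hw z (by simp [hz])]
      · simp only [hb, if_false, zero_add] at hz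
        exact hw z (by simp [hz])
  · refine ⟨y₀, y₀, w, by simp [h], ?_, ?_, fun _ => hy₀, fun _ => hy₀⟩
    · by_cases hb : b <;> simp [h, hb] at hc ⊢ <;> omega
    · intro z hz
      by_cases hb : b
      · simp only [hb, if_true, Multiset.mem_add, Multiset.mem_singleton] at hz
        rcases hz with rfl | hz
        exacts [hy₀, hw z hz]
      · simp only [hb, if_false, zero_add] at hz
        exact hw z hz

theorem Ico_val_eq_cons {a b : ℕ} (h : a < b) :
    (Finset.Ico a b).val = a ::ₘ (Finset.Ico (a + 1) b).val := by
  rw [← Finset.insert_Ico_succ_left_eq_Ico h, Finset.insert_val_of_notMem (by simp)]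
  rfl

theorem Ico_val_succ_eq_cons {a b : ℕ} (h : a ≤ b) :
    (Finset.Ico a (b + 1)).val = b ::ₘ (Finset.Ico a b).val := by
  rw [← Finset.insert_Ico_right_eq_Ico_add_one h, Finset.insert_val_of_notMem (by simp)]

open Classical in
/-- The tokens on one place when the transition `v` other than the transfer fires. The minus
symbols lose the oldest token. -/
theorem PlaceInv.minus_fires {i : ℕ} {v : Trans N N.maxConst} (hv : r.u i = some v) {p : P}
    {k : Fin N.maxConst} {w : Multiset ℝ≥0} (hw : r.PlaceInv g i p (.minus k) w) :
    ∃ a b s, r.lo p k i ≤ a ∧ r.lo p k i ≤ b ∧ (.tok p (.minus k) ∉ v.output → a = r.lo p k i) ∧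
      w = (if .tok p (.minus k) ∈ v.input then {r.age g p k i a} else 0) + s ∧
      r.PlaceInv g (i + 1) p (.minus k)
        ((if .tok p (.minus k) ∈ v.output then {r.age g p k i b} else 0) + s) := by
  rw [PlaceInv.minus_iff] at hw
  have hph := r.phase_succ_some hv
  have hr : r.Removes p k i ↔ .tok p (.minus k) ∈ v.input ∧ .tok p (.minus k) ∉ v.output := by
    simp [Removes, hv]
  have ha : r.Adds p k i ↔ .tok p (.minus k) ∈ v.output ∧ .tok p (.minus k) ∉ v.input := by
    simp [Adds, hv]
  have hlh := r.lo_add p k i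
  have hin : Place.tok p (.minus k) ∈ v.input → r.lo p k i < r.hi p k i := by
    intro h
    have := (r.fires i v hv).1 _ h
    omega
  simp only [PlaceInv.minus_iff, age_congr hph]
  by_cases h1 : Place.tok p (.minus k) ∈ v.input <;>
    by_cases h2 : Place.tok p (.minus k) ∈ v.output <;>
    simp only [h1, h2, not_true, not_false_eq_true, and_true, and_false, iff_true,
      iff_false, if_true, if_false] at hr ha ⊢
  · rw [lo_succ_of_not_removes hr, hi_succ_of_not_adds ha]
    refine ⟨r.lo p k i, r.lo p k i, (Finset.Ico (r.lo p k i + 1) (r.hi p k i)).val.map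
      (r.age g p k i), le_rfl, le_rfl, by simp, ?_, ?_⟩
    · rw [hw, Ico_val_eq_cons (hin h1)]; simp
    · rw [Ico_val_eq_cons (hin h1)]; simp
  · rw [lo_succ_of_removes hr, hi_succ_of_not_adds ha]
    refine ⟨r.lo p k i, r.lo p k i, _, le_rfl, le_rfl, by simp, ?_, zero_add _⟩
    rw [hw, Ico_val_eq_cons (hin h1)]; simp
  · rw [lo_succ_of_not_removes hr, hi_succ_of_adds ha]
    refine ⟨r.lo p k i, r.hi p k i, _, le_rfl, by omega, by simp, (zero_add _).symm, ?_⟩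
    rw [hw, Ico_val_succ_eq_cons (by omega)]; simp
  · rw [lo_succ_of_not_removes hr, hi_succ_of_not_adds ha]
    exact ⟨r.lo p k i, r.lo p k i, _, le_rfl, le_rfl, by simp, (zero_add _).symm,
      by rw [zero_add, hw]⟩

open Classical in
-- In a discrete phase the tokens that satisfy the invariant realize their symbols, so the ones
-- chosen here can be consumed or created by a timed transition.
theorem PlaceInv.fires (hg : IsSchedule g) {i : ℕ} {v : Trans N N.maxConst} (hv : r.u i = some v)
    (hi : r.σ i .disc = 1) {p : P} {s : Sym N.maxConst} {w : Multiset ℝ≥0}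
    (hw : r.PlaceInv g i p s w) :
    ∃ x y z, w = (if .tok p s ∈ v.input then {x} else 0) + z ∧
      r.PlaceInv g (i + 1) p s ((if .tok p s ∈ v.output then {y} else 0) + z) ∧
      (.tok p s ∈ v.input → s.Realizes x) ∧ (.tok p s ∈ v.output → s.Realizes y) := by
  have hcount := (r.fires i v hv).count (.tok p s)
  have hin := (r.fires i v hv).1 (.tok p s)
  have hph := r.phase_succ_some hv
  rw [← hw.1] at hcount hin
  cases s with
  | exact k =>
    obtain ⟨x, y, z, h1, h2, h3, h4, h5⟩ := exists_replace (Q := fun x => x = (k : ℕ)) hw.2 rfl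
      hin hcount
    exact ⟨x, y, z, h1, ⟨h2, h3⟩, h4, h5⟩
  | plus k =>
    have h1 := hg.top
    have h2 := hg.nonneg (2 * r.phase i : ℕ)
    obtain ⟨x, y, z, h1, h2, h3, h4, h5⟩ := exists_replace
      (Q := fun x => ((k : ℕ) : ℝ≥0) < x ∧ ((k : ℕ) < N.maxConst →
        (x : ℝ) + g ⊤ < (k : ℕ) + 1 + g (2 * r.phase i : ℕ))) hw.2
      -- A new plus token takes half of the margin 1 - g ⊤, so that even the whole duration g ⊤
      -- would not bring it to k + 1.
      (y₀ := (k : ℕ) + ((1 - g ⊤) / 2).toNNReal) (by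
        have h3 : 0 < (1 - g ⊤) / 2 := by linarith
        refine ⟨by simpa using hg.top, fun _ => ?_⟩
        rw [NNReal.coe_add, NNReal.coe_natCast, Real.coe_toNNReal _ h3.le]
        linarith) hin hcount
    have hQ : ∀ x : ℝ≥0, (((k : ℕ) : ℝ≥0) < x ∧ ((k : ℕ) < N.maxConst →
        (x : ℝ) + g ⊤ < (k : ℕ) + 1 + g (2 * r.phase i : ℕ))) → (Sym.plus k).Realizes x := by
      rintro x ⟨h1, h2⟩
      refine ⟨h1, fun hk => ?_⟩
      have h3 := hg.strictMono.monotone (le_top (a := ((2 * r.phase i : ℕ) : ℕ∞)))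
      have h4 := h2 hk
      rw [← NNReal.coe_lt_coe, NNReal.coe_add, NNReal.coe_natCast, NNReal.coe_one]
      linarith
    refine ⟨x, y, z, h1, ⟨h2, ?_⟩, fun h => hQ _ (h4 h), fun h => hQ _ (h5 h)⟩
    intro x hx
    rw [hph]
    exact h3 x hx
  | minus k =>
    obtain ⟨a, b, z, ha, hb, -, h1, h2⟩ := hw.minus_fires hv
    exact ⟨_, _, z, h1, h2, fun _ => realizes_age hg hi ha, fun _ => realizes_age hg hi hb⟩

variable (r) in
/-- One transition of the run corresponds to one transition of the timed net. -/
def Follows (g : ℕ∞ → ℝ) (i : ℕ) (M M' : Marking P) : Prop :=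
  ∃ l, Step N l M M' ∧
    l.delay ≤ (g (2 * r.phase (i + 1) : ℕ) - g (2 * r.phase i : ℕ)).toNNReal ∧
    ∀ v, r.u i = some v → v.IsFire → ∃ t, l = .disc t

/-- The marking `C` holds tokens that the run ignores: it allows for markings larger than the one
described by the region. A discrete transition leaves it alone. -/
theorem follows_fire (hg : IsSchedule g) {i : ℕ} {t A B hA hB}
    (hv : r.u i = some (.fire t A B hA hB)) {W : P → Sym N.maxConst → Multiset ℝ≥0}
    (hW : ∀ p s, r.PlaceInv g i p s (W p s)) :
    ∃ W', (∀ p s, r.PlaceInv g (i + 1) p s (W' p s)) ∧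
      ∀ C, ∃ C', r.Follows g i (flatten W + C) (flatten W' + C') := by
  classical
  have hd : r.σ i .disc = 1 := by
    have h1 := r.mode i
    have h2 := (r.fires i _ hv).1 .disc (by simp [TPN.toSDTN, Trans.input])
    omega
  choose X Y Z hX hY hX' hY' using fun p s => (hW p s).fires hg hv hd
  have hA' := hA
  have hB' := hB
  obtain ⟨a, ha, rfl⟩ := hA
  obtain ⟨b, hb, rfl⟩ := hB
  have hin : ∀ p s, (Place.tok p s ∈ (Trans.fire (N := N) t _ _ hA' hB').input) ↔
      (N.arcIn t p).isSome = true ∧ s = a p := by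
    intro p s
    simp only [Trans.input, Set.mem_union, Set.mem_ofPred_eq, Set.mem_singleton_iff, reduceCtorEq,
      or_false, Place.tok.injEq]
    exact ⟨by rintro ⟨q, h1, rfl, rfl⟩; exact ⟨h1, rfl⟩, fun h => ⟨p, h.1, rfl, h.2⟩⟩
  have hout : ∀ p s, (Place.tok p s ∈ (Trans.fire (N := N) t _ _ hA' hB').output) ↔
      (N.arcOut t p).isSome = true ∧ s = b p := by
    intro p s
    simp only [Trans.output, Set.mem_union, Set.mem_ofPred_eq, Set.mem_singleton_iff, reduceCtorEq,
      or_false, Place.tok.injEq, Set.mem_insert_iff]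
    exact ⟨by rintro ⟨q, h1, rfl, rfl⟩; exact ⟨h1, rfl⟩, fun h => ⟨p, h.1, rfl, h.2⟩⟩
  simp only [hin, hout] at hX hY hX' hY'
  refine ⟨_, hY, fun C => ⟨C, .disc t, ⟨fun p => X p (a p), fun p => Y p (b p), flatten Z + C, ?_,
    ?_, ?_, ?_⟩, zero_le, fun _ _ _ => ⟨t, rfl⟩⟩⟩
  · intro p I hI
    exact ((hX' p (a p) ⟨by simp [hI], rfl⟩).mem_enc_iff (N.maxConst_arcIn_le hI)).1 (ha p I hI)
  · intro p I hI
    exact ((hY' p (b p) ⟨by simp [hI], rfl⟩).mem_enc_iff (N.maxConst_arcOut_le hI)).1 (hb p I hI)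
  · rw [← flatten_arcs, add_right_comm, ← flatten_add]
    congr 2
    funext p s
    rw [hX p s, add_comm]
  · rw [flatten_add, flatten_arcs]
    abel

/-- A waiting token gets a new symbol when its fate has come. -/
theorem follows_relabel {i : ℕ} {v : Trans N N.maxConst}
    (hv : r.u i = some v) (hnf : ¬ v.IsFire) {p₀ : P} {k₀ : Fin N.maxConst} {s₀ : Sym N.maxConst}
    (hs₀ : ∀ k, s₀ ≠ .minus k)
    (hin : ∀ p s, .tok p s ∈ v.input ↔ p = p₀ ∧ s = .minus k₀)
    (hout : ∀ p s, .tok p s ∈ v.output ↔ p = p₀ ∧ s = s₀)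
    (hnew : ∀ w, (r.PlaceInv g i p₀ s₀ w) →
      r.PlaceInv g (i + 1) p₀ s₀ (r.age g p₀ k₀ i (r.lo p₀ k₀ i) ::ₘ w))
    {W : P → Sym N.maxConst → Multiset ℝ≥0} (hW : ∀ p s, r.PlaceInv g i p s (W p s)) :
    ∃ W', (∀ p s, r.PlaceInv g (i + 1) p s (W' p s)) ∧
      ∀ C, ∃ C', r.Follows g i (flatten W + C) (flatten W' + C') := by
  classical
  let x := r.age g p₀ k₀ i (r.lo p₀ k₀ i)
  have hph := r.phase_succ_some hv
  have h1 : ∀ p s, ∃ z, W p s = (if p = p₀ ∧ s = .minus k₀ then {x} else 0) + z ∧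
      r.PlaceInv g (i + 1) p s ((if p = p₀ ∧ s = s₀ then {x} else 0) + z) := by
    intro p s
    by_cases h : p = p₀ ∧ s = s₀
    · obtain ⟨rfl, rfl⟩ := h
      refine ⟨W p s, by simp [hs₀ k₀], ?_⟩
      rw [if_pos ⟨rfl, rfl⟩, Multiset.singleton_add]
      exact hnew _ (hW p s)
    · cases s with
      | minus k =>
        obtain ⟨a, b, z, -, -, hlo, h2, h3⟩ := (hW p (.minus k)).minus_fires hv
        simp only [hin, hout, if_neg h] at hlo h2 h3
        refine ⟨z, ?_, by rwa [if_neg h]⟩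
        rw [h2]
        split_ifs with h4
        · obtain ⟨rfl, h4⟩ := h4
          obtain rfl : k = k₀ := by simpa using h4
          rw [hlo h]
        · rfl
      | exact k =>
        refine ⟨W p (.exact k), by simp, ?_⟩
        have hc := (r.fires i v hv).count (.tok p (.exact k))
        rw [if_neg h, zero_add]
        have := hW p (.exact k)
        simp only [TPN.toSDTN, hin, hout, reduceCtorEq, and_false, false_and] at hc
        exact ⟨by rw [this.1]; simpa [h] using hc.symm, this.2⟩
      | plus k =>
        refine ⟨W p (.plus k), by simp, ?_⟩
        have hc := (r.fires i v hv).count (.tok p (.plus k))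
        rw [if_neg h, zero_add]
        have := hW p (.plus k)
        simp only [TPN.toSDTN, hin, hout, reduceCtorEq, and_false, false_and] at hc
        refine ⟨by rw [this.1]; simpa [h] using hc.symm, ?_⟩
        simpa only [hph] using this.2
  choose Z hZ hZ' using h1
  have hfl : ∀ s : Sym N.maxConst, flatten (fun p s' => if p = p₀ ∧ s' = s then {x} else 0) =
      ({(p₀, x)} : Marking P) := by
    intro s
    rw [flatten, Finset.sum_eq_single p₀, Finset.sum_eq_single s] <;> simp +contextual
  refine ⟨_, hZ', fun C => ⟨C, .time 0, ?_, zero_le, fun v' hv' hf => ?_⟩⟩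
  · rw [flatten_add, hfl, show flatten W = {(p₀, x)} + flatten Z by
      rw [← hfl (.minus k₀), ← flatten_add]
      congr 1
      funext p s
      exact hZ p s]
    exact step_zero _
  · obtain rfl : v = v' := by simpa using hv.symm.trans hv'
    exact absurd hf hnf

/-- The oldest waiting token has fate 2n in phase n, so its age is exactly k + 1; no time passes and
only its symbol changes. -/
theorem follows_reach (hg : IsSchedule g) {i : ℕ} {p₀ : P} {k₀ : Fin N.maxConst}
    (hv : r.u i = some (.reach p₀ k₀)) {W : P → Sym N.maxConst → Multiset ℝ≥0}
    (hW : ∀ p s, r.PlaceInv g i p s (W p s)) :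
    ∃ W', (∀ p s, r.PlaceInv g (i + 1) p s (W' p s)) ∧
      ∀ C, ∃ C', r.Follows g i (flatten W + C) (flatten W' + C') := by
  refine follows_relabel hv (by rintro ⟨t, A, B, hA, hB, h⟩; cases h) (p₀ := p₀) (k₀ := k₀)
    (s₀ := .exact k₀.succ) (by simp) (by simp [Trans.input]) (by simp [Trans.output]) ?_ hW
  intro w hw
  have hrem : r.Removes p₀ k₀ i := ⟨_, hv, by simp [Trans.input], by simp [Trans.output]⟩
  have hc := (r.fires i _ hv).count (.tok p₀ (.exact k₀.succ))
  simp [TPN.toSDTN, Trans.input, Trans.output] at hc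
  refine ⟨by rw [Multiset.card_cons, hw.1, hc], ?_⟩
  intro x hx
  rcases Multiset.mem_cons.1 hx with rfl | hx
  · rw [← NNReal.coe_inj, coe_age hg, fate_lo hrem, hv]
    simp [fateOf]
  · exact hw.2 x hx

/-- The oldest waiting token has fate 2n - 1 in phase n and passed k + 1 shortly before the end of
the phase, at g(2n - 1) < g(2n). It will not reach k + 2 because g ⊤ < 1. -/
theorem follows_exceed (hg : IsSchedule g) {i : ℕ} {p₀ : P} {k₀ : Fin N.maxConst}
    (hv : r.u i = some (.exceed p₀ k₀)) {W : P → Sym N.maxConst → Multiset ℝ≥0}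
    (hW : ∀ p s, r.PlaceInv g i p s (W p s)) :
    ∃ W', (∀ p s, r.PlaceInv g (i + 1) p s (W' p s)) ∧
      ∀ C, ∃ C', r.Follows g i (flatten W + C) (flatten W' + C') := by
  refine follows_relabel hv (by rintro ⟨t, A, B, hA, hB, h⟩; cases h) (p₀ := p₀) (k₀ := k₀)
    (s₀ := .plus k₀.succ) (by simp) (by simp [Trans.input]) (by simp [Trans.output]) ?_ hW
  intro w hw
  have hrem : r.Removes p₀ k₀ i := ⟨_, hv, by simp [Trans.input], by simp [Trans.output]⟩
  have hc := (r.fires i _ hv).count (.tok p₀ (.plus k₀.succ))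
  simp [TPN.toSDTN, Trans.input, Trans.output] at hc
  have hph := r.phase_succ_some hv
  -- The phase is at least 1, so the truncated difference 2n - 1 is genuinely smaller than 2n.
  have hpos := r.phase_lt_of_le (i := 0) (j := i) r.standard.1 (Nat.zero_le _)
    ((r.fires i _ hv).1 .time2 (by simp [TPN.toSDTN, Trans.input]))
  have hf : r.fate p₀ k₀ (r.lo p₀ k₀ i) = (2 * r.phase i - 1 : ℕ) := by
    rw [fate_lo hrem, hv]; rfl
  have h1 : g (2 * r.phase i - 1 : ℕ) < g (2 * r.phase i : ℕ) :=
    hg.strictMono (by exact_mod_cast (by omega : 2 * r.phase i - 1 < 2 * r.phase i))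
  have h2 := hg.nonneg (2 * r.phase i - 1 : ℕ)
  have h3 := hg.top
  refine ⟨by rw [Multiset.card_cons, hw.1, hc], ?_⟩
  intro x hx
  rcases Multiset.mem_cons.1 hx with rfl | hx
  · constructor
    · rw [← NNReal.coe_lt_coe, coe_age hg, hf, NNReal.coe_natCast, Fin.val_succ]
      push_cast at *
      linarith
    · intro _
      rw [coe_age hg, hf, hph, Fin.val_succ]
      push_cast at *
      linarith
  · rw [hph]; exact hw.2 x hx

theorem follows_switch {i : ℕ} {v : Trans N N.maxConst} (hv : r.u i = some v) (hnf : ¬ v.IsFire)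
    (hin : ∀ p s, .tok p s ∉ v.input) (hout : ∀ p s, .tok p s ∉ v.output)
    {W : P → Sym N.maxConst → Multiset ℝ≥0} (hW : ∀ p s, r.PlaceInv g i p s (W p s)) :
    ∃ W', (∀ p s, r.PlaceInv g (i + 1) p s (W' p s)) ∧
      ∀ C, ∃ C', r.Follows g i (flatten W + C) (flatten W' + C') := by
  classical
  have hph := r.phase_succ_some hv
  refine ⟨W, fun p s => ?_, fun C => ⟨C, .time 0, step_zero _, zero_le, fun v' hv' hf => ?_⟩⟩
  · have hc := (r.fires i v hv).count (.tok p s)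
    simp [TPN.toSDTN, hin, hout] at hc
    refine ⟨by rw [hc]; exact (hW p s).1, ?_⟩
    cases s with
    | exact k => exact (hW p (.exact k)).2
    | plus k => simpa only [hph] using (hW p (.plus k)).2
    | minus k =>
      have h1 : ¬ r.Removes p k i := by simp [Removes, hv, hin]
      have h2 : ¬ r.Adds p k i := by simp [Adds, hv, hout]
      show W p (.minus k) =
        (Finset.Ico (r.lo p k (i + 1)) (r.hi p k (i + 1))).val.map (r.age g p k (i + 1))
      rw [lo_succ_of_not_removes h1, hi_succ_of_not_adds h2, age_congr hph]
      exact (hW p (.minus k)).2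
  · obtain rfl : v = v' := by simpa using hv.symm.trans hv'
    exact absurd hf hnf

/-- All the time of a phase passes at the transfer. Minus tokens may thereby get beyond their
integer; the relabelling transitions that follow take no time. -/
theorem follows_transfer (hg : IsSchedule g) {i : ℕ} (hv : r.u i = none)
    {W : P → Sym N.maxConst → Multiset ℝ≥0} (hW : ∀ p s, r.PlaceInv g i p s (W p s)) :
    ∃ W', (∀ p s, r.PlaceInv g (i + 1) p s (W' p s)) ∧
      ∀ C, ∃ C', r.Follows g i (flatten W + C) (flatten W' + C') := by
  have hph := r.phase_succ_none hv
  obtain ⟨-, -, -, -, hE, hP, hM⟩ := firesTrans_iff (r.trans i hv)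
  have hlt : g (2 * r.phase i : ℕ) < g (2 * r.phase (i + 1) : ℕ) := by
    apply hg.strictMono
    rw [hph]
    exact_mod_cast (by omega : 2 * r.phase i < 2 * (r.phase i + 1))
  set d : ℝ := g (2 * r.phase (i + 1) : ℕ) - g (2 * r.phase i : ℕ) with hd
  have hd0 : 0 < d := sub_pos.2 hlt
  have hdc : (d.toNNReal : ℝ) = d := Real.coe_toNNReal _ hd0.le
  have htop := hg.top
  have hnn := hg.nonneg (2 * r.phase i : ℕ)
  let W' : P → Sym N.maxConst → Multiset ℝ≥0 := fun p s => match s with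
    | .exact k => 0
    | .plus k => (W p (.plus k)).map (· + d.toNNReal) + (W p (.exact k)).map (· + d.toNNReal)
    | .minus k => (W p (.minus k)).map (· + d.toNNReal)
  refine ⟨W', fun p s => ?_, fun C => ⟨C.map fun τ => (τ.1, τ.2 + d.toNNReal), .time d.toNNReal, ?_,
    le_rfl, fun v' hv' => by simp [hv] at hv'⟩⟩
  · cases s with
    | exact k => exact ⟨by simp [W', hE], by simp [W']⟩
    | plus k =>
      refine ⟨by simp [W', hP, (hW p (.plus k)).1, (hW p (.exact k)).1], ?_⟩
      intro x hx
      rcases Multiset.mem_add.1 hx with hx | hx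
      · obtain ⟨y, hy, rfl⟩ := Multiset.mem_map.1 hx
        obtain ⟨h1, h2⟩ := (hW p (.plus k)).2 y hy
        refine ⟨h1.trans_le (by simp), fun hk => ?_⟩
        have := h2 hk
        rw [NNReal.coe_add, hdc]
        linarith
      · obtain ⟨y, hy, rfl⟩ := Multiset.mem_map.1 hx
        obtain rfl := (hW p (.exact k)).2 y hy
        refine ⟨lt_add_of_pos_right _ (Real.toNNReal_pos.2 hd0), fun hk => ?_⟩
        rw [NNReal.coe_add, hdc, NNReal.coe_natCast]
        linarith
    | minus k =>
      rw [PlaceInv.minus_iff]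
      have h1 : ¬ r.Removes p k i := by simp [Removes, hv]
      have h2 : ¬ r.Adds p k i := by simp [Adds, hv]
      rw [lo_succ_of_not_removes h1, hi_succ_of_not_adds h2]
      show (W p (.minus k)).map (· + d.toNNReal) = _
      rw [PlaceInv.minus_iff.1 (hW p (.minus k)), Multiset.map_map]
      refine Multiset.map_congr rfl fun a _ => ?_
      rw [Function.comp_apply, ← NNReal.coe_inj, NNReal.coe_add, hdc, coe_age hg, coe_age hg]
      linarith
  · show _ = _
    rw [Multiset.map_add, map_flatten W fun x => x + d.toNNReal]
    congr 1
    rw [flatten, flatten]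
    refine Finset.sum_congr rfl fun p _ => ?_
    simp only [Sym.sum_eq, W', Multiset.map_add, Finset.sum_add_distrib, Multiset.map_zero,
      Finset.sum_const_zero, zero_add]
    rw [add_comm (∑ k, _) (∑ k, _)]

theorem exists_follows (hg : IsSchedule g) {i : ℕ} {W : P → Sym N.maxConst → Multiset ℝ≥0}
    (hW : ∀ p s, r.PlaceInv g i p s (W p s)) :
    ∃ W', (∀ p s, r.PlaceInv g (i + 1) p s (W' p s)) ∧
      ∀ C, ∃ C', r.Follows g i (flatten W + C) (flatten W' + C') := by
  cases hu : r.u i with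
  | none => exact follows_transfer hg hu hW
  | some v =>
    cases v with
    | fire t A B hA hB => exact follows_fire hg hu hW
    | switchTime =>
      exact follows_switch hu (by rintro ⟨t, A, B, hA, hB, h⟩; cases h) (by simp [Trans.input])
        (by simp [Trans.output]) hW
    | switchDisc =>
      exact follows_switch hu (by rintro ⟨t, A, B, hA, hB, h⟩; cases h) (by simp [Trans.input])
        (by simp [Trans.output]) hW
    | reach p k => exact follows_reach hg hu hW
    | exceed p k => exact follows_exceed hg hu hW

/-- Iteration of the simulation. Transitions of the run that are neither transfers nor discrete
become delays 0, and `fire_often` supplies infinitely many discrete transitions. -/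
theorem mem_ZENO (hg : IsSchedule g) {W : P → Sym N.maxConst → Multiset ℝ≥0}
    (hW : ∀ p s, r.PlaceInv g 0 p s (W p s)) (C : Marking P) : flatten W + C ∈ ZENO N := by
  have hstep : ∀ i M, (∃ W C, (∀ p s, r.PlaceInv g i p s (W p s)) ∧ M = flatten W + C) →
      ∃ M', (∃ W C, (∀ p s, r.PlaceInv g (i + 1) p s (W p s)) ∧ M' = flatten W + C) ∧
        r.Follows g i M M' := by
    rintro i M ⟨W, C, hW, rfl⟩
    obtain ⟨W', hW', h⟩ := exists_follows hg hW
    obtain ⟨C', hC'⟩ := h C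
    exact ⟨_, ⟨W', C', hW', rfl⟩, hC'⟩
  choose! next hnext hfol using hstep
  let M : ℕ → Marking P := fun n => n.rec (flatten W + C) next
  have hM : ∀ i, ∃ W C, (∀ p s, r.PlaceInv g i p s (W p s)) ∧ M i = flatten W + C := by
    intro i
    induction i with
    | zero => exact ⟨W, C, hW, rfl⟩
    | succ i ih => exact hnext i _ ih
  choose l hl hdelay hdisc using fun i => hfol i (M i) (hM i)
  refine Set.mem_iUnion.2 ⟨1, ⟨M, l, hl, fun n => ?_⟩, rfl, ?_⟩
  · obtain ⟨i, hi, v, hv, hf⟩ := r.fire_often n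
    exact ⟨i, hi, hdisc i v hv hf⟩
  · have hmono : ∀ i, g (2 * r.phase i : ℕ) ≤ g (2 * r.phase (i + 1) : ℕ) := by
      intro i
      apply hg.strictMono.monotone
      have : r.phase i ≤ r.phase (i + 1) := by
        cases hu : r.u i with
        | none => rw [r.phase_succ_none hu]; omega
        | some v => rw [r.phase_succ_some hu]
      exact_mod_cast (by omega : 2 * r.phase i ≤ 2 * r.phase (i + 1))
    rw [InfComputation.totalDelay, ENNReal.tsum_eq_iSup_nat]
    refine iSup_le fun n => ?_
    rw [← ENNReal.ofNNReal_finsetSum, ENNReal.coe_le_coe]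
    -- The delays telescope, as phase n ends at time g(2n).
    have h1 : ∑ i ∈ Finset.range n, (l i).delay ≤ (g (2 * r.phase n : ℕ)).toNNReal := by
      induction n with
      | zero => simp
      | succ n ih =>
        rw [Finset.sum_range_succ]
        refine (add_le_add ih (hdelay n)).trans ?_
        rw [← Real.toNNReal_add (hg.nonneg _) (sub_nonneg.2 (hmono n)), add_sub_cancel]
    refine h1.trans ?_
    rw [Real.toNNReal_le_one]
    exact (hg.lt_one _).le

end Run

end Net

/-! ## Words and markings of the associated net -/

section Counting

theorem sum_count_eq {α : Type*} [DecidableEq α] (l : List (Multiset α)) (a : α) :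
    (l.map fun b => b.count a).sum = l.sum.count a := by
  rw [← Multiset.coe_countAddMonoidHom, map_list_sum]

theorem count_sum_smul_singleton {α : Type*} [Fintype α] [DecidableEq α] (f : α → ℕ) (a : α) :
    (∑ q, f q • ({q} : Multiset α)).count a = f a := by
  rw [Multiset.count_sum', Finset.sum_eq_single a] <;> simp +contextual [Multiset.count_singleton]
  intro b hb hb'
  exact absurd hb'.symm hb

theorem sum_filter_eq {α κ : Type*} [Fintype κ] [DecidableEq κ] (A : Multiset α) (f : α → κ) :
    ∑ k, A.filter (fun a => f a = k) = A := by
  classical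
  ext a
  simp [Multiset.count_sum', Multiset.count_filter]

theorem map_fst_sum_groups {β κ : Type*} (L : List (κ × Multiset β)) :
    (L.map fun e : κ × Multiset β => e.2.map fun b => (b, e.1)).sum.map Prod.fst =
      (L.map Prod.snd).sum := by
  induction L with
  | nil => rfl
  | cons e L ih => simp [ih, Multiset.map_map]

theorem mem_sum_groups {β κ : Type*} {L : List (κ × Multiset β)} {a : β × κ} :
    a ∈ (L.map fun e : κ × Multiset β => e.2.map fun b => (b, e.1)).sum ↔
      ∃ e ∈ L, e.1 = a.2 ∧ a.1 ∈ e.2 := by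
  induction L with
  | nil => simp
  | cons e L ih =>
    rw [List.map_cons, List.sum_cons, Multiset.mem_add, ih]
    simp only [List.mem_cons, exists_eq_or_imp, Multiset.mem_map]
    refine or_congr ⟨?_, ?_⟩ Iff.rfl
    · rintro ⟨b, hb, rfl⟩; exact ⟨rfl, hb⟩
    · rintro ⟨h, hb⟩; exact ⟨_, hb, Prod.ext rfl h⟩

theorem groupTokens_map {P κ : Type*} {m : ℕ} (h : κ → ℝ≥0)
    (L : List (κ × Multiset (P × Fin m))) :
    groupTokens (L.map fun e => (h e.1, e.2)) =
      (L.map fun e : κ × Multiset (P × Fin m) => e.2.map fun b => (b, e.1)).sum.map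
        fun a : (P × Fin m) × κ => (a.1.1, ((a.1.2 : ℕ) : ℝ≥0) + h a.2) := by
  induction L with
  | nil => simp
  | cons e L ih => simp [ih, Multiset.map_map]

theorem exists_sorted_groups_gt {β κ : Type*} [LinearOrder κ] (A : Multiset (β × κ)) :
    ∃ L : List (κ × Multiset β), L.Pairwise (fun a b => a.1 > b.1) ∧ (∀ e ∈ L, e.2 ≠ 0) ∧
      (L.map fun e => e.2.map fun b => (b, e.1)).sum = A := by
  obtain ⟨L, h1, h2, h3⟩ := exists_sorted_groups A
  refine ⟨L.reverse, List.pairwise_reverse.2 h1, by simpa using h2, ?_⟩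
  rw [List.map_reverse, List.sum_reverse, h3]

variable {P : Type*} [DecidableEq P] {m : ℕ}

theorem mem_permMinus_iff {M : Place P m → ℕ} {w : Word P m} :
    w ∈ permMinus M ↔ ∀ q : P × Fin m, w.1.sum.count q = M (.tok q.1 (.minus q.2)) := by
  simp only [permMinus, Set.mem_ofPred_eq, sum_count_eq, Prod.forall]
  exact forall₂_congr fun p k => eq_comm

theorem mem_permPlus_iff {M : Place P m → ℕ} {w : Word P m} :
    w ∈ permPlus M ↔ ∀ q : P × Fin m, w.1.sum.count q = M (.tok q.1 (.plus q.2.castSucc)) := by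
  simp only [permPlus, Set.mem_ofPred_eq, sum_count_eq, Prod.forall]
  exact forall₂_congr fun p k => eq_comm

end Counting

/-! ## Schedules -/

open Run in
/-- Fates in decreasing order can be scheduled so that they come when given fractional parts reach
`1`, and before other, smaller, fractional parts reach `1`. -/
theorem exists_isSchedule {K : List ℕ∞} {fs fp : List ℝ≥0} (hlen : K.length = fs.length)
    (hK : K.Pairwise (· > ·)) (hK0 : ∀ v ∈ K, 0 < v) (hfs : fs.Pairwise (· < ·))
    (hfs' : ∀ f ∈ fs, 0 < f ∧ f < 1) (hfp : ∀ f ∈ fp, f < 1) (hlt : ∀ a ∈ fp, ∀ b ∈ fs, a < b) :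
    ∃ g, IsSchedule g ∧ K.map (fun v => 1 - g v) = fs.map (fun f : ℝ≥0 => (f : ℝ)) ∧
      ∀ f ∈ fp, (f : ℝ) + g ⊤ < 1 := by
  classical
  -- c separates the fractional parts of plus tokens from those of minus tokens; g ⊤ ≤ 1 - c then
  -- keeps the former below 1. The added 0 and 1 give 0 < c < 1.
  obtain ⟨c, hc1, hc2⟩ := Order.exists_between_finsets
    (lo := (insert 0 fp.toFinset).image fun f : ℝ≥0 => (f : ℝ))
    (hi := (insert 1 fs.toFinset).image fun f : ℝ≥0 => (f : ℝ)) (by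
      intro x hx y hy
      obtain ⟨a, ha, rfl⟩ := Finset.mem_image.1 hx
      obtain ⟨b, hb, rfl⟩ := Finset.mem_image.1 hy
      rw [NNReal.coe_lt_coe]
      simp only [Finset.mem_insert, List.mem_toFinset] at ha hb
      rcases ha with rfl | ha <;> rcases hb with rfl | hb
      exacts [one_pos, (hfs' b hb).1, hfp a ha, hlt a ha b hb])
  simp only [Finset.mem_image, Finset.mem_insert, List.mem_toFinset, forall_exists_index, and_imp,
    forall_eq_or_imp, NNReal.coe_zero, NNReal.coe_one] at hc1 hc2
  have hc0 : 0 < c := (hc1 0).1 rfl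
  have hcp : ∀ f ∈ fp, (f : ℝ) < c := fun f hf => (hc1 f).2 f hf rfl
  have hcs : ∀ f ∈ fs, c < (f : ℝ) := fun f hf => (hc2 f).2 f hf rfl
  replace hc1 : c < 1 := (hc2 1).1 rfl
  -- If ⊤ is not among the given fates, its value is prescribed as 1 - c; otherwise it already has a
  -- smaller one.
  let e₁ : List ℕ∞ := if ⊤ ∈ K then [] else [⊤]
  let e₂ : List ℝ := if ⊤ ∈ K then [] else [1 - c]
  have he : e₁.length = e₂.length := by by_cases h : ⊤ ∈ K <;> simp [e₁, e₂, h]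
  have he₁ : ∀ v ∈ e₁, v = ⊤ ∧ ⊤ ∉ K := by
    intro v hv; by_cases h : ⊤ ∈ K <;> simp [e₁, h] at hv; exact ⟨hv, h⟩
  have he₂ : ∀ v ∈ e₂, v = 1 - c := by
    intro v hv; by_cases h : ⊤ ∈ K <;> simp [e₂, h] at hv; exact hv
  have hp₁ : e₁.Pairwise (· < ·) := by by_cases h : ⊤ ∈ K <;> simp [e₁, h]
  have hp₂ : e₂.Pairwise (· < ·) := by by_cases h : ⊤ ∈ K <;> simp [e₂, h]
  -- Fates are listed decreasingly and fractional parts increasingly; after reversal both v and 1 -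
  -- f increase, starting from the prescribed value 0 at 0.
  let l₁ : List ℕ∞ := 0 :: (K.reverse ++ e₁)
  let l₂ : List ℝ := 0 :: ((fs.map fun f : ℝ≥0 => 1 - (f : ℝ)).reverse ++ e₂)
  have hl₂ : ∀ x ∈ l₂, x ≤ 1 - c := by
    intro x hx
    simp only [l₂, List.mem_cons, List.mem_append, List.mem_reverse, List.mem_map] at hx
    rcases hx with rfl | ⟨f, hf, rfl⟩ | hx
    · linarith
    · have := hcs f hf; linarith
    · exact (he₂ x hx).le
  obtain ⟨h, hh, hmono⟩ := exists_strictMonoOn_map_eq l₁ l₂ (by simp [l₁, l₂, hlen, he])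
    (by
      simp only [l₁, List.pairwise_cons, List.pairwise_append, List.mem_append, List.mem_reverse,
        List.pairwise_reverse]
      refine ⟨?_, hK, hp₁, ?_⟩
      · rintro v (hv | hv)
        · exact hK0 v hv
        · rw [(he₁ v hv).1]; exact ENat.top_pos
      · intro a ha b hb
        obtain ⟨rfl, hb'⟩ := he₁ b hb
        exact lt_top_iff_ne_top.2 fun h => hb' (h ▸ ha))
    (by
      simp only [l₂, List.pairwise_cons, List.pairwise_append, List.mem_append, List.mem_reverse,
        List.pairwise_reverse, List.pairwise_map, List.mem_map]
      refine ⟨?_, hfs.imp fun {a b} hab => ?_, hp₂, ?_⟩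
      · rintro v (⟨f, hf, rfl⟩ | hv)
        · exact sub_pos.2 (hfs' f hf).2
        · rw [he₂ v hv]; linarith
      · exact sub_lt_sub_left (NNReal.coe_lt_coe.2 hab) _
      · rintro _ ⟨f, hf, rfl⟩ b hb
        rw [he₂ b hb]
        have := hcs f hf
        linarith)
  -- A bounded strictly increasing function on ℕ∞: -1/(n+1) at n and 0 at ⊤.
  have hφ : StrictMono fun v : ℕ∞ => if v = ⊤ then (0 : ℝ) else -(1 / ((v.toNat : ℝ) + 1)) := by
    intro a b hab
    have ha : a ≠ ⊤ := hab.ne_top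
    lift a to ℕ using ha
    by_cases hb : b = ⊤
    · subst hb
      simp only [ENat.natCast_ne_top, if_false, if_true, ENat.toNat_natCast]
      have : (0 : ℝ) < 1 / ((a : ℝ) + 1) := by positivity
      linarith
    · lift b to ℕ using hb
      simp only [ENat.natCast_ne_top, if_false, ENat.toNat_natCast]
      have : (a : ℝ) < b := by exact_mod_cast hab
      exact neg_lt_neg (one_div_lt_one_div_of_lt (by positivity) (by linarith))
  have hφ' : ∀ v : ℕ∞, -1 ≤ (if v = ⊤ then (0 : ℝ) else -(1 / ((v.toNat : ℝ) + 1))) ∧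
      (if v = ⊤ then (0 : ℝ) else -(1 / ((v.toNat : ℝ) + 1))) ≤ 0 := by
    intro v
    split_ifs
    · norm_num
    · have h1 : (0 : ℝ) ≤ v.toNat := Nat.cast_nonneg _
      have h2 : (1 : ℝ) / ((v.toNat : ℝ) + 1) ≤ 1 := by rw [div_le_one] <;> linarith
      have h3 : (0 : ℝ) ≤ 1 / ((v.toNat : ℝ) + 1) := by positivity
      constructor <;> linarith
  obtain ⟨g, hg, hgV⟩ := exists_strictMono_extension _ hφ
    (fun a b => by have := hφ' a; have := hφ' b; linarith) l₁.toFinset (by simp [l₁]) h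
    (fun x hx y hy hxy => hmono (List.mem_toFinset.1 hx) (List.mem_toFinset.1 hy) hxy)
  have htop : ⊤ ∈ l₁ := by
    by_cases h : ⊤ ∈ K <;> simp [l₁, e₁, h]
  have hgt : g ⊤ ≤ 1 - c := by
    rw [hgV _ (List.mem_toFinset.2 htop)]
    exact hl₂ _ (hh ▸ List.mem_map_of_mem htop)
  simp only [l₁, l₂, List.map_cons, List.map_append, List.cons.injEq] at hh
  obtain ⟨h0, hh⟩ := hh
  have hKr := (List.append_inj hh (by simp [hlen])).1
  rw [List.map_reverse, List.reverse_inj] at hKr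
  refine ⟨g, ⟨hg, by rw [hgV 0 (by simp [l₁]), h0], by linarith⟩, ?_, fun f hf => ?_⟩
  · have h1 := congrArg (List.map fun x : ℝ => 1 - x) hKr
    simp only [List.map_map, Function.comp_def, sub_sub_cancel] at h1
    rw [← h1]
    refine List.map_congr_left fun v hv => ?_
    rw [hgV v (by simp [l₁, hv])]
  · have := hcp f hf
    linarith

theorem preStar_mono {P T : Type*} [Fintype P] {N : TPN P T} {S S' : Set (Marking P)} (h : S ⊆ S') : preStar N S ⊆ preStar N S' :=
  fun _ ⟨M', hM', hr⟩ => ⟨M', h hM', hr⟩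

section Net

variable {P T : Type*} [Fintype P] [DecidableEq P] [Fintype T] {N : TPN P T}

namespace Run

variable (r : Run N)

/-- The tokens on the places `p((k+1)-)` at the start of the run with their fates. -/
noncomputable def fates : Multiset ((P × Fin N.maxConst) × ℕ∞) :=
  ∑ q : P × Fin N.maxConst,
    (Finset.Ico (r.lo q.1 q.2 0) (r.hi q.1 q.2 0)).val.map fun a => (q, r.fate q.1 q.2 a)

theorem count_fates (q : P × Fin N.maxConst) :
    (r.fates.map Prod.fst).count q = r.σ 0 (.tok q.1 (.minus q.2)) := by
  simp only [fates, ← Multiset.coe_mapAddMonoidHom, map_sum]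
  simp only [Multiset.coe_mapAddMonoidHom, Multiset.map_map, Function.comp_def]
  have h : ∀ q : P × Fin N.maxConst, (Finset.Ico (r.lo q.1 q.2 0) (r.hi q.1 q.2 0)).val.map
      (fun _ => q) = r.σ 0 (.tok q.1 (.minus q.2)) • {q} := by
    intro q
    rw [Multiset.map_const', Multiset.nsmul_singleton, r.lo_zero, r.hi_zero]
    congr 1
    exact Nat.card_Ico _ _
  simp only [h]
  exact count_sum_smul_singleton (fun q : P × Fin N.maxConst => r.σ 0 (.tok q.1 (.minus q.2))) q

variable {r}

/-- A marking of a region that is arranged according to the fates starts a zeno computation. -/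
theorem mem_ZENO_of_groups {g : ℕ∞ → ℝ} (hg : IsSchedule g)
    {A : Multiset ((P × Fin N.maxConst) × ℝ≥0)} {B : Marking P}
    (hA : ∀ q, (A.map Prod.fst).count q = r.σ 0 (.tok q.1 (.plus q.2.castSucc)))
    (hA' : ∀ a ∈ A, 0 < a.2 ∧ (a.2 : ℝ) + g ⊤ < 1)
    (hB : ∀ p, (B.map Prod.fst).count p = r.σ 0 (.tok p (.plus (Fin.last _))))
    (hB' : ∀ τ ∈ B, (N.maxConst : ℝ≥0) < τ.2) (C : Marking P) :
    (∑ q : P × Fin (N.maxConst + 1), r.σ 0 (.tok q.1 (.exact q.2)) • {(q.1, ((q.2 : ℕ) : ℝ≥0))}) +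
      (A.map fun a => (a.1.1, ((a.1.2 : ℕ) : ℝ≥0) + a.2)) +
      (r.fates.map fun a => (a.1.1, ((a.1.2 : ℕ) : ℝ≥0) + (1 - g a.2).toNNReal)) + B + C ∈
        ZENO N := by
  let W : P → Sym N.maxConst → Multiset ℝ≥0 := fun p s => match s with
    | .exact k => r.σ 0 (.tok p (.exact k)) • {((k : ℕ) : ℝ≥0)}
    | .plus k => if h : (k : ℕ) < N.maxConst then
        (A.filter fun a => a.1 = (p, ⟨k, h⟩)).map fun a => ((a.1.2 : ℕ) : ℝ≥0) + a.2
      else (B.filter fun τ => τ.1 = p).map Prod.snd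
    | .minus k => (Finset.Ico (r.lo p k 0) (r.hi p k 0)).val.map (r.age g p k 0)
  have hW : ∀ p s, r.PlaceInv g 0 p s (W p s) := by
    intro p s
    cases s with
    | minus k => exact PlaceInv.minus_iff.2 rfl
    | exact k =>
      refine ⟨by simp [W], fun x hx => ?_⟩
      exact Multiset.mem_singleton.1 (Multiset.mem_of_mem_nsmul hx)
    | plus k =>
      by_cases h : (k : ℕ) < N.maxConst
      · have hk : k = Fin.castSucc ⟨k, h⟩ := rfl
        simp only [W, dif_pos h]
        refine ⟨?_, fun x hx => ?_⟩
        · rw [Multiset.card_map]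
          have := hA (p, ⟨k, h⟩)
          rw [Multiset.count_map] at this
          refine Eq.trans ?_ this
          simp only [eq_comm]
        · obtain ⟨a, ha, rfl⟩ := Multiset.mem_map.1 hx
          obtain ⟨ha, ha'⟩ := Multiset.mem_filter.1 ha
          obtain ⟨h1, h2⟩ := hA' a ha
          rw [ha']
          refine ⟨lt_add_of_pos_right _ h1, fun _ => ?_⟩
          rw [r.phase_zero, NNReal.coe_add, NNReal.coe_natCast]
          have := hg.zero
          simp only [mul_zero, Nat.cast_zero, this]
          linarith
      · have hk : k = Fin.last _ := by
          apply Fin.ext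
          have := k.2
          simp only [Fin.val_last]
          omega
        simp only [W, dif_neg h]
        refine ⟨?_, fun x hx => ?_⟩
        · rw [Multiset.card_map]
          have := hB p
          rw [Multiset.count_map] at this
          rw [hk, ← this]
          simp only [eq_comm]
        · obtain ⟨τ, hτ, rfl⟩ := Multiset.mem_map.1 hx
          refine ⟨?_, fun h' => absurd h' h⟩
          rw [hk]
          exact hB' τ (Multiset.mem_filter.1 hτ).1
  have hfl : flatten W = (∑ q : P × Fin (N.maxConst + 1),
      r.σ 0 (.tok q.1 (.exact q.2)) • {(q.1, ((q.2 : ℕ) : ℝ≥0))}) +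
      (A.map fun a => (a.1.1, ((a.1.2 : ℕ) : ℝ≥0) + a.2)) +
      (r.fates.map fun a => (a.1.1, ((a.1.2 : ℕ) : ℝ≥0) + (1 - g a.2).toNNReal)) + B := by
    have h1 : ∑ p, ∑ k, (W p (.exact k)).map (fun x => (p, x)) =
        ∑ q : P × Fin (N.maxConst + 1),
          r.σ 0 (.tok q.1 (.exact q.2)) • {(q.1, ((q.2 : ℕ) : ℝ≥0))} := by
      rw [Fintype.sum_prod_type]
      simp [W, Multiset.map_nsmul]
    have h2 : ∑ p, ∑ k : Fin N.maxConst, (W p (.plus k.castSucc)).map (fun x => (p, x)) =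
        A.map fun a => (a.1.1, ((a.1.2 : ℕ) : ℝ≥0) + a.2) := by
      conv_rhs => rw [← sum_filter_eq A Prod.fst, ← Multiset.coe_mapAddMonoidHom, map_sum,
        Fintype.sum_prod_type]
      refine Finset.sum_congr rfl fun p _ => Finset.sum_congr rfl fun k _ => ?_
      simp only [W, Fin.val_castSucc, k.2, dif_pos, Multiset.coe_mapAddMonoidHom,
        Multiset.map_map, Function.comp_def]
      refine Multiset.map_congr rfl fun a ha => ?_
      rw [(Multiset.mem_filter.1 ha).2]
    have h3 : ∑ p, (W p (.plus (Fin.last _))).map (fun x => (p, x)) = B := by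
      conv_rhs => rw [← sum_filter_eq B Prod.fst]
      refine Finset.sum_congr rfl fun p _ => ?_
      simp only [W, Fin.val_last, lt_irrefl, dif_neg, not_false_eq_true, Multiset.map_map]
      conv_rhs => rw [← Multiset.map_id (B.filter _)]
      refine Multiset.map_congr rfl fun τ hτ => ?_
      simp [← (Multiset.mem_filter.1 hτ).2]
    have h4 : ∑ p, ∑ k, (W p (.minus k)).map (fun x => (p, x)) =
        r.fates.map fun a => (a.1.1, ((a.1.2 : ℕ) : ℝ≥0) + (1 - g a.2).toNNReal) := by
      rw [fates, ← Multiset.coe_mapAddMonoidHom, map_sum, Fintype.sum_prod_type]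
      refine Finset.sum_congr rfl fun p _ => Finset.sum_congr rfl fun k _ => ?_
      simp only [W, Multiset.coe_mapAddMonoidHom, Multiset.map_map, Function.comp_def]
      refine Multiset.map_congr rfl fun a _ => ?_
      congr 1
      have := hg.lt_one (r.fate p k a)
      rw [← NNReal.coe_inj, coe_age hg, NNReal.coe_add, NNReal.coe_natCast,
        Real.coe_toNNReal _ (by linarith), r.phase_zero]
      have := hg.zero
      simp only [mul_zero, Nat.cast_zero, this]
      ring
    rw [flatten]
    simp only [Sym.sum_eq, Fin.sum_univ_castSucc (n := N.maxConst) (fun k => (W _ (.plus k)).map _),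
      Finset.sum_add_distrib, h1, h2, h3, h4]
    abel
  rw [← hfl]
  exact mem_ZENO hg hW C

variable (r) in
/-- Some arrangement of the tokens on the places `p(k-)` leads to zeno computations. -/
theorem exists_permMinus : ∃ wm ∈ permMinus (r.σ 0), ∀ wp ∈ permPlus (r.σ 0),
    MRUC.den ({Reg (r.σ 0) wp wm} : MRUC P N.maxConst) ⊆ ZENO N := by
  -- Grouping by fate in decreasing order: tokens with a larger fractional part reach the next
  -- integer earlier. This fixes the arrangement before `wp` and the marking are known.
  obtain ⟨F, hF, hF0, hFsum⟩ := exists_sorted_groups_gt r.fates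
  have hF1 : (F.map Prod.snd).sum = r.fates.map Prod.fst := by
    rw [← map_fst_sum_groups, hFsum]
  have hFpos : ∀ e ∈ F, (0 : ℕ∞) < e.1 := by
    intro e he
    obtain ⟨q, hq⟩ := Multiset.exists_mem_of_ne_zero (hF0 e he)
    have : (q, e.1) ∈ r.fates := by
      rw [← hFsum]
      exact mem_sum_groups.2 ⟨e, he, rfl, hq⟩
    simp only [fates, Multiset.mem_sum, Multiset.mem_map] at this
    obtain ⟨q', -, a, -, h⟩ := this
    obtain ⟨-, h⟩ := Prod.ext_iff.1 h
    exact (r.fate_pos _ _ _).trans_eq h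
  have hF0' : ∀ b ∈ F.map Prod.snd, b ≠ 0 := by
    intro b hb
    obtain ⟨e, he, rfl⟩ := List.mem_map.1 hb
    exact hF0 e he
  refine ⟨⟨F.map Prod.snd, hF0'⟩, mem_permMinus_iff.2 fun q => ?_, fun wp hwp => ?_⟩
  · rw [hF1]; exact r.count_fates q
  rintro M ⟨R, hR, M₀, hM₀, hle⟩
  obtain rfl := Finset.mem_singleton.1 hR
  obtain ⟨C, rfl⟩ := Multiset.le_iff_exists_add.1 hle
  obtain ⟨L, B, hL, hs, hL', hB, hB', rfl⟩ := Region.mem_den_iff.1 hM₀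
  obtain ⟨Lp, Lm, rfl, hLp, hLm⟩ := List.map_eq_append_iff.1 hL
  obtain ⟨hsp, hsm, hspm⟩ := List.pairwise_append.1 hs
  have hlen : F.length = Lm.length := by simpa using congrArg List.length hLm.symm
  -- The schedule is adapted to the given marking: a group with fractional part f and fate v
  -- requires g v = 1 - f.
  obtain ⟨g, hg, hgF, hgp⟩ := exists_isSchedule (K := F.map fun e => (e.1 : ℕ∞))
    (fs := Lm.map Prod.fst) (fp := Lp.map Prod.fst) (by simpa using hlen)
    (List.pairwise_map.2 hF)
    (by
      intro v hv
      obtain ⟨e, he, rfl⟩ := List.mem_map.1 hv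
      exact hFpos e he)
    (List.pairwise_map.2 hsm)
    (by
      intro v hv
      obtain ⟨e, he, rfl⟩ := List.mem_map.1 hv
      exact hL' e (List.mem_append_right _ he))
    (by
      intro v hv
      obtain ⟨e, he, rfl⟩ := List.mem_map.1 hv
      exact (hL' e (List.mem_append_left _ he)).2)
    (by
      intro a ha b hb
      obtain ⟨e, he, rfl⟩ := List.mem_map.1 ha
      obtain ⟨e', he', rfl⟩ := List.mem_map.1 hb
      exact hspm e he e' he')
  have hLmF : Lm = F.map fun e => ((1 - g e.1).toNNReal, e.2) := by
    have h1 := congrArg (List.map Real.toNNReal) hgF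
    simp only [List.map_map, Function.comp_def, Real.toNNReal_coe] at h1
    have h2 : Lm.map Prod.snd = F.map Prod.snd := hLm
    have h1' : Lm.map Prod.fst = F.map fun e => (1 - g e.1).toNNReal := h1.symm
    rw [← List.zip_unzip Lm, List.unzip_eq_map, h2, h1', List.zip_map']
  have hm : groupTokens Lm =
      r.fates.map fun a => (a.1.1, ((a.1.2 : ℕ) : ℝ≥0) + (1 - g a.2).toNNReal) := by
    rw [← hFsum, hLmF, groupTokens_map fun v => (1 - g v).toNNReal]
  have hE : exactTokens (Reg (r.σ 0) wp ⟨F.map Prod.snd, hF0'⟩).b0 =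
      ∑ q : P × Fin (N.maxConst + 1),
        r.σ 0 (.tok q.1 (.exact q.2)) • {(q.1, ((q.2 : ℕ) : ℝ≥0))} := by
    simp only [exactTokens, Reg, ← Multiset.coe_mapAddMonoidHom, map_sum, map_nsmul]
    simp
  have := mem_ZENO_of_groups (r := r) hg
    (A := (Lp.map fun e => e.2.map fun b => (b, e.1)).sum) (B := B) (fun q => ?_) (fun a ha => ?_)
    (fun p => ?_) hB' C
  · rw [hE, groupTokens_append, hm, groupTokens_eq_map, ← add_assoc]
    exact this
  · rw [map_fst_sum_groups, hLp]
    exact mem_permPlus_iff.1 hwp q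
  · obtain ⟨e, he, h1, -⟩ := mem_sum_groups.1 ha
    rw [← h1]
    exact ⟨(hL' e (List.mem_append_left _ he)).1, hgp _ (List.mem_map_of_mem he)⟩
  · rw [hB]
    exact count_sum_smul_singleton (fun p : P => r.σ 0 (.tok p (.plus (Fin.last _)))) p

end Run

/-- Membership in the intersection is used only for the arrangement given by the fates of one run.
-/
theorem den_subset_ZENO {Z : MRUC P N.maxConst} (hZ : IsZ N Z) : Z.den ⊆ ZENO N := by
  obtain ⟨Q, hQ, hZ⟩ := hZ
  intro M hM
  rw [hZ] at hM
  simp only [Set.mem_iUnion, Set.mem_iInter] at hM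
  obtain ⟨M', hM', wp, hwp, h⟩ := hM
  obtain ⟨r, rfl⟩ := exists_run hM'.1.1 hM'.2
  obtain ⟨wm, hwm, hden⟩ := r.exists_permMinus
  have := h wm hwm
  rw [hQ] at this
  exact preStar_ZENO_subset (preStar_mono (hden wp hwp) this)

end Net

/-! ## Runs of the associated net from timed computations -/

section Net

theorem SDTN.fires_of_count {Q U : Type*} {N : SDTN Q U} {t : U} {M M' : Q → ℕ}
    (h₀ : ∀ p ∈ N.input t, 1 ≤ M p)
    (h₁ : ∀ p, p ∈ N.input t → p ∈ N.output t → M' p = M p)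
    (h₂ : ∀ p, p ∈ N.input t → p ∉ N.output t → M' p + 1 = M p)
    (h₃ : ∀ p, p ∉ N.input t → p ∈ N.output t → M' p = M p + 1)
    (h₄ : ∀ p, p ∉ N.input t → p ∉ N.output t → M' p = M p) : N.Fires t M M' :=
  ⟨h₀, fun p => ⟨h₁ p, fun hi ho => by have := h₂ p hi ho; omega, h₃ p, h₄ p⟩⟩

variable {P T : Type*} [DecidableEq P] {m : ℕ}

/-- The marking with the tokens `U` and the given numbers of tokens on the control places. -/
noncomputable def mkMarking (U : Multiset (P × Sym m)) (d a b c e : ℕ) : Place P m → ℕ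
  | .tok p s => U.count (p, s)
  | .disc => d
  | .time1 => a
  | .time2 => b
  | .count => c
  | .dump => e

/-- The effect of the transfer on a symbol. -/
def Sym.bump : Sym m → Sym m
  | .exact k => .plus k
  | .plus k => .plus k
  | .minus k => .minus k

theorem Sym.bump_exact (k : Fin (m + 1)) : (Sym.exact k).bump = .plus k := rfl

theorem Sym.bump_plus (k : Fin (m + 1)) : (Sym.plus k).bump = .plus k := rfl

theorem Sym.bump_minus (k : Fin m) : (Sym.minus k).bump = .minus k := rfl

variable [Fintype P] [Fintype T] {N : TPN P T}

theorem step_switchTime (U : Multiset (P × Sym N.maxConst)) (d a b c e : ℕ) :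
    N.toSDTN.Step (mkMarking U (d + 1) a b (c + 1) e) (mkMarking U d (a + 1) b c e) := by
  refine .inl ⟨.switchTime, SDTN.fires_of_count ?_ ?_ ?_ ?_ ?_⟩ <;>
    rintro (_ | _) <;> simp [TPN.toSDTN, Trans.input, Trans.output, mkMarking]

theorem step_switchDisc (U : Multiset (P × Sym N.maxConst)) (d a b c e : ℕ) :
    N.toSDTN.Step (mkMarking U d a (b + 1) c e) (mkMarking U (d + 1) a b c e) := by
  refine .inl ⟨.switchDisc, SDTN.fires_of_count ?_ ?_ ?_ ?_ ?_⟩ <;>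
    rintro (_ | _) <;> simp [TPN.toSDTN, Trans.input, Trans.output, mkMarking]

theorem step_relabel {v : Trans N N.maxConst} {p : P} {s s' : Sym N.maxConst} (hs : s ≠ s')
    (hin : v.input = {.time2, .tok p s}) (hout : v.output = {.time2, .tok p s'})
    (U : Multiset (P × Sym N.maxConst)) (d a b c e : ℕ) :
    N.toSDTN.Step (mkMarking ((p, s) ::ₘ U) d a (b + 1) c e)
      (mkMarking ((p, s') ::ₘ U) d a (b + 1) c e) := by
  refine .inl ⟨v, SDTN.fires_of_count ?_ ?_ ?_ ?_ ?_⟩ <;>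
    simp only [TPN.toSDTN, hin, hout] <;> rintro (⟨q, r⟩ | _) <;>
    simp +contextual [mkMarking, hs, hs.symm]

theorem step_transfer (U : Multiset (P × Sym N.maxConst)) (d a b c e : ℕ) :
    N.toSDTN.Step (mkMarking U d (a + 1) b c e)
      (mkMarking (U.map fun q => (q.1, q.2.bump)) d a (b + 1) 0 (e + c)) := by
  have hexact : ∀ p k, (U.map fun q => (q.1, q.2.bump)).count (p, .exact k) = 0 := by
    intro p k
    rw [Multiset.count_eq_zero, Multiset.mem_map]
    rintro ⟨⟨q, s⟩, -, h⟩
    cases s <;> simp [Sym.bump] at h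
  have hminus : ∀ p k, (U.map fun q => (q.1, q.2.bump)).count (p, .minus k) =
      U.count (p, .minus k) := by
    intro p k
    clear hexact
    induction U using Multiset.induction_on with
    | empty => simp
    | cons q U ih =>
      obtain ⟨q, s⟩ := q
      cases s <;> simp [Multiset.count_cons, ih, Sym.bump_exact, Sym.bump_plus, Sym.bump_minus]
  have hplus : ∀ p k, (U.map fun q => (q.1, q.2.bump)).count (p, .plus k) =
      U.count (p, .plus k) + U.count (p, .exact k) := by
    intro p k
    clear hexact hminus
    induction U using Multiset.induction_on with
    | empty => simp
    | cons q U ih =>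
      obtain ⟨q, s⟩ := q
      cases s <;> simp [Multiset.count_cons, ih, Sym.bump_exact, Sym.bump_plus, Sym.bump_minus] <;> omega
  refine .inr ⟨by simp [TPN.toSDTN, mkMarking], ?_⟩
  rintro (⟨p, s | s | s⟩ | _) <;>
    simp +contextual [TPN.toSDTN, mkMarking, transferArcs, hexact, hminus, hplus]

theorem count_map_arcs (arcs : P → Option Intrv) (a : P → Sym m) (p : P) (s : Sym m) :
    ((Finset.univ.filter fun p => (arcs p).isSome = true).val.map fun p => (p, a p)).count (p, s) =
      if (arcs p).isSome = true ∧ s = a p then 1 else 0 := by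
  have hnd : ((Finset.univ.filter fun p => (arcs p).isSome = true).val.map
      fun p => (p, a p)).Nodup :=
    (Finset.nodup _).map fun p q h => (Prod.ext_iff.1 h).1
  rw [Multiset.count_eq_of_nodup hnd]
  congr 1
  simp only [Multiset.mem_map, Finset.mem_val, Finset.mem_filter, Finset.mem_univ, true_and,
    Prod.mk.injEq, eq_iff_iff]
  exact ⟨by rintro ⟨q, h, rfl, rfl⟩; exact ⟨h, rfl⟩, fun h => ⟨p, h.1, rfl, h.2.symm⟩⟩

theorem step_fire {t : T} {a b : P → Sym N.maxConst}
    (ha : ∀ p I, N.arcIn t p = some I → a p ∈ enc N.maxConst I)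
    (hb : ∀ p I, N.arcOut t p = some I → b p ∈ enc N.maxConst I)
    (U : Multiset (P × Sym N.maxConst)) (d x y c e : ℕ) :
    N.toSDTN.Step
      (mkMarking (U + (Finset.univ.filter fun p => (N.arcIn t p).isSome = true).val.map
        fun p => (p, a p)) (d + 1) x y c e)
      (mkMarking (U + (Finset.univ.filter fun p => (N.arcOut t p).isSome = true).val.map
        fun p => (p, b p)) (d + 1) x y (c + 1) e) := by
  have hin : ∀ p s, (Place.tok p s ∈ (Trans.fire (N := N) (m := N.maxConst) t _ _
      ⟨a, ha, rfl⟩ ⟨b, hb, rfl⟩).input) ↔ (N.arcIn t p).isSome = true ∧ s = a p := by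
    intro p s
    simp only [Trans.input, Set.mem_union, Set.mem_ofPred_eq, Set.mem_singleton_iff, reduceCtorEq,
      or_false, Place.tok.injEq]
    exact ⟨by rintro ⟨q, h1, rfl, rfl⟩; exact ⟨h1, rfl⟩, fun h => ⟨p, h.1, rfl, h.2⟩⟩
  have hout : ∀ p s, (Place.tok p s ∈ (Trans.fire (N := N) (m := N.maxConst) t _ _
      ⟨a, ha, rfl⟩ ⟨b, hb, rfl⟩).output) ↔ (N.arcOut t p).isSome = true ∧ s = b p := by
    intro p s
    simp only [Trans.output, Set.mem_union, Set.mem_ofPred_eq, Set.mem_singleton_iff, reduceCtorEq,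
      or_false, Place.tok.injEq, Set.mem_insert_iff]
    exact ⟨by rintro ⟨q, h1, rfl, rfl⟩; exact ⟨h1, rfl⟩, fun h => ⟨p, h.1, rfl, h.2⟩⟩
  refine .inl ⟨.fire t _ _ ⟨a, ha, rfl⟩ ⟨b, hb, rfl⟩, SDTN.fires_of_count ?_ ?_ ?_ ?_ ?_⟩ <;>
    rintro (⟨p, s⟩ | _)
  all_goals
    simp only [TPN.toSDTN, hin, hout, mkMarking, Multiset.count_add, count_map_arcs]
  all_goals first
    | (intro h1 h2; rw [if_pos h1, if_pos h2])
    | (intro h1 h2; rw [if_pos h1, if_neg h2])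
    | (intro h1 h2; rw [if_neg h1, if_pos h2])
    | (intro h1 h2; rw [if_neg h1, if_neg h2])
    | (intro h1; rw [if_pos h1]; omega)
    | (simp [Trans.input, Trans.output])

/-! ### Time steps -/

/-- The symbols that represent an age when a time of `δ` is left: a minus symbol stands for an age
that comes to exceed the next integer. -/
def Sym.Rep (δ : ℝ≥0) (s : Sym m) (x : ℝ≥0) : Prop :=
  s.Realizes x ∧ match s with
    | .exact _ => True
    | .plus k => (k : ℕ) < m → x + δ ≤ (k : ℕ) + 1
    | .minus k => ((k : ℕ) : ℝ≥0) + 1 < x + δ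

/-- A token whose age would become exactly its next integer at the very end gets a plus symbol: it
does not exceed that integer. -/
theorem Sym.exists_rep (m : ℕ) (δ x : ℝ≥0) : ∃ s : Sym m, s.Rep δ x := by
  rcases lt_or_ge (m : ℝ≥0) x with h | h
  · exact ⟨.plus (Fin.last m), ⟨h, fun h => absurd h (lt_irrefl _)⟩,
      fun h => absurd h (lt_irrefl _)⟩
  have hle : ((⌊x⌋₊ : ℕ) : ℝ≥0) ≤ x := Nat.floor_le zero_le
  have hm : ⌊x⌋₊ ≤ m := by exact_mod_cast hle.trans h
  rcases hle.eq_or_lt with he | hl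
  · exact ⟨.exact ⟨⌊x⌋₊, Nat.lt_succ_of_le hm⟩, he.symm, trivial⟩
  · have hm : ⌊x⌋₊ < m := by exact_mod_cast hl.trans_le h
    have hx := Nat.lt_floor_add_one x
    rcases lt_or_ge (((⌊x⌋₊ : ℕ) : ℝ≥0) + 1) (x + δ) with h1 | h1
    · exact ⟨.minus ⟨⌊x⌋₊, hm⟩, ⟨hl, hx⟩, h1⟩
    · exact ⟨.plus ⟨⌊x⌋₊, hm.trans (Nat.lt_succ_self _)⟩, ⟨hl, fun _ => hx⟩, fun _ => h1⟩

/-- The possible changes of a symbol in a phase of time after the transfer. -/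
def Sym.Moves (s s' : Sym m) : Prop :=
  s = s' ∨ ∃ k, s = .minus k ∧ (s' = .exact k.succ ∨ s' = .plus k.succ)

/-- Less than one time unit is left, so at most one integer is crossed. As δ' > 0, the delay is
strictly shorter than δ, so a plus token stays strictly below its next integer. -/
theorem Sym.Rep.exists_moves {δ δ' d x : ℝ≥0} {s : Sym m} (h : s.Rep δ x) (hd : 0 < d)
    (hδ : δ = d + δ') (hδ1 : δ < 1) (hδ' : 0 < δ') :
    ∃ s' : Sym m, s'.Rep δ' (x + d) ∧ s.bump.Moves s' := by
  have hxd : x + d + δ' = x + δ := by rw [hδ, add_assoc]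
  have hdδ : d < δ := by rw [hδ]; exact lt_add_of_pos_right _ hδ'
  cases s with
  | exact k =>
    obtain ⟨rfl, -⟩ : x = (k : ℕ) ∧ True := h
    refine ⟨.plus k, ⟨⟨lt_add_of_pos_right _ hd, fun _ => ?_⟩, fun _ => ?_⟩, .inl rfl⟩
    · exact add_lt_add_right (hdδ.trans hδ1) _
    · rw [hxd]; exact add_le_add_right hδ1.le _
  | plus k =>
    obtain ⟨⟨h1, h2⟩, h3⟩ := h
    refine ⟨.plus k, ⟨⟨h1.trans_le (by simp), fun hk => ?_⟩, fun hk => ?_⟩, .inl rfl⟩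
    · exact (add_lt_add_right hdδ _).trans_le (h3 hk)
    · rw [hxd]; exact h3 hk
  | minus k =>
    obtain ⟨⟨h1, h2⟩, h3⟩ := h
    have hx2 : x + δ < (k : ℕ) + 1 + 1 := add_lt_add h2 hδ1
    rcases lt_trichotomy (x + d) ((k : ℕ) + 1) with h | h | h
    · exact ⟨.minus k, ⟨⟨h1.trans_le (by simp), h⟩, by rw [hxd]; exact h3⟩, .inl rfl⟩
    · refine ⟨.exact k.succ, ⟨?_, trivial⟩, .inr ⟨k, rfl, .inl rfl⟩⟩
      show x + d = ((k.succ : Fin (m + 1)) : ℕ)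
      rw [h, Fin.val_succ, Nat.cast_succ]
    · refine ⟨.plus k.succ, ⟨⟨?_, fun _ => ?_⟩, fun _ => ?_⟩, .inr ⟨k, rfl, .inr rfl⟩⟩
      · rw [Fin.val_succ, Nat.cast_succ]; exact h
      · rw [Fin.val_succ, Nat.cast_succ]
        exact (add_lt_add_right hdδ _).trans hx2
      · rw [Fin.val_succ, Nat.cast_succ, hxd]; exact hx2.le

theorem reflTransGen_moves (Y : Multiset (P × Sym N.maxConst × Sym N.maxConst))
    (hY : ∀ y ∈ Y, y.2.1.Moves y.2.2) (U : Multiset (P × Sym N.maxConst)) (d a b c e : ℕ) :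
    Relation.ReflTransGen N.toSDTN.Step
      (mkMarking (Y.map (fun y => (y.1, y.2.1)) + U) d a (b + 1) c e)
      (mkMarking (Y.map (fun y => (y.1, y.2.2)) + U) d a (b + 1) c e) := by
  induction Y using Multiset.induction_on generalizing U with
  | empty => exact .refl
  | cons y Y ih =>
    have ih' := ih (fun z hz => hY z (Multiset.mem_cons_of_mem hz)) ((y.1, y.2.2) ::ₘ U)
    rw [Multiset.add_cons, Multiset.add_cons, ← Multiset.cons_add, ← Multiset.cons_add] at ih'
    rw [Multiset.map_cons, Multiset.map_cons]
    refine .trans ?_ ih'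
    obtain ⟨p, s, s'⟩ := y
    rcases hY _ (Multiset.mem_cons_self _ _) with h | ⟨k, h, h' | h'⟩
    · obtain rfl : s = s' := h
      exact .refl
    · obtain rfl : s = _ := h
      obtain rfl : s' = _ := h'
      rw [Multiset.cons_add, Multiset.cons_add]
      exact .single (step_relabel (v := .reach p k) (by simp) rfl rfl _ _ _ _ _ _)
    · obtain rfl : s = _ := h
      obtain rfl : s' = _ := h'
      rw [Multiset.cons_add, Multiset.cons_add]
      exact .single (step_relabel (v := .exceed p k) (by simp) rfl rfl _ _ _ _ _ _)

/-- The marking `U` of the token places represents the timed marking `M` when a time of `δ` is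
left. -/
def Encodes (δ : ℝ≥0) (U : Multiset (P × Sym m)) (M : Marking P) : Prop :=
  ∃ V : Multiset (P × ℝ≥0 × Sym m), V.map (fun v => (v.1, v.2.1)) = M ∧
    V.map (fun v => (v.1, v.2.2)) = U ∧ ∀ v ∈ V, v.2.2.Rep δ v.2.1

theorem exists_encodes {P : Type*} (m : ℕ) (δ : ℝ≥0) (M : Marking P) :
    ∃ U : Multiset (P × Sym m), Encodes δ U M := by
  choose cls hcls using Sym.exists_rep m δ
  refine ⟨_, M.map fun τ => (τ.1, τ.2, cls τ.2), by simp [Multiset.map_map], rfl, ?_⟩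
  intro v hv
  obtain ⟨τ, _, rfl⟩ := Multiset.mem_map.1 hv
  exact hcls _

theorem Encodes.time {δ δ' d : ℝ≥0} {U : Multiset (P × Sym N.maxConst)} {M : Marking P}
    (h : Encodes δ U M) (hδ : δ = d + δ') (hδ1 : δ < 1) (h0 : δ = 0 ∨ 0 < δ') (c e : ℕ) :
    ∃ U' c' e', Encodes δ' U' (M.map fun τ => (τ.1, τ.2 + d)) ∧
      Relation.ReflTransGen N.toSDTN.Step (mkMarking U 1 0 0 (c + 1) e)
        (mkMarking U' 1 0 0 c' e') := by
  -- A delay 0 is simulated by no transition at all: a transfer would wrongly make integer ages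
  -- fractional.
  rcases (zero_le (a := d)).eq_or_lt with h0d | hd
  · subst h0d
    refine ⟨U, c + 1, e, ?_, .refl⟩
    obtain rfl : δ = δ' := by simpa using hδ
    simpa using h
  have hδ' : 0 < δ' := by
    rcases h0 with h0 | h0
    · have h1 : d ≤ δ := by rw [hδ]; exact le_self_add
      exact absurd (h1.trans_eq h0) (not_le.2 hd)
    · exact h0
  obtain ⟨V, rfl, rfl, hV⟩ := h
  have hmv : ∀ v : P × ℝ≥0 × Sym N.maxConst, ∃ s' : Sym N.maxConst, v ∈ V →
      s'.Rep δ' (v.2.1 + d) ∧ v.2.2.bump.Moves s' := by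
    intro v
    by_cases hv : v ∈ V
    · obtain ⟨s', hs'⟩ := (hV v hv).exists_moves hd hδ hδ1 hδ'
      exact ⟨s', fun _ => hs'⟩
    · exact ⟨v.2.2, fun h => absurd h hv⟩
  choose f hf using hmv
  -- One token of count pays for the switch, the transfer dumps the other `c`, and the crossings of
  -- integers are recorded before control returns to disc.
  refine ⟨V.map fun v => (v.1, f v), 0, e + c, ⟨V.map fun v => (v.1, v.2.1 + d, f v), ?_, ?_, ?_⟩,
    .head (step_switchTime _ 0 0 0 c e) (.head (step_transfer _ 0 0 0 c e)
      (.tail ?_ (step_switchDisc _ 0 0 0 0 (e + c))))⟩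
  · simp [Multiset.map_map]
  · simp [Multiset.map_map]
  · intro v hv
    obtain ⟨u, hu, rfl⟩ := Multiset.mem_map.1 hv
    exact (hf u hu).1
  · have := reflTransGen_moves (N := N) (V.map fun v => (v.1, v.2.2.bump, f v)) (by
      intro y hy
      obtain ⟨u, hu, rfl⟩ := Multiset.mem_map.1 hy
      exact (hf u hu).2) 0 0 0 0 0 (e + c)
    simpa [Multiset.map_map, Function.comp_def] using this

/-- Created tokens are classified by the time that is left, and symbols lie in the encoding of an
interval exactly when the ages they represent lie in it. -/
theorem Encodes.disc {δ : ℝ≥0} {U : Multiset (P × Sym N.maxConst)} {M M' : Marking P} {t : T}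
    (h : Encodes δ U M) (hs : Step N (.disc t) M M') (c e : ℕ) :
    ∃ U', Encodes δ U' M' ∧
      N.toSDTN.Step (mkMarking U 1 0 0 c e) (mkMarking U' 1 0 0 (c + 1) e) := by
  obtain ⟨V, rfl, rfl, hV⟩ := h
  obtain ⟨x, y, C, hx, hy, hM, rfl⟩ := hs
  obtain ⟨VC, VI, rfl, rfl, hI⟩ := exists_add_of_map_eq_add hM
  have : Inhabited (Sym N.maxConst) := ⟨.exact 0⟩
  obtain ⟨a, ha, hmem⟩ := exists_arcTokens_snd hI
  choose cls hcls using Sym.exists_rep N.maxConst δ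
  refine ⟨_, ⟨VC + (Finset.univ.filter fun p => (N.arcOut t p).isSome = true).val.map
    fun p => (p, y p, cls (y p)), ?_, rfl, ?_⟩, ?_⟩
  · simp [arcTokens, Multiset.map_map]
  · intro v hv
    rcases Multiset.mem_add.1 hv with hv | hv
    · exact hV v (Multiset.mem_add.2 (.inl hv))
    · obtain ⟨p, _, rfl⟩ := Multiset.mem_map.1 hv
      exact hcls _
  · rw [Multiset.map_add, Multiset.map_add, ha, Multiset.map_map]
    refine step_fire (fun p I hI => ?_) (fun p I hI => ?_) _ 0 0 0 c e
    · exact ((hV _ (Multiset.mem_add.2 (.inr (hmem p (by simp [hI]))))).1.mem_enc_iff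
        (N.maxConst_arcIn_le hI)).2 (hx p I hI)
    · exact ((hcls _).1.mem_enc_iff (N.maxConst_arcOut_le hI)).2 (hy p I hI)

end Net

/-! ## Tails of infinite computations -/

section Tails

theorem tsum_nat_add_eq {f : ℕ → ℝ≥0} (hf : Summable f) (i : ℕ) :
    ∑' k, f (k + i) = f i + ∑' k, f (k + (i + 1)) := by
  have e : (fun k => f (k + (i + 1))) = fun k => f (k + 1 + i) := by
    funext k
    congr 1
    omega
  have hf' : Summable fun k => f (k + 1 + i) := e ▸ (NNReal.summable_nat_add_iff (i + 1)).2 hf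
  have h := tsum_eq_zero_add' (f := fun k => f (k + i)) hf'
  rw [e, h, zero_add]

theorem exists_tail_sums {f : ℕ → ℝ≥0} (hf : Summable f) :
    ∃ Δ : ℕ → ℝ≥0, (∀ i, Δ i = f i + Δ (i + 1)) ∧ Filter.Tendsto Δ Filter.atTop (nhds 0) :=
  ⟨fun i => ∑' k, f (k + i), tsum_nat_add_eq hf, NNReal.tendsto_sum_nat_add f⟩

variable {P T : Type*} [Fintype P] {N : TPN P T} (π : InfComputation N)

/-- `Δ i` is the time that passes after step `i`. -/
def InfComputation.IsTail (Δ : ℕ → ℝ≥0) : Prop :=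
  ∀ i, Δ i = (π.label i).delay + Δ (i + 1)

theorem InfComputation.exists_isTail {m : ℝ≥0} (h : π.totalDelay ≤ m) :
    ∃ Δ, π.IsTail Δ ∧ Filter.Tendsto Δ Filter.atTop (nhds 0) :=
  exists_tail_sums (ENNReal.tsum_coe_ne_top_iff_summable.1 (h.trans_lt ENNReal.coe_lt_top).ne)

variable {π} {Δ : ℕ → ℝ≥0}

theorem InfComputation.IsTail.antitone (h : π.IsTail Δ) : Antitone Δ :=
  antitone_nat_of_succ_le fun i => by rw [h i]; exact le_add_self

/-- Consecutive time steps amount to one. -/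
theorem InfComputation.IsTail.exists_delay (h : π.IsTail Δ) (i n : ℕ)
    (ht : ∀ l, i ≤ l → l < i + n → ¬ ∃ t, π.label l = .disc t) :
    ∃ d, π.state (i + n) = (π.state i).map (fun τ => (τ.1, τ.2 + d)) ∧ Δ i = d + Δ (i + n) := by
  induction n with
  | zero => exact ⟨0, by simp⟩
  | succ n ih =>
    obtain ⟨d, h1, h2⟩ := ih fun l hl hl' => ht l hl (by omega)
    have hs := π.step (i + n)
    have hΔ := h (i + n)
    cases hl : π.label (i + n) with
    | disc t => exact absurd ⟨t, hl⟩ (ht (i + n) (by omega) (by omega))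
    | time d' =>
      rw [hl] at hs hΔ
      refine ⟨d + d', ?_, ?_⟩
      · rw [← add_assoc, show π.state (i + n + 1) = _ from hs, h1, Multiset.map_map]
        simp [add_assoc]
      · rw [h2, hΔ]; exact (add_assoc _ _ _).symm

theorem InfComputation.reflTransGen (π : InfComputation N) {i j : ℕ} (h : i ≤ j) :
    Relation.ReflTransGen (fun M₁ M₂ => ∃ l, Step N l M₁ M₂) (π.state i) (π.state j) := by
  induction j, h using Nat.le_induction with
  | base => exact .refl
  | succ j _ ih => exact .tail ih ⟨_, π.step j⟩

/-- The encoding of a tail of a zeno computation starts an infinite computation of the associated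
net. -/
theorem InfComputation.IsTail.mem_INF [Fintype T] [DecidableEq P] (h : π.IsTail Δ) {j : ℕ}
    (hj : ∃ t, π.label j = .disc t) (hj1 : Δ j < 1) (h0 : ∀ i ≥ j, Δ i = 0 ∨ ∀ i, 0 < Δ i)
    {U : Multiset (P × Sym N.maxConst)} (hU : Encodes (Δ j) U (π.state j)) :
    mkMarking U 1 0 0 0 0 ∈ N.toSDTN.INF := by
  -- Encodings of the states just before a discrete transition. The contents of count and dump are
  -- left free, since only the possibility of continuing matters.
  let S : Set (Place P N.maxConst → ℕ) := {E | ∃ i ≥ j, (∃ t, π.label i = .disc t) ∧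
    ∃ U c e, Encodes (Δ i) U (π.state i) ∧ E = mkMarking U 1 0 0 c e}
  refine exists_infinite_path (S := S) ?_ ⟨j, le_rfl, hj, U, 0, 0, hU, rfl⟩
  rintro _ ⟨i, hij, ⟨t, ht⟩, U, c, e, hU, rfl⟩
  have hs := π.step i
  have hΔ := h i
  rw [ht] at hs hΔ
  obtain ⟨U₁, hU₁, hstep⟩ := hU.disc hs c e
  rw [show Δ i = Δ (i + 1) by rw [hΔ]; exact zero_add _] at hU₁
  have hex : ∃ n, ∃ t, π.label (i + 1 + n) = .disc t := by
    obtain ⟨i', hi', h'⟩ := π.disc_often (i + 1)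
    exact ⟨i' - (i + 1), by rwa [Nat.add_sub_cancel' hi']⟩
  classical
  -- The delays up to the next discrete transition are merged into one, because N' allows a time
  -- phase only after a discrete transition.
  obtain ⟨d, hd, hdΔ⟩ := h.exists_delay (i + 1) (Nat.find hex) fun l hl hl' hc =>
    Nat.find_min hex (m := l - (i + 1)) (by omega) (by rwa [Nat.add_sub_cancel' hl])
  obtain ⟨U₂, c', e', hU₂, hrt⟩ := hU₁.time hdΔ ((h.antitone (by omega)).trans_lt hj1)
    ((h0 (i + 1) (by omega)).imp_right fun h => h _) c e
  rw [← hd] at hU₂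
  exact ⟨_, ⟨i + 1 + Nat.find hex, by omega, Nat.find_spec hex, U₂, c', e', hU₂, rfl⟩,
    .head' hstep hrt⟩

/-- Two ages before step `i` that may be exchanged without consequences until step `j`, when time
`Δ j` is left: the first one comes to exceed an integer after step `j` only, and the second one
does not reach it before. -/
def Exchangeable (m : ℕ) (Δ : ℕ → ℝ≥0) (i₀ j i : ℕ) (x x' : ℝ≥0) : Prop :=
  x = x' ∨ ∃ k : ℕ, k < m ∧ (x : ℝ) + (Δ i - Δ j) < k + 1 ∧ (k : ℝ) + 1 < x + Δ i ∧
    (x' : ℝ) + (Δ i - Δ j) < k + 1 ∧ (k : ℝ) + (Δ i₀ - Δ i) < x'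

/-- Tokens that are created with exchangeable ages can be given other ages from the start. -/
theorem InfComputation.IsTail.exists_exchange [Fintype T] (h : π.IsTail Δ) {i₀ j : ℕ}
    (hj1 : Δ i₀ < 1) {V : Multiset (P × ℝ≥0 × ℝ≥0)}
    (hV : V.map (fun v => (v.1, v.2.1)) = π.state j)
    (hV' : ∀ v ∈ V, Exchangeable N.maxConst Δ i₀ j j v.2.1 v.2.2) {i : ℕ} (hi : i₀ ≤ i)
    (hij : i ≤ j) :
    ∃ W : Multiset (P × ℝ≥0 × ℝ≥0), W.map (fun v => (v.1, v.2.1)) = π.state i ∧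
      (∀ v ∈ W, Exchangeable N.maxConst Δ i₀ j i v.2.1 v.2.2) ∧
      Relation.ReflTransGen (fun M₁ M₂ => ∃ l, Step N l M₁ M₂)
        (W.map fun v => (v.1, v.2.2)) (V.map fun v => (v.1, v.2.2)) := by
  induction hij using Nat.decreasingInduction with
  | self => exact ⟨V, hV, hV', .refl⟩
  | of_succ i hij ih =>
    obtain ⟨W, hW, hW', hr⟩ := ih (by omega)
    have hs := π.step i
    have hΔ := h i
    have hΔ₀ : (Δ i : ℝ) ≤ Δ i₀ := h.antitone hi
    have hΔj : (Δ j : ℝ) ≤ Δ (i + 1) := h.antitone hij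
    have hj1 : (Δ i₀ : ℝ) < 1 := hj1
    cases hl : π.label i with
    | time d =>
      rw [hl] at hs hΔ
      have hΔ : (Δ i : ℝ) = d + Δ (i + 1) := by rw [hΔ]; rfl
      have hd : (0 : ℝ) ≤ d := d.2
      -- Both ages are at least d, so the delay can be undone: the original age because its token
      -- comes from the previous state, the exchanged one because it exceeds k by more than the time
      -- since i₀.
      have hle : ∀ v ∈ W, d ≤ v.2.1 ∧ d ≤ v.2.2 := by
        intro v hv
        have h1 : d ≤ v.2.1 := by
          have : (v.1, v.2.1) ∈ π.state (i + 1) := hW ▸ Multiset.mem_map_of_mem _ hv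
          rw [show π.state (i + 1) = _ from hs] at this
          obtain ⟨τ, _, hτ⟩ := Multiset.mem_map.1 this
          have hτ' := (Prod.ext_iff.1 hτ).2
          dsimp only at hτ'
          rw [← hτ']
          exact le_add_self
        refine ⟨h1, ?_⟩
        rcases hW' v hv with he | ⟨k, -, -, -, -, h5⟩
        · rwa [← he]
        · rw [← NNReal.coe_le_coe]
          have : (0 : ℝ) ≤ k := Nat.cast_nonneg _
          linarith
      refine ⟨W.map fun v => (v.1, v.2.1 - d, v.2.2 - d), ?_, ?_, .head ⟨.time d, ?_⟩ hr⟩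
      · have hinj : Function.Injective fun τ : P × ℝ≥0 => (τ.1, τ.2 + d) := by
          rintro ⟨p, x⟩ ⟨q, y⟩ hxy
          simpa using hxy
        refine Multiset.map_injective hinj ?_
        rw [← show π.state (i + 1) = _ from hs, ← hW, Multiset.map_map, Multiset.map_map]
        refine Multiset.map_congr rfl fun v hv => ?_
        simp [tsub_add_cancel_of_le (hle v hv).1]
      · intro v hv
        obtain ⟨u, hu, rfl⟩ := Multiset.mem_map.1 hv
        rcases hW' u hu with he | ⟨k, h1, h2, h3, h4, h5⟩
        · exact .inl (by rw [he])
        · refine .inr ⟨k, h1, ?_⟩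
          rw [NNReal.coe_sub (hle u hu).1, NNReal.coe_sub (hle u hu).2]
          refine ⟨?_, ?_, ?_, ?_⟩ <;> linarith
      · show _ = _
        rw [Multiset.map_map, Multiset.map_map]
        refine Multiset.map_congr rfl fun v hv => ?_
        simp [tsub_add_cancel_of_le (hle v hv).2]
    | disc t =>
      rw [hl] at hs hΔ
      have hΔ : Δ i = Δ (i + 1) := by rw [hΔ]; exact zero_add _
      obtain ⟨x, y, C, hx, hy, hM, hM'⟩ := hs
      rw [← hΔ] at hΔj
      rw [hM'] at hW
      obtain ⟨WC, WO, rfl, rfl, hO⟩ := exists_add_of_map_eq_add hW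
      obtain ⟨y', hy', hmem⟩ := exists_arcTokens_snd hO
      have hE : ∀ v ∈ WC + WO, Exchangeable N.maxConst Δ i₀ j i v.2.1 v.2.2 := by
        intro v hv
        have := hW' v hv
        rwa [Exchangeable, ← hΔ] at this
      -- Going backwards, the created tokens disappear together with their exchanged ages, and the
      -- consumed ones appear with the same age on both sides.
      refine ⟨WC + (Finset.univ.filter fun p => (N.arcIn t p).isSome = true).val.map
        fun p => (p, x p, x p), ?_, ?_, .head ⟨.disc t, x, y', WC.map fun v => (v.1, v.2.2), hx,
          fun p I hI => ?_, ?_, ?_⟩ hr⟩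
      · rw [hM]; simp [arcTokens, Multiset.map_map]
      · intro v hv
        rcases Multiset.mem_add.1 hv with hv | hv
        · exact hE v (Multiset.mem_add.2 (.inl hv))
        · obtain ⟨p, _, rfl⟩ := Multiset.mem_map.1 hv
          exact .inl rfl
      · rcases hE _ (Multiset.mem_add.2 (.inr (hmem p (by simp [hI])))) with
          he | ⟨k, h1, h2, h3, h4, h5⟩
        · rw [← show y p = y' p from he]; exact hy p I hI
        -- At the moment of creation both ages lie in the open interval (k, k+1), so the output arc
        -- admits one if and only if it admits the other.
        · have key : ∀ z : ℝ≥0, (k : ℝ) < z → (z : ℝ) < k + 1 →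
              (Sym.minus (⟨k, h1⟩ : Fin N.maxConst)).Realizes z := fun z hz hz' =>
            ⟨NNReal.coe_lt_coe.1 (by simpa using hz), NNReal.coe_lt_coe.1 (by simpa using hz')⟩
          have hI' := N.maxConst_arcOut_le hI
          simp only at h2 h3 h4 h5
          rw [← (key (y' p) (by linarith) (by linarith)).mem_enc_iff hI',
            (key (y p) (by linarith) (by linarith)).mem_enc_iff hI']
          exact hy p I hI
      · simp [arcTokens, Multiset.map_map]
      · rw [Multiset.map_add, hy']; rfl

end Tails

/-! ## Minimal markings -/

section Minimal

variable {P T : Type*} [Fintype P] {m : ℕ}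

instance : Finite (Place P m) := by
  let f : Place P m → Option (P × Sym m) × Fin 6
    | .tok p s => (some (p, s), 0)
    | .disc => (none, 1)
    | .time1 => (none, 2)
    | .time2 => (none, 3)
    | .count => (none, 4)
    | .dump => (none, 5)
  refine Finite.of_injective f ?_
  rintro (_ | _) (_ | _) h <;> simp_all [f]

/-- A minimal element below a standard marking can differ from standard only by having no control
token at all, and then nothing would be enabled. -/
theorem exists_INFminStd_le [Fintype T] {N : TPN P T} {M : Place P N.maxConst → ℕ}
    (hM : M ∈ N.toSDTN.INF) (hs : IsStandard M) : ∃ E ∈ INFminStd N, E ≤ M := by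
  obtain ⟨E, hE, hmin⟩ := exists_minimal_le_of_wellFoundedLT (· ∈ N.toSDTN.INF) M hM
  refine ⟨E, ⟨hmin, ?_⟩, hE⟩
  obtain ⟨h1, h2, h3, h4⟩ := hs
  have e1 : E .disc ≤ 1 := (hE .disc).trans_eq h1
  have e2 : E .time1 ≤ 0 := (hE .time1).trans_eq h2
  have e3 : E .time2 ≤ 0 := (hE .time2).trans_eq h3
  have e4 : E .count ≤ 0 := (hE .count).trans_eq h4
  refine ⟨?_, by omega, by omega, by omega⟩
  obtain ⟨σ, h0, hσ⟩ := hmin.1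
  -- Every transition of N' needs a token on one of these three places.
  have : 1 ≤ E .disc ∨ 1 ≤ E .time1 ∨ 1 ≤ E .time2 := by
    rw [← h0]
    rcases hσ 0 with ⟨v, hv, -⟩ | ⟨hv, -⟩
    · cases v with
      | fire t A B hA hB => exact .inl (hv _ (by simp [TPN.toSDTN, Trans.input]))
      | switchTime => exact .inl (hv _ (by simp [TPN.toSDTN, Trans.input]))
      | switchDisc => exact .inr (.inr (hv _ (by simp [TPN.toSDTN, Trans.input])))
      | reach p k => exact .inr (.inr (hv _ (by simp [TPN.toSDTN, Trans.input])))
      | exceed p k => exact .inr (.inr (hv _ (by simp [TPN.toSDTN, Trans.input])))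
    · exact .inr (.inl (hv _ rfl))
  omega

theorem exists_increasing_list {c : ℝ≥0} (hc : c < 1) (n : ℕ) :
    ∃ l : List ℝ≥0, l.length = n ∧ l.Pairwise (· < ·) ∧ ∀ f ∈ l, c < f ∧ f < 1 := by
  induction n generalizing c with
  | zero => exact ⟨[], by simp⟩
  | succ n ih =>
    obtain ⟨f, hf, hf'⟩ := exists_between hc
    obtain ⟨l, h1, h2, h3⟩ := ih hf'
    refine ⟨f :: l, by simp [h1], List.pairwise_cons.2 ⟨fun x hx => (h3 x hx).1, h2⟩, ?_⟩
    intro x hx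
    rcases List.mem_cons.1 hx with rfl | hx
    exacts [⟨hf, hf'⟩, ⟨hf.trans (h3 x hx).1, (h3 x hx).2⟩]

/-- The tokens of a marking of the associated net, by kinds of symbols. -/
theorem sum_tok_eq (E : Place P m → ℕ) :
    ∑ q : P × Sym m, E (.tok q.1 q.2) • ({q} : Multiset (P × Sym m)) =
      (∑ q : P × Fin (m + 1), E (.tok q.1 (.exact q.2)) • ({q} : Multiset _)).map
        (fun q => (q.1, .exact q.2)) +
      (∑ q : P × Fin m, E (.tok q.1 (.plus q.2.castSucc)) • ({q} : Multiset _)).map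
        (fun q => (q.1, .plus q.2.castSucc)) +
      (∑ q : P × Fin m, E (.tok q.1 (.minus q.2)) • ({q} : Multiset _)).map
        (fun q => (q.1, .minus q.2)) +
      (∑ p, E (.tok p (.plus (Fin.last m))) • ({p} : Multiset _)).map
        (fun p => (p, .plus (Fin.last m))) := by
  simp only [← Multiset.coe_mapAddMonoidHom, map_sum, map_nsmul]
  simp only [Multiset.coe_mapAddMonoidHom, Multiset.map_singleton, Fintype.sum_prod_type,
    Sym.sum_eq, Fin.sum_univ_castSucc
      (fun k => E (.tok _ (.plus k)) • ({(_, .plus k)} : Multiset (P × Sym m))),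
    Finset.sum_add_distrib]
  abel

end Minimal

/-! ## Zeno markings belong to the denotation -/

section Final

variable {P T : Type*} [Fintype P] [Fintype T] {N : TPN P T}

/-- Choice of a step of a zeno computation that is the start of an encodable tail and of an
earlier one whose tokens do not exceed another integer age later. -/
theorem exists_steps {π : InfComputation N} {Δ : ℕ → ℝ≥0} (h : π.IsTail Δ)
    (hΔ : Filter.Tendsto Δ Filter.atTop (nhds 0)) :
    ∃ i₀ j, i₀ ≤ j ∧ Δ i₀ < 1 ∧ (∃ t, π.label j = .disc t) ∧
      (∀ i ≥ j, Δ i = 0 ∨ ∀ i, 0 < Δ i) ∧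
      ∀ τ ∈ π.state i₀, ∀ k : Fin N.maxConst, ((k : ℕ) : ℝ) + 1 < τ.2 + Δ i₀ →
        ((k : ℕ) : ℝ) + 1 ≤ τ.2 + (Δ i₀ - Δ j) := by
  -- Either the remaining time vanishes and i₀ is taken from there on, or it is always positive.
  -- This excludes a positive delay that uses up all remaining time, for which the encoding of plus
  -- tokens would fail.
  obtain ⟨i₀, h1, h0⟩ : ∃ i₀, Δ i₀ < 1 ∧ ∀ i ≥ i₀, Δ i = 0 ∨ ∀ i, 0 < Δ i := by
    by_cases hz : ∃ i, Δ i = 0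
    · obtain ⟨i, hi⟩ := hz
      exact ⟨i, by rw [hi]; exact one_pos, fun l hl =>
        .inl (le_antisymm ((h.antitone hl).trans_eq hi) zero_le)⟩
    · obtain ⟨i, hi⟩ := (hΔ.eventually (gt_mem_nhds one_pos)).exists
      exact ⟨i, hi, fun _ _ => .inr fun l => pos_iff_ne_zero.2 fun hl => hz ⟨l, hl⟩⟩
  -- Only finitely many ages and integers are concerned, and Δ j tends to 0: an integer exceeded in
  -- the remaining time is reached before step j once j is large.
  have hev : ∀ᶠ j in Filter.atTop, ∀ τ ∈ (π.state i₀).map Prod.snd, ∀ k : Fin N.maxConst,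
      ((k : ℕ) : ℝ) + 1 < τ + Δ i₀ → ((k : ℕ) : ℝ) + 1 ≤ τ + (Δ i₀ - Δ j) := by
    have hfin : {x | x ∈ (π.state i₀).map Prod.snd}.Finite := by
      classical
      exact ((π.state i₀).map Prod.snd).toFinset.finite_toSet.subset fun x hx => by simpa using hx
    refine (Filter.eventually_all_finite hfin).2 fun x _ => Filter.eventually_all.2 fun k => ?_
    by_cases hk : ((k : ℕ) : ℝ) + 1 < x + Δ i₀
    · have hΔ' : Filter.Tendsto (fun j => (Δ j : ℝ)) Filter.atTop (nhds 0) := by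
        simpa using NNReal.tendsto_coe.2 hΔ
      filter_upwards [hΔ'.eventually (gt_mem_nhds (sub_pos.2 hk))] with j hj _
      linarith
    · exact Filter.Eventually.of_forall fun _ h => absurd h hk
  obtain ⟨n, hn⟩ := Filter.eventually_atTop.1 hev
  obtain ⟨j, hj, hjd⟩ := π.disc_often (max i₀ n)
  exact ⟨i₀, j, (le_max_left _ _).trans hj, h1, hjd,
    fun i hi => h0 i (((le_max_left _ _).trans hj).trans hi), fun τ hτ =>
      hn j ((le_max_right _ _).trans hj) τ.2 (Multiset.mem_map_of_mem _ hτ)⟩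

/-- The groups of the tokens represented by plus symbols. -/
theorem exists_plus_groups {δ : ℝ≥0} {V : Multiset (P × ℝ≥0 × Sym N.maxConst)}
    {b : Multiset (P × Fin N.maxConst)}
    (hV : V.map (fun v => (v.1, v.2.2)) = b.map fun q => (q.1, .plus q.2.castSucc))
    (hrep : ∀ v ∈ V, v.2.2.Rep δ v.2.1) :
    ∃ L : List (ℝ≥0 × Multiset (P × Fin N.maxConst)), L.Pairwise (fun a b => a.1 < b.1) ∧
      (∀ e ∈ L, e.2 ≠ 0) ∧ (∀ e ∈ L, 0 < e.1 ∧ e.1 < 1) ∧ (L.map Prod.snd).sum = b ∧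
      groupTokens L = V.map fun v => (v.1, v.2.1) := by
  obtain ⟨W, rfl, rfl, hW⟩ := exists_pairing_of_map_eq hV
  have key : ∀ w ∈ W, w.1.1 = w.2.1 ∧ ((w.2.2 : ℕ) : ℝ≥0) < w.1.2.1 ∧
      w.1.2.1 < (w.2.2 : ℕ) + 1 := by
    intro w hw
    have h1 := (hrep w.1 (Multiset.mem_map_of_mem _ hw)).1
    obtain ⟨h2, h3⟩ := Prod.ext_iff.1 (hW w hw)
    dsimp only at h2 h3
    rw [h3] at h1
    exact ⟨h2, h1.1, h1.2 w.2.2.2⟩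
  obtain ⟨L, hs, h0, hsum⟩ := exists_sorted_groups
    (W.map fun w => (w.2, w.1.2.1 - ((w.2.2 : ℕ) : ℝ≥0)))
  refine ⟨L, hs, h0, fun e he => ?_, ?_, ?_⟩
  · obtain ⟨q, hq⟩ := Multiset.exists_mem_of_ne_zero (h0 e he)
    have := (mem_sum_groups (a := (q, e.1))).2 ⟨e, he, rfl, hq⟩
    rw [hsum] at this
    obtain ⟨w, hw, h⟩ := Multiset.mem_map.1 this
    obtain ⟨h1, h2⟩ := Prod.ext_iff.1 h
    obtain ⟨-, h3, h4⟩ := key w hw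
    dsimp only at h2
    rw [← h2]
    exact ⟨tsub_pos_of_lt h3, by rwa [tsub_lt_iff_left h3.le]⟩
  · rw [← map_fst_sum_groups, hsum]
    simp [Multiset.map_map]
  · rw [groupTokens_eq_map, hsum, Multiset.map_map, Multiset.map_map]
    refine Multiset.map_congr rfl fun w hw => ?_
    obtain ⟨h1, h2, -⟩ := key w hw
    simp only [Function.comp_apply]
    rw [h1, add_tsub_cancel_of_le h2.le]

theorem exactTokens_eq {V : Multiset (P × ℝ≥0 × Sym N.maxConst)} {δ : ℝ≥0}
    {b : Multiset (P × Fin (N.maxConst + 1))}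
    (hV : V.map (fun v => (v.1, v.2.2)) = b.map fun q => (q.1, .exact q.2))
    (hrep : ∀ v ∈ V, v.2.2.Rep δ v.2.1) : exactTokens b = V.map fun v => (v.1, v.2.1) := by
  obtain ⟨W, rfl, rfl, hW⟩ := exists_pairing_of_map_eq hV
  rw [exactTokens, Multiset.map_map, Multiset.map_map]
  refine Multiset.map_congr rfl fun w hw => ?_
  have h1 := (hrep w.1 (Multiset.mem_map_of_mem _ hw)).1
  obtain ⟨h2, h3⟩ := Prod.ext_iff.1 (hW w hw)
  dsimp only at h2 h3
  rw [h3] at h1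
  exact Prod.ext h2.symm (Eq.symm h1)

/-- Tokens represented by minus symbols can be paired with tokens that are arranged in a given
order. -/
theorem exists_minus_groups {Δ : ℕ → ℝ≥0} {i₀ j : ℕ} (hij : Δ j ≤ Δ i₀)
    {V : Multiset (P × ℝ≥0 × Sym N.maxConst)} {b : Multiset (P × Fin N.maxConst)}
    (hV : V.map (fun v => (v.1, v.2.2)) = b.map fun q => (q.1, .minus q.2))
    (hrep : ∀ v ∈ V, v.2.2.Rep (Δ j) v.2.1)
    {L : List (ℝ≥0 × Multiset (P × Fin N.maxConst))} (hL : (L.map Prod.snd).sum = b)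
    (hL' : ∀ e ∈ L, Δ i₀ - Δ j < e.1 ∧ e.1 < 1) :
    ∃ W : Multiset (P × ℝ≥0 × ℝ≥0),
      W.map (fun v => (v.1, v.2.1)) = V.map (fun v => (v.1, v.2.1)) ∧
      W.map (fun v => (v.1, v.2.2)) = groupTokens L ∧
      ∀ v ∈ W, Exchangeable N.maxConst Δ i₀ j j v.2.1 v.2.2 := by
  rw [← hL, ← map_fst_sum_groups, Multiset.map_map] at hV
  obtain ⟨W, rfl, hW₂, hW⟩ := exists_pairing_of_map_eq hV
  refine ⟨W.map fun w => (w.1.1, w.1.2.1, ((w.2.1.2 : ℕ) : ℝ≥0) + w.2.2), ?_, ?_, ?_⟩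
  · simp [Multiset.map_map]
  · rw [groupTokens_eq_map, ← hW₂, Multiset.map_map, Multiset.map_map]
    refine Multiset.map_congr rfl fun w hw => ?_
    have := (Prod.ext_iff.1 (hW w hw)).1
    exact Prod.ext this rfl
  · intro v hv
    obtain ⟨w, hw, rfl⟩ := Multiset.mem_map.1 hv
    have h1 := hrep w.1 (Multiset.mem_map_of_mem _ hw)
    have h3 := (Prod.ext_iff.1 (hW w hw)).2
    dsimp only [Function.comp_apply] at h3
    rw [h3] at h1
    obtain ⟨⟨h4, h5⟩, h6⟩ := h1
    obtain ⟨e, he, he', -⟩ := mem_sum_groups.1 (hW₂ ▸ Multiset.mem_map_of_mem Prod.snd hw)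
    obtain ⟨h7, h8⟩ := hL' e he
    rw [he'] at h7 h8
    have h7 := NNReal.coe_lt_coe.2 h7
    rw [NNReal.coe_sub hij] at h7
    have h5 := NNReal.coe_lt_coe.2 h5
    have h6 := NNReal.coe_lt_coe.2 h6
    have h8 := NNReal.coe_lt_coe.2 h8
    refine .inr ⟨w.2.1.2, w.2.1.2.2, ?_⟩
    push_cast at *
    refine ⟨?_, ?_, ?_, ?_⟩ <;> linarith

variable [DecidableEq P]

/-- The order of the quantifiers is that of the union and the intersection: E and `wp` are read off
from the encoding at step j, and the ages of the minus tokens are adapted to each `wm` afterwards.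
-/
theorem exists_mem_of_mem_ZENO {M : Marking P} (hM : M ∈ ZENO N) :
    ∃ E ∈ INFminStd N, ∃ wp ∈ permPlus E, ∀ wm ∈ permMinus E,
      M ∈ preStar N (MRUC.den ({Reg E wp wm} : MRUC P N.maxConst)) := by
  obtain ⟨m, π, rfl, hm⟩ := Set.mem_iUnion.1 hM
  obtain ⟨Δ, htail, hΔ⟩ := π.exists_isTail hm
  obtain ⟨i₀, j, hij, hlt1, hdisc, h0, hold⟩ := exists_steps htail hΔ
  have hΔij := htail.antitone hij
  obtain ⟨U, hU⟩ := exists_encodes N.maxConst (Δ j) (π.state j)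
  obtain ⟨E, hE, hEle⟩ := exists_INFminStd_le
    (htail.mem_INF hdisc (hΔij.trans_lt hlt1) h0 hU) ⟨rfl, rfl, rfl, rfl⟩
  obtain ⟨V, hVM, rfl, hrep⟩ := hU
  have hle : ∑ q : P × Sym N.maxConst, E (.tok q.1 q.2) • ({q} : Multiset _) ≤
      V.map fun v => (v.1, v.2.2) := by
    rw [Multiset.le_iff_count]
    rintro ⟨p, s⟩
    rw [count_sum_smul_singleton fun q : P × Sym N.maxConst => E (.tok q.1 q.2)]
    exact hEle (.tok p s)
  -- V' are the tokens counted by E and V₀ the surplus. V' splits into Ve (integer ages), Vp (plus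
  -- below max), Vm (minus) and Vx (above max).
  obtain ⟨V', hV', hVE⟩ := exists_le_of_le_map hle
  obtain ⟨V₀, rfl⟩ := Multiset.le_iff_exists_add.1 hV'
  rw [sum_tok_eq] at hVE
  obtain ⟨V₁, Vx, rfl, hV₁, hVx⟩ := exists_add_of_map_eq_add hVE
  obtain ⟨V₂, Vm, rfl, hV₂, hVm⟩ := exists_add_of_map_eq_add hV₁
  obtain ⟨Ve, Vp, rfl, hVe, hVp⟩ := exists_add_of_map_eq_add hV₂
  obtain ⟨Lp, hLps, hLp0, hLp1, hLpsum, hLptok⟩ := exists_plus_groups hVp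
    (δ := Δ j) fun v hv => hrep v (by simp [hv])
  refine ⟨E, hE, ⟨Lp.map Prod.snd, fun b hb => ?_⟩, mem_permPlus_iff.2 fun q => ?_,
    fun wm hwm => ?_⟩
  · obtain ⟨e, he, rfl⟩ := List.mem_map.1 hb
    exact hLp0 e he
  · rw [hLpsum]
    exact count_sum_smul_singleton (fun q : P × Fin N.maxConst => E (.tok q.1 (.plus q.2.castSucc)))
      q
  -- The new fractional parts must exceed those of the plus tokens, so that w₋ follows w₊, and also
  -- the time from i₀ to j, so that the exchanged tokens are older than k whenever they were created
  -- after i₀.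
  obtain ⟨c, hc1, hcD, hcp⟩ : ∃ c : ℝ≥0, c < 1 ∧ Δ i₀ - Δ j ≤ c ∧ ∀ e ∈ Lp, e.1 ≤ c := by
    refine ⟨(insert (Δ i₀ - Δ j) (Lp.map Prod.fst).toFinset).sup id, ?_, ?_, fun e he => ?_⟩
    · rw [Finset.sup_lt_iff (by exact one_pos)]
      intro x hx
      rcases Finset.mem_insert.1 hx with rfl | hx
      · exact tsub_le_self.trans_lt hlt1
      · obtain ⟨e, he, rfl⟩ := List.mem_map.1 (List.mem_toFinset.1 hx)
        exact (hLp1 e he).2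
    · exact Finset.le_sup (f := id) (Finset.mem_insert_self _ _)
    · exact Finset.le_sup (f := id) (Finset.mem_insert_of_mem (List.mem_toFinset.2
        (List.mem_map_of_mem he)))
  obtain ⟨fs, hfslen, hfs, hfs'⟩ := exists_increasing_list hc1 wm.1.length
  let Lm : List (ℝ≥0 × Multiset (P × Fin N.maxConst)) := fs.zip wm.1
  have hLm₁ : Lm.map Prod.fst = fs := List.map_fst_zip hfslen.le
  have hLm₂ : Lm.map Prod.snd = wm.1 := List.map_snd_zip hfslen.ge
  have hLm : ∀ e ∈ Lm, c < e.1 ∧ e.1 < 1 := fun e he =>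
    hfs' _ (hLm₁ ▸ List.mem_map_of_mem he)
  obtain ⟨W, hW₁, hW₂, hW⟩ := exists_minus_groups hΔij hVm (fun v hv => hrep v (by simp [hv]))
    (L := Lm) (by
      rw [hLm₂]
      ext q
      rw [mem_permMinus_iff.1 hwm]
      exact (count_sum_smul_singleton (fun q : P × Fin N.maxConst => E (.tok q.1 (.minus q.2)))
        q).symm)
    fun e he => ⟨hcD.trans_lt (hLm e he).1, (hLm e he).2⟩
  -- Only the tokens of Vm change their ages; all others are paired with themselves.
  obtain ⟨W', hW'₁, hW', hr⟩ := htail.exists_exchange hlt1 (j := j)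
    (V := (Ve + Vp + Vx + V₀).map (fun v => (v.1, v.2.1, v.2.1)) + W)
    (by
      rw [← hVM]
      simp only [Multiset.map_add, hW₁, Multiset.map_map, Function.comp_def]
      abel)
    (by
      intro v hv
      rcases Multiset.mem_add.1 hv with hv | hv
      · obtain ⟨u, _, rfl⟩ := Multiset.mem_map.1 hv
        exact .inl rfl
      · exact hW v hv) le_rfl hij
  -- At i₀ nothing has been exchanged: a token there that would exceed k + 1 later has reached it by
  -- step j, contrary to the first condition of an exchange.
  have hstart : W'.map (fun v => (v.1, v.2.2)) = π.state i₀ := by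
    rw [← hW'₁]
    refine Multiset.map_congr rfl fun v hv => ?_
    rcases hW' v hv with he | ⟨k, hk, h1, h2, -, -⟩
    · rw [he]
    · have := hold (v.1, v.2.1) (hW'₁ ▸ Multiset.mem_map_of_mem _ hv) ⟨k, hk⟩ h2
      exact absurd h1 (not_lt.2 this)
  rw [hstart] at hr
  refine ⟨_, ⟨_, Finset.mem_singleton_self _, _, Region.mem_den_iff.2 ⟨Lp ++ Lm,
    Vx.map fun v => (v.1, v.2.1), ?_, ?_, ?_, ?_, ?_, rfl⟩, ?_⟩,
    (π.reflTransGen (Nat.zero_le i₀)).trans hr⟩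
  · rw [List.map_append, hLm₂]; rfl
  · rw [List.pairwise_append]
    refine ⟨hLps, List.pairwise_map.1 (hLm₁ ▸ hfs), fun a ha b hb => ?_⟩
    exact (hcp a ha).trans_lt (hLm b hb).1
  · intro e he
    rcases List.mem_append.1 he with he | he
    exacts [hLp1 e he, ⟨zero_le.trans_lt (hLm e he).1, (hLm e he).2⟩]
  · have := congrArg (Multiset.map Prod.fst) hVx
    simpa [Multiset.map_map, Reg] using this
  · intro τ hτ
    obtain ⟨v, hv, rfl⟩ := Multiset.mem_map.1 hτ
    have h1 : (v.1, v.2.2) ∈ Vx.map fun v => (v.1, v.2.2) := Multiset.mem_map_of_mem _ hv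
    rw [hVx] at h1
    obtain ⟨p, _, hp⟩ := Multiset.mem_map.1 h1
    have h2 := (hrep v (by simp [hv])).1
    rw [← (Prod.ext_iff.1 hp).2] at h2
    exact h2.1
  · refine Multiset.le_iff_exists_add.2 ⟨V₀.map fun v => (v.1, v.2.1), ?_⟩
    have hex := exactTokens_eq hVe (δ := Δ j) fun v hv => hrep v (by simp [hv])
    change _ = exactTokens (∑ q : P × Fin (N.maxConst + 1), E (.tok q.1 (.exact q.2)) • {q}) +
      groupTokens (Lp ++ Lm) + _ + _
    rw [hex, groupTokens_append, hLptok, ← hW₂]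
    simp only [Multiset.map_add, Multiset.map_map, Function.comp_def]
    abel

theorem ZENO_subset_den {Z : MRUC P N.maxConst} (hZ : IsZ N Z) : ZENO N ⊆ Z.den := by
  obtain ⟨Q, hQ, hZ⟩ := hZ
  intro M hM
  obtain ⟨E, hE, wp, hwp, h⟩ := exists_mem_of_mem_ZENO hM
  rw [hZ]
  simp only [Set.mem_iUnion, Set.mem_iInter]
  exact ⟨E, hE, wp, hwp, fun wm hwm => by rw [hQ]; exact h wm hwm⟩

end Final

end TimedPetri

theorem mainTheorem2 {P T : Type*} [Fintype P] [DecidableEq P] [Fintype T]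
    (N : TimedPetri.TPN P T) :
    (∃ Z : TimedPetri.MRUC P N.maxConst, TimedPetri.IsZ N Z) ∧
      ∀ Z : TimedPetri.MRUC P N.maxConst, TimedPetri.IsZ N Z →
        Z.den = TimedPetri.ZENO N :=
  ⟨TimedPetri.exists_isZ N, fun _ hZ =>
    Set.Subset.antisymm (TimedPetri.den_subset_ZENO hZ) (TimedPetri.ZENO_subset_den hZ)⟩
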